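/- All rings are commutative and Noetherian. Let $(R,\mathfrak m,k)$ be a local Cohen--Macaulay ring of dimension $1$, let $Q(R)$ be its total ring of fractions, $\overline R$ the integral closure of $R$ in $Q(R)$, and $\mathfrak c=(R:\overline R)=\{r\in R : r\overline R\subseteq R\}$ the conductor. Let $I\subseteq\mathfrak m$ be an ideal containing a non-zerodivisor. A finitely generated module $M$ over a local ring $A$ is maximal Cohen--Macaulay if $\operatorname{depth} M\ge\dim A$ (so $0$ is maximal Cohen--Macaulay). For a local Cohen--Macaulay ring $A$ of dimension $1$ and an ideal $J$ of $A$, primary to the maximal ideal, $\operatorname{Ul}_J(A)$ denotes the class of $J$-Ulrich modules, i.e. of the maximal Cohen--Macaulay $A$-modules $M$ with $e_J(M)=\ell_A(M/JM)$, where $e_J$ is the Hilbert--Samuel multiplicity. $\operatorname{Ul}(A)$ is the class of Ulrich modules, i.e. of the maximal Cohen--Macaulay $A$-modules $M$ with $e_{\mathfrak m_A}(M)=\mu(M)$, the minimal number of generators; $A$ is called Ulrich split if every short exact sequence of Ulrich $A$-modules splits. Let $R\bowtie I=\{(a,b)\in R\times R : a-b\in I\}$ be the fiber product of $R$ with itself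 along $R/I$, with its ideal $I\times I$; let $B(I)=\bigcup_{n\ge1}(I^n:_{Q(R)}I^n)$ be the blow-up of $I$, and let $\operatorname{tr}(M)=\sum_{f\in\operatorname{Hom}_R(M,R)}f(M)$. The following conditions are equivalent: 1. every short exact sequence of modules in $\operatorname{Ul}_I(R)$ splits; 2. every short exact sequence of modules in $\operatorname{Ul}_{I\times I}(R\bowtie I)$ splits; 3. the ring $B(I)$ is regular; 4. for all $n\gg0$, $\operatorname{tr}(I^n)=\mathfrak c$ and $I^n$ is a reflexive $R$-module. If $I=\mathfrak m$, these conditions are also equivalent to each of 5. $\mathfrak m\operatorname{Ext}^1_R(M,N)=0$ for all $M,N\in\operatorname{Ul}(R)$; 6. the $\mathfrak m$-adic completion $\widehat R$ is Ulrich split. If moreover $I=\mathfrak m$, $R$ is not regular, and $R$ has minimal multiplicity (that is, $\mu(\mathfrak m)=e(R)+\dim R-1$), then the above conditions are also equivalent to each of 7. $\mathfrak m\cong\mathfrak c$ as $R$-modules; 8. $R$ is analytically unramified (that is, $\widehat R$ is reduced) and $\mathfrak m\operatorname{Ext}^1_R(\mathfrak c,\Omega_R\mathfrak c)=0$, where $\Omega_R\mathfrak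 c$ is the first syzygy in a minimal free resolution of $\mathfrak c$. -/

import Mathlib

open IsLocalRing Filter Topology
open scoped ENNReal Nat

universe u

noncomputable section

namespace UlrichSplit

/-! ### Maximal Cohen–Macaulay modules, multiplicity, Ulrich modules -/

/-- A finitely generated module over a local ring is maximal Cohen–Macaulay if
`depth M ≥ dim R`, i.e. if the maximal ideal contains an `M`-regular sequence of length `dim R`.
For `M ≠ 0` a weakly regular sequence in the maximal ideal is a regular sequence by Nakayama's
lemma; for `M = 0` (of infinite depth) every sequence is weakly regular, so that `0` is maximal
Cohen–Macaulay. -/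
def IsMCM (R : Type u) [CommRing R] [IsLocalRing R] (M : Type u) [AddCommGroup M] [Module R M] :
    Prop :=
  Module.Finite R M ∧
    ∃ rs : List R, (rs.length : WithBot ℕ∞) = ringKrullDim R ∧ (∀ r ∈ rs, r ∈ maximalIdeal R) ∧
      RingTheory.Sequence.IsWeaklyRegular M rs

/-- A (Noetherian) local ring is Cohen–Macaulay if `depth R ≥ dim R`. -/
def IsCohenMacaulayLocal (R : Type u) [CommRing R] [IsLocalRing R] : Prop :=
  IsMCM R R

/-- `e` is the Hilbert–Samuel multiplicity `e_I(M) = lim d! ℓ(M / Iⁿ M) / n ^ d`, where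
`d = dim R`. -/
def HasMultiplicity {R : Type u} [CommRing R] (I : Ideal R) (M : Type u) [AddCommGroup M]
    [Module R M] (e : ℝ≥0∞) : Prop :=
  ∃ d : ℕ, ringKrullDim R = d ∧
    Tendsto (fun n : ℕ =>
      ((d ! : ℕ) : ℝ≥0∞) * (Module.length R (M ⧸ (I ^ n • ⊤ : Submodule R M)) : ℝ≥0∞) /
        (n : ℝ≥0∞) ^ d) atTop (𝓝 e)

/-- `μ(M)`, the minimal number of generators of a finitely generated module. -/
def mu (R : Type u) [CommRing R] (M : Type u) [AddCommGroup M] [Module R M] : ℕ :=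
  (⊤ : Submodule R M).spanFinrank

/-- A maximal Cohen–Macaulay module `M` is `I`-Ulrich if `e_I(M) = ℓ(M / I M)`. -/
def IsUlrichWrt {R : Type u} [CommRing R] [IsLocalRing R] (I : Ideal R) (M : Type u)
    [AddCommGroup M] [Module R M] : Prop :=
  IsMCM R M ∧ HasMultiplicity I M (Module.length R (M ⧸ (I • ⊤ : Submodule R M)) : ℝ≥0∞)

/-- A maximal Cohen–Macaulay module `M` is Ulrich if `e_𝔪(M) = μ(M)`. -/
def IsUlrich (R : Type u) [CommRing R] [IsLocalRing R] (M : Type u) [AddCommGroup M]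
    [Module R M] : Prop :=
  IsMCM R M ∧ HasMultiplicity (maximalIdeal R) M (mu R M : ℝ≥0∞)

/-- Every short exact sequence `0 → A → B → C → 0` of `R`-modules whose three terms satisfy `P`
splits. -/
def AllSplit (R : Type u) [CommRing R]
    (P : ∀ (M : Type u) [AddCommGroup M] [Module R M], Prop) : Prop :=
  ∀ (A B C : Type u) [AddCommGroup A] [Module R A] [AddCommGroup B] [Module R B]
    [AddCommGroup C] [Module R C], P A → P B → P C →
    ∀ (f : A →ₗ[R] B) (g : B →ₗ[R] C), Function.Injective f → Function.Exact f g →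
      Function.Surjective g → ∃ s : C →ₗ[R] B, g ∘ₗ s = LinearMap.id

/-- Every short exact sequence of modules in `Ul_I(R)` splits. -/
def UlrichSequencesSplit {R : Type u} [CommRing R] [IsLocalRing R] (I : Ideal R) : Prop :=
  AllSplit R (fun M _ _ => IsUlrichWrt I M)

/-- `R` is Ulrich split: every short exact sequence of Ulrich modules splits. -/
def IsUlrichSplit (R : Type u) [CommRing R] [IsLocalRing R] : Prop :=
  AllSplit R (fun M _ _ => IsUlrich R M)

/-- `R` has minimal multiplicity: `μ(𝔪) = e(R) + dim R - 1`. -/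
def HasMinimalMultiplicity (R : Type u) [CommRing R] [IsLocalRing R] : Prop :=
  ∃ d e : ℕ, ringKrullDim R = d ∧ HasMultiplicity (maximalIdeal R) R (e : ℝ≥0∞) ∧
    mu R (maximalIdeal R) + 1 = e + d

/-- The completion of a local ring at its maximal ideal. -/
abbrev Completion (R : Type u) [CommRing R] [IsLocalRing R] : Type u :=
  AdicCompletion (maximalIdeal R) R

/-- `R` is analytically unramified: its completion is reduced. -/
def IsAnalyticallyUnramified (R : Type u) [CommRing R] [IsLocalRing R] : Prop :=
  IsReduced (Completion R)

/-! ### Ideals and birational extensions inside the total ring of fractions -/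

/-- A regular ideal: one that contains a non-zerodivisor. -/
def IsRegularIdeal {R : Type u} [CommRing R] (I : Ideal R) : Prop :=
  ∃ x ∈ I, x ∈ nonZeroDivisors R

/-- The ideal `J` as an `R`-submodule of the total ring of fractions `Q(R)`. -/
abbrev inQ {R : Type u} [CommRing R] (J : Ideal R) : Submodule R (FractionRing R) :=
  IsLocalization.coeSubmodule (FractionRing R) J

lemma colon_mono {R : Type u} [CommRing R] (I : Ideal R) {m n : ℕ} (h : m ≤ n) :
    inQ (I ^ m) / inQ (I ^ m) ≤ inQ (I ^ n) / inQ (I ^ n) := by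
  obtain ⟨k, rfl⟩ := Nat.exists_eq_add_of_le h
  have h2 : inQ (I ^ (m + k)) = inQ (I ^ m) * inQ (I ^ k) := by
    rw [pow_add]
    exact IsLocalization.coeSubmodule_mul _ _ _
  rw [Submodule.le_div_iff_mul_le, h2, ← mul_assoc]
  exact mul_le_mul' (Submodule.le_div_iff_mul_le.mp le_rfl) le_rfl

/-- The blow-up `B(I) = ⋃_{n ≥ 1} (Iⁿ : Iⁿ)`, a subring of `Q(R)` containing `R`; here `/` is the
colon of submodules of `Q(R)`. -/
def blowUp {R : Type u} [CommRing R] (I : Ideal R) : Subalgebra R (FractionRing R) where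
  carrier := {q | ∃ n : ℕ, 1 ≤ n ∧ q ∈ inQ (I ^ n) / inQ (I ^ n)}
  mul_mem' := by
    rintro a b ⟨m, hm, ha⟩ ⟨n, hn, hb⟩
    have ha' := colon_mono I (le_max_left m n) ha
    have hb' := colon_mono I (le_max_right m n) hb
    refine ⟨max m n, le_max_of_le_left hm, ?_⟩
    rw [Submodule.mem_div_iff_forall_mul_mem] at ha' hb' ⊢
    intro y hy
    rw [mul_assoc]
    exact ha' _ (hb' y hy)
  add_mem' := by
    rintro a b ⟨m, hm, ha⟩ ⟨n, hn, hb⟩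
    exact ⟨max m n, le_max_of_le_left hm, Submodule.add_mem _
      (colon_mono I (le_max_left m n) ha) (colon_mono I (le_max_right m n) hb)⟩
  algebraMap_mem' r := by
    refine ⟨1, le_rfl, ?_⟩
    rw [Submodule.mem_div_iff_forall_mul_mem]
    intro y hy
    rw [← Algebra.smul_def]
    exact Submodule.smul_mem _ r hy

/-- The conductor `𝔠 = (R : R̄)` of the integral closure `R̄` of `R` in `Q(R)`, as an ideal of
`R`. -/
def conductorIdeal (R : Type u) [CommRing R] : Ideal R :=
  Submodule.comap (Algebra.linearMap R (FractionRing R))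
    ((1 : Submodule R (FractionRing R)) /
      Subalgebra.toSubmodule (integralClosure R (FractionRing R)))

/-- The trace ideal `tr(M) = ∑_{f : M → R} f(M)`. -/
def traceIdeal (R : Type u) [CommRing R] (M : Type u) [AddCommGroup M] [Module R M] : Ideal R :=
  ⨆ f : M →ₗ[R] R, LinearMap.range f

/-! ### The fiber product `R ⋈ I = R ×_{R/I} R` -/

/-- The fiber product of `R` with itself along `R / I`, i.e. the subring
`{(a, b) | a + I = b + I}` of `R × R`. -/
def fiberSquare {R : Type u} [CommRing R] (I : Ideal R) : Subring (R × R) :=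
  RingHom.eqLocus ((Ideal.Quotient.mk I).comp (RingHom.fst R R))
    ((Ideal.Quotient.mk I).comp (RingHom.snd R R))

/-- The ideal `I × I` of `R ⋈ I`. -/
def fiberSquareIdeal {R : Type u} [CommRing R] (I : Ideal R) : Ideal (fiberSquare I) :=
  (I.prod I).comap (fiberSquare I).subtype

theorem isLocalRing_fiberSquare {R : Type u} [CommRing R] [IsLocalRing R] {I : Ideal R}
    (hI : I ≤ maximalIdeal R) : IsLocalRing (fiberSquare I) := by
  let p : fiberSquare I →+* R := (RingHom.fst R R).comp (fiberSquare I).subtype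
  have hp : IsLocalHom p := by
    refine ⟨?_⟩
    rintro ⟨⟨a, b⟩, hab⟩ ha
    have hab' : a - b ∈ I := Ideal.Quotient.eq.mp hab
    have ha' : IsUnit a := ha
    have hb : IsUnit b := by
      by_contra hb
      have h1 : b ∈ maximalIdeal R := hb
      have h2 : a ∈ maximalIdeal R := by
        have := Ideal.add_mem _ (hI hab') h1
        simpa using this
      exact h2 ha'
    obtain ⟨c, hc⟩ := ha'.exists_right_inv
    obtain ⟨d, hd⟩ := hb.exists_right_inv
    have hcd : c - d ∈ I := by
      have h3 : c - d = -(c * d) * (a - b) := by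
        linear_combination d * hc - c * hd
      rw [h3]
      exact I.mul_mem_left _ hab'
    refine IsUnit.of_mul_eq_one (⟨(c, d), Ideal.Quotient.eq.mpr hcd⟩ : fiberSquare I) ?_
    apply Subtype.ext
    exact Prod.ext hc hd
  exact RingHom.domain_isLocalRing p

/-! ### `Ext` and syzygies -/

/-- `𝔪 · Ext¹_R(M, N) = 0`. -/
def MaximalIdealKillsExt (R : Type u) [CommRing R] [IsLocalRing R] (M N : Type u)
    [AddCommGroup M] [Module R M] [AddCommGroup N] [Module R N] : Prop :=
  ∀ r ∈ maximalIdeal R, ∀ x : CategoryTheory.Abelian.Ext (ModuleCat.of R M) (ModuleCat.of R N) 1,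
    r • x = 0

theorem exists_minimalCover (R : Type u) [CommRing R] (M : Type u) [AddCommGroup M] [Module R M]
    [Module.Finite R M] :
    ∃ f : (Fin (mu R M) → R) →ₗ[R] M, Function.Surjective f := by
  obtain ⟨s, hs, hspan⟩ :=
    Submodule.FG.exists_span_finset_card_eq_spanFinrank (Module.Finite.fg_top (R := R) (M := M))
  let v : Fin (mu R M) → M := fun i => (s.equivFinOfCardEq hs).symm i
  refine ⟨Fintype.linearCombination R v, ?_⟩
  rw [← LinearMap.range_eq_top, Fintype.range_linearCombination, ← hspan]
  congr 1
  ext x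
  constructor
  · rintro ⟨i, rfl⟩
    exact ((s.equivFinOfCardEq hs).symm i).2
  · intro hx
    exact ⟨s.equivFinOfCardEq hs ⟨x, hx⟩, by simp [v]⟩

/-- The first step `R ^ μ(M) → M` of a minimal free resolution of `M`. -/
def minimalCover (R : Type u) [CommRing R] (M : Type u) [AddCommGroup M] [Module R M]
    [Module.Finite R M] : (Fin (mu R M) → R) →ₗ[R] M :=
  (exists_minimalCover R M).choose

/-- The first syzygy `Ω_R M` in a minimal free resolution of `M`. -/
abbrev syzygy (R : Type u) [CommRing R] (M : Type u) [AddCommGroup M] [Module R M]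
    [Module.Finite R M] : Submodule R (Fin (mu R M) → R) :=
  LinearMap.ker (minimalCover R M)

end UlrichSplit

end

open UlrichSplit

namespace UlrichSplit

section RelLength

open scoped Pointwise

variable {R : Type*} [CommRing R] {M M' : Type*} [AddCommGroup M] [Module R M]
  [AddCommGroup M'] [Module R M']

/-- The length of `P / (P ∩ N)` for submodules `P`, `N` of a module. -/
noncomputable def relLength (P N : Submodule R M) : ℕ∞ :=
  Module.length R (P ⧸ N.comap P.subtype)

lemma relLength_add {N P Q : Submodule R M} (h₁ : N ≤ P) (h₂ : P ≤ Q) :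
    relLength Q N = relLength P N + relLength Q P := by
  let f : (P ⧸ N.comap P.subtype) →ₗ[R] (Q ⧸ N.comap Q.subtype) :=
    Submodule.mapQ _ _ (Submodule.inclusion h₂) (fun x hx => hx)
  let g : (Q ⧸ N.comap Q.subtype) →ₗ[R] (Q ⧸ P.comap Q.subtype) :=
    Submodule.mapQ _ _ LinearMap.id (fun x hx => h₁ hx)
  refine Module.length_eq_add_of_exact f g ?_ ?_ ?_
  · rw [← LinearMap.ker_eq_bot, LinearMap.ker_eq_bot']
    intro x hx
    obtain ⟨x, rfl⟩ := Submodule.Quotient.mk_surjective _ x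
    rw [Submodule.Quotient.mk_eq_zero]
    exact (Submodule.Quotient.mk_eq_zero (N.comap Q.subtype)).mp hx
  · intro x
    obtain ⟨x, rfl⟩ := Submodule.Quotient.mk_surjective _ x
    exact ⟨Submodule.Quotient.mk x, rfl⟩
  · intro x
    obtain ⟨x, rfl⟩ := Submodule.Quotient.mk_surjective _ x
    constructor
    · intro hx
      exact ⟨Submodule.Quotient.mk ⟨x, (Submodule.Quotient.mk_eq_zero (P.comap Q.subtype)).mp hx⟩, rfl⟩
    · rintro ⟨z, hz⟩
      obtain ⟨z, rfl⟩ := Submodule.Quotient.mk_surjective _ z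
      have h3 : (z : M) - x ∈ P := h₁ ((Submodule.Quotient.eq (N.comap Q.subtype)).mp hz)
      have h4 := P.sub_mem z.2 h3
      rw [sub_sub_cancel] at h4
      exact (Submodule.Quotient.mk_eq_zero (P.comap Q.subtype)).mpr h4

lemma relLength_map (f : M →ₗ[R] M') (hf : Function.Injective f) (P N : Submodule R M) :
    relLength (P.map f) (N.map f) = relLength P N := by
  refine (LinearEquiv.length_eq (Submodule.Quotient.equiv _ _
    (Submodule.equivMapOfInjective f hf P) ?_)).symm
  ext ⟨x, hx⟩
  obtain ⟨x, hx, rfl⟩ := hx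
  constructor
  · rintro ⟨z, hz, hzx⟩
    exact ⟨z, hz, congrArg Subtype.val hzx⟩
  · rintro ⟨z, hz, hzx⟩
    obtain rfl := hf hzx
    exact ⟨⟨z, hx⟩, hz, rfl⟩

lemma relLength_top (N : Submodule R M) : relLength ⊤ N = Module.length R (M ⧸ N) := by
  refine LinearEquiv.length_eq (Submodule.Quotient.equiv _ _ Submodule.topEquiv ?_)
  ext x
  constructor
  · rintro ⟨z, hz, rfl⟩
    exact hz
  · intro hx
    exact ⟨⟨x, trivial⟩, hx, rfl⟩

lemma relLength_self (P : Submodule R M) : relLength P P = 0 := by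
  rw [relLength, Module.length_eq_zero_iff, Submodule.comap_subtype_self]
  exact Submodule.Quotient.subsingleton_iff.mpr rfl

lemma relLength_smul {t : R} (ht : IsSMulRegular M t) (P N : Submodule R M) :
    relLength (t • P) (t • N) = relLength P N :=
  relLength_map (LinearMap.lsmul R M t) ht P N

lemma relLength_eq_zero_iff {N P : Submodule R M} : relLength P N = 0 ↔ P ≤ N := by
  rw [relLength, Module.length_eq_zero_iff, Submodule.Quotient.subsingleton_iff,
    Submodule.comap_subtype_eq_top]

lemma relLength_le_of_comap_le (f : M →ₗ[R] M') {P N : Submodule R M} {P' N' : Submodule R M'}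
    (hP : ∀ v ∈ P, f v ∈ P') (hN : ∀ v ∈ P, f v ∈ N' → v ∈ N) :
    relLength P N ≤ relLength P' N' := by
  let g : P →ₗ[R] (P' ⧸ N'.comap P'.subtype) :=
    (N'.comap P'.subtype).mkQ ∘ₗ (f ∘ₗ P.subtype).codRestrict P' (fun v => hP v v.2)
  have hg : LinearMap.ker g ≤ N.comap P.subtype := by
    intro v hv
    refine hN v v.2 ?_
    exact (Submodule.Quotient.mk_eq_zero (N'.comap P'.subtype)).mp hv
  calc relLength P N ≤ Module.length R (P ⧸ LinearMap.ker g) := by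
        refine Module.length_le_of_surjective (Submodule.mapQ (LinearMap.ker g)
          (N.comap P.subtype) LinearMap.id hg) ?_
        intro x
        obtain ⟨x, rfl⟩ := Submodule.Quotient.mk_surjective _ x
        exact ⟨Submodule.Quotient.mk x, rfl⟩
    _ ≤ _ := Module.length_le_of_injective ((LinearMap.ker g).liftQ g le_rfl) (by
        rw [← LinearMap.ker_eq_bot, Submodule.ker_liftQ_eq_bot _ _ _ le_rfl])

/-- For `t` a non-zerodivisor on `M` the length of `P / t P` does not change when `P` is replaced
by a submodule of finite colength. -/
lemma relLength_smul_self_eq {P N : Submodule R M}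
    {t : R} (ht : IsSMulRegular M t) (hNP : N ≤ P) (hfin : relLength P N ≠ ⊤) :
    relLength N (t • N) = relLength P (t • P) := by
  have h1 := relLength_add (Submodule.smul_le_self_of_tower t N) hNP
  have h2 := relLength_add (Submodule.map_mono hNP : t • N ≤ t • P)
    (Submodule.smul_le_self_of_tower t P)
  have h3 := relLength_smul ht P N
  change relLength P (t • N) = relLength (t • P) (t • N) + relLength P (t • P) at h2
  rw [h3, h1, add_comm] at h2
  exact ENat.add_right_injective_of_ne_top hfin h2

end RelLength

/-- A local ring of dimension one whose maximal ideal contains a non-zerodivisor. For Noetherian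
rings these are the Cohen–Macaulay local rings of dimension one. -/
class IsOneDimCM (R : Type*) [CommRing R] [IsLocalRing R] : Prop where
  ringKrullDim_eq : ringKrullDim R = 1
  exists_mem : ∃ t ∈ maximalIdeal R, t ∈ nonZeroDivisors R

section OneDim

open scoped Pointwise

variable {R : Type*} [CommRing R] [IsLocalRing R] [IsNoetherianRing R]

lemma isOneDimCM_of_pow_le {t : R} (htm : t ∈ maximalIdeal R) (ht : t ∈ nonZeroDivisors R) {k : ℕ}
    (hk : maximalIdeal R ^ k ≤ Ideal.span {t}) : IsOneDimCM R := by
  refine ⟨?_, t, htm, ht⟩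
  have hmin : maximalIdeal R ∈ (Ideal.span {t}).minimalPrimes := by
    refine ⟨⟨inferInstance, (Ideal.span_singleton_le_iff_mem _).mpr htm⟩, ?_⟩
    rintro p ⟨hp, htp⟩ -
    exact hp.le_of_pow_le (hk.trans htp)
  apply le_antisymm
  · rw [← maximalIdeal_height_eq_ringKrullDim]
    exact_mod_cast Ideal.height_le_one_of_isPrincipal_of_mem_minimalPrimes _ _ hmin
  · rw [← ringKrullDim_quotient_span_singleton_succ_eq_ringKrullDim_of_mem_nonZeroDivisors ht htm]
    have : Nontrivial (R ⧸ Ideal.span {t}) := Ideal.Quotient.nontrivial_iff.mpr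
      (fun h => (maximalIdeal.isMaximal R).ne_top (top_le_iff.mp (h ▸
        (Ideal.span_singleton_le_iff_mem _).mpr htm)))
    have h0 : (0 : WithBot ℕ∞) ≤ ringKrullDim (R ⧸ Ideal.span {t}) :=
      ringKrullDim_nonneg_of_nontrivial
    calc (1 : WithBot ℕ∞) = 0 + 1 := by simp
      _ ≤ _ := by gcongr

variable [IsOneDimCM R]

lemma exists_pow_le_span {t : R} (ht : t ∈ nonZeroDivisors R) :
    ∃ k : ℕ, maximalIdeal R ^ k ≤ Ideal.span {t} := by
  by_cases htm : t ∈ maximalIdeal R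
  · have h1 := ringKrullDim_quotient_span_singleton_succ_eq_ringKrullDim_of_mem_nonZeroDivisors
      ht htm
    rw [IsOneDimCM.ringKrullDim_eq (R := R)] at h1
    have hnt : Nontrivial (R ⧸ Ideal.span {t}) := Ideal.Quotient.nontrivial_iff.mpr
      (fun h => (maximalIdeal.isMaximal R).ne_top (top_le_iff.mp (h ▸
        (Ideal.span_singleton_le_iff_mem _).mpr htm)))
    have h2 : ringKrullDim (R ⧸ Ideal.span {t}) = 0 := by
      obtain ⟨d, hd⟩ := WithBot.ne_bot_iff_exists.mp
        (ne_bot_of_le_ne_bot WithBot.zero_ne_bot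
          (ringKrullDim_nonneg_of_nontrivial (R := R ⧸ Ideal.span {t})))
      rw [← hd] at h1 ⊢
      have h3 : d + 1 = 0 + 1 := by
        rw [zero_add]
        exact_mod_cast h1
      rw [ENat.add_left_injective_of_ne_top ENat.one_ne_top h3]
      rfl
    have h3 : Ring.KrullDimLE 0 (R ⧸ Ideal.span {t}) :=
      ringKrullDimZero_iff_ringKrullDim_eq_zero.mpr h2
    have h4 := isArtinianRing_iff_krullDimLE_zero.mpr h3
    have : IsLocalRing (R ⧸ Ideal.span {t}) :=
      .of_surjective' (Ideal.Quotient.mk _) Ideal.Quotient.mk_surjective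
    obtain ⟨k, hk⟩ := (isArtinianRing_iff_isNilpotent_maximalIdeal _).mp h4
    refine ⟨k, ?_⟩
    have h5 : Ideal.map (Ideal.Quotient.mk (Ideal.span {t})) (maximalIdeal R ^ k) ≤ ⊥ := by
      rw [Ideal.map_pow]
      refine (Ideal.pow_right_mono ?_ k).trans hk.le
      exact ((local_hom_TFAE (Ideal.Quotient.mk (Ideal.span {t}))).out 0 2).mp
        (IsLocalHom.of_surjective _ Ideal.Quotient.mk_surjective)
    rw [Ideal.map_le_iff_le_comap] at h5
    intro z hz
    exact Ideal.Quotient.eq_zero_iff_mem.mp (h5 hz)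
  · exact ⟨0, by
      rw [Ideal.span_singleton_eq_top.mpr (by simpa using htm)]
      exact le_top⟩

lemma length_quotient_span_ne_top {t : R} (ht : t ∈ nonZeroDivisors R) :
    Module.length R (R ⧸ Ideal.span {t}) ≠ ⊤ := by
  obtain ⟨k, hk⟩ := exists_pow_le_span ht
  have : IsArtinianRing (R ⧸ maximalIdeal R ^ k) := by
    rcases Nat.eq_zero_or_pos k with rfl | hk0
    · have : Subsingleton (R ⧸ maximalIdeal R ^ 0) := by
        rw [pow_zero]
        exact Ideal.Quotient.subsingleton_iff.mpr Ideal.one_eq_top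
      infer_instance
    · have : Nontrivial (R ⧸ maximalIdeal R ^ k) := Ideal.Quotient.nontrivial_iff.mpr
        (fun h => (maximalIdeal.isMaximal R).ne_top
          (top_le_iff.mp (h ▸ Ideal.pow_le_self hk0.ne')))
      have : IsLocalRing (R ⧸ maximalIdeal R ^ k) :=
        .of_surjective' (Ideal.Quotient.mk _) Ideal.Quotient.mk_surjective
      refine (isArtinianRing_iff_isNilpotent_maximalIdeal _).mpr ⟨k, ?_⟩
      have h1 : maximalIdeal (R ⧸ maximalIdeal R ^ k) =
          (maximalIdeal R).map (Ideal.Quotient.mk _) :=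
        (IsLocalRing.map_maximalIdeal_of_surjective _ Ideal.Quotient.mk_surjective).symm
      rw [h1, ← Ideal.map_pow, Ideal.map_quotient_self]
      rfl
  have h2 : IsArtinian R (R ⧸ maximalIdeal R ^ k) := by
    have h3 : IsArtinian (R ⧸ maximalIdeal R ^ k) (R ⧸ maximalIdeal R ^ k) := this
    exact isArtinian_of_surjective_algebraMap (R := R ⧸ maximalIdeal R ^ k)
      Ideal.Quotient.mk_surjective
  have h4 : Module.length R (R ⧸ maximalIdeal R ^ k) ≠ ⊤ := Module.length_ne_top
  refine ne_top_of_le_ne_top h4 (Module.length_le_of_surjective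
    (Submodule.mapQ (maximalIdeal R ^ k) (Ideal.span {t}) LinearMap.id hk) ?_)
  intro x
  obtain ⟨x, rfl⟩ := Submodule.Quotient.mk_surjective _ x
  exact ⟨Submodule.Quotient.mk x, rfl⟩

lemma length_ne_top_of_smul_eq_zero {M : Type*} [AddCommGroup M] [Module R M] [Module.Finite R M]
    {t : R} (ht : t ∈ nonZeroDivisors R) (h : ∀ v : M, t • v = 0) :
    Module.length R M ≠ ⊤ := by
  obtain ⟨n, f, hf⟩ := Module.Finite.exists_fin' R M
  let g : (Fin n → R ⧸ Ideal.span {t}) →ₗ[R] M :=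
    ((Submodule.pi Set.univ fun _ => Ideal.span {t}).liftQ f (by
      intro v hv
      rw [Submodule.mem_pi] at hv
      choose w hw using fun i => Ideal.mem_span_singleton'.mp (hv i trivial)
      have : v = t • w := by
        ext i
        simp [← hw i, mul_comm]
      rw [LinearMap.mem_ker, this, map_smul, h])) ∘ₗ
      (Submodule.quotientPi fun _ : Fin n => Ideal.span {t}).symm.toLinearMap
  have hg : Function.Surjective g := by
    intro v
    obtain ⟨w, rfl⟩ := hf v
    refine ⟨Submodule.quotientPi _ (Submodule.Quotient.mk w), ?_⟩
    simp [g]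
  refine ne_top_of_le_ne_top ?_ (Module.length_le_of_surjective g hg)
  rw [Module.length_pi, ENat.card_eq_coe_fintype_card]
  exact WithTop.mul_ne_top (ENat.natCast_ne_top _) (length_quotient_span_ne_top ht)

lemma relLength_ne_top {M : Type*} [AddCommGroup M] [Module R M] {P N : Submodule R M}
    (hP : P.FG) {t : R} (ht : t ∈ nonZeroDivisors R) (h : t • P ≤ N) : relLength P N ≠ ⊤ := by
  have : Module.Finite R P := Module.Finite.iff_fg.mpr hP
  refine length_ne_top_of_smul_eq_zero ht fun v => ?_
  obtain ⟨v, rfl⟩ := Submodule.Quotient.mk_surjective _ v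
  rw [← Submodule.Quotient.mk_smul, Submodule.Quotient.mk_eq_zero]
  exact h (Submodule.smul_mem_pointwise_smul _ _ _ v.2)

end OneDim

section MCM

variable {R : Type u} [CommRing R] [IsLocalRing R]

lemma isOneDimCM_of_isCohenMacaulayLocal (hCM : IsCohenMacaulayLocal R)
    (hdim : ringKrullDim R = 1) : IsOneDimCM R := by
  refine ⟨hdim, ?_⟩
  obtain ⟨-, rs, hlen, hmem, hreg⟩ := hCM
  rw [hdim] at hlen
  have hlen' : rs.length = 1 := by exact_mod_cast hlen
  obtain ⟨t, rfl⟩ := List.length_eq_one_iff.mp hlen'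
  refine ⟨t, hmem t (by simp), ?_⟩
  rw [RingTheory.Sequence.isWeaklyRegular_singleton_iff] at hreg
  rw [mem_nonZeroDivisors_iff_right]
  intro z hz
  exact hreg (by simpa [mul_comm] using hz)

lemma isMCM_iff [IsNoetherianRing R] [IsOneDimCM R] (M : Type u) [AddCommGroup M] [Module R M] :
    IsMCM R M ↔ Module.Finite R M ∧ Module.IsTorsionFree R M := by
  constructor
  · rintro ⟨hfin, rs, hlen, hmem, hreg⟩
    rw [IsOneDimCM.ringKrullDim_eq] at hlen
    have hlen' : rs.length = 1 := by exact_mod_cast hlen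
    obtain ⟨x, rfl⟩ := List.length_eq_one_iff.mp hlen'
    rw [RingTheory.Sequence.isWeaklyRegular_singleton_iff] at hreg
    refine ⟨hfin, ⟨fun t ht => ?_⟩⟩
    obtain ⟨k, hk⟩ := exists_pow_le_span (isRegular_iff_mem_nonZeroDivisors.mp ht)
    have hx : x ^ k ∈ Ideal.span {t} := hk (Ideal.pow_mem_pow (hmem x (by simp)) k)
    obtain ⟨y, hy⟩ := Ideal.mem_span_singleton'.mp hx
    refine IsSMulRegular.of_smul (s := t) y ?_
    rw [smul_eq_mul, hy]
    exact hreg.pow k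
  · rintro ⟨hfin, htf⟩
    obtain ⟨t, htm, ht⟩ := IsOneDimCM.exists_mem (R := R)
    refine ⟨hfin, [t], ?_, by simpa using htm, ?_⟩
    · rw [IsOneDimCM.ringKrullDim_eq]; rfl
    · rw [RingTheory.Sequence.isWeaklyRegular_singleton_iff]
      exact htf.isSMulRegular (isRegular_iff_mem_nonZeroDivisors.mpr ht)

end MCM

end UlrichSplit

namespace UlrichSplit

section Reduction

open Polynomial
open scoped Pointwise

/-- `x ∈ I ^ r` generates a reduction of `I ^ r`, where `r ≥ 1`: `x I ^ n = I ^ (n + r)` for all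
large `n`. -/
structure IsReduction {R : Type*} [CommRing R] (I : Ideal R) (r : ℕ) (x : R) : Prop where
  one_le : 1 ≤ r
  mem : x ∈ I ^ r
  exists_forall_le : ∃ n₀, ∀ n ≥ n₀, I ^ (n + r) ≤ Ideal.span {x} * I ^ n

section Monomial

variable {R : Type*} [CommRing R] {I : Ideal R}

/-- The element `f T ^ n` of the Rees algebra, for `f ∈ I ^ n`. -/
noncomputable def reesMonomial {n : ℕ} {f : R} (h : f ∈ I ^ n) : reesAlgebra I :=
  ⟨monomial n f, reesAlgebra.monomial_mem.mpr h⟩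

lemma coeff_mem_of_mem_map {J : Ideal R} {p : reesAlgebra I}
    (hp : p ∈ J.map (algebraMap R (reesAlgebra I))) (n : ℕ) : (p : R[X]).coeff n ∈ J * I ^ n := by
  induction hp using Submodule.span_induction generalizing n with
  | mem q hq =>
    obtain ⟨a, ha, rfl⟩ := hq
    change (C a : R[X]).coeff n ∈ _
    rw [coeff_C]
    split_ifs with h
    · simpa [h] using ha
    · exact zero_mem _
  | zero => exact zero_mem _
  | add q q' _ _ hq hq' =>
    rw [Subalgebra.coe_add, coeff_add]
    exact add_mem (hq n) (hq' n)
  | smul b q _ hq =>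
    rw [smul_eq_mul, Subalgebra.coe_mul, coeff_mul]
    refine sum_mem fun ij hij => ?_
    have h1 := Ideal.mul_mem_mul (b.2 ij.1) (hq ij.2)
    rwa [mul_left_comm, ← pow_add, Finset.HasAntidiagonal.mem_antidiagonal.mp hij] at h1

lemma reesMonomial_mem_map_iff {J : Ideal R} {n : ℕ} {f : R} (h : f ∈ I ^ n) :
    reesMonomial h ∈ J.map (algebraMap R (reesAlgebra I)) ↔ f ∈ J * I ^ n := by
  constructor
  · intro hf
    simpa [reesMonomial] using coeff_mem_of_mem_map hf n
  · intro hf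
    have hle : J * I ^ n ≤ I ^ n := Ideal.mul_le_right
    have key : ∀ g ∈ J * I ^ n, ∀ hg : g ∈ I ^ n,
        reesMonomial hg ∈ J.map (algebraMap R (reesAlgebra I)) := by
      intro g hg
      induction hg using Submodule.mul_induction_on' with
      | mem_mul_mem a ha b hb =>
        intro hg
        have : reesMonomial hg = algebraMap R (reesAlgebra I) a * reesMonomial hb := by
          apply Subtype.ext
          change monomial n (a * b) = C a * monomial n b
          rw [C_mul_monomial]
        rw [this]
        exact Ideal.mul_mem_right _ _ (Ideal.mem_map_of_mem _ ha)
      | add a ha b hb iha ihb =>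
        intro hg
        have ha' : a ∈ I ^ n := hle ha
        have hb' : b ∈ I ^ n := hle hb
        have : reesMonomial hg = reesMonomial ha' + reesMonomial hb' := by
          apply Subtype.ext
          change monomial n (a + b) = monomial n a + monomial n b
          rw [map_add]
        rw [this]
        exact add_mem (iha ha') (ihb hb')
    exact key f hf h

lemma mem_of_reesMonomial_mem_span_sup {J : Ideal R} {r n : ℕ} {x f : R} (hx : x ∈ I ^ r)
    (h : f ∈ I ^ (n + r))
    (hf : reesMonomial h ∈ Ideal.span {reesMonomial hx} ⊔ J.map (algebraMap R (reesAlgebra I))) :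
    f ∈ Ideal.span {x} * I ^ n ⊔ J * I ^ (n + r) := by
  obtain ⟨p, hp, q, hq, hpq⟩ := Submodule.mem_sup.mp hf
  obtain ⟨b, rfl⟩ := Ideal.mem_span_singleton'.mp hp
  have h1 := congrArg (fun z : reesAlgebra I => (z : R[X]).coeff (n + r)) hpq
  have h2 : (b : R[X]).coeff n * x + (q : R[X]).coeff (n + r) = f := by
    simpa [reesMonomial, coeff_mul_monomial] using h1
  rw [← h2]
  refine Submodule.add_mem_sup ?_ (coeff_mem_of_mem_map hq _)
  rw [mul_comm (Polynomial.coeff _ _)]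
  exact Ideal.mul_mem_mul (Ideal.mem_span_singleton_self x) (b.2 n)

lemma reesMonomial_mem_pow {n : ℕ} {f : R} (h : f ∈ I ^ n) :
    reesMonomial h ∈ (Ideal.span {p | ∃ a, ∃ ha : a ∈ I ^ 1, p = reesMonomial ha}) ^ n := by
  induction n generalizing f with
  | zero => simp
  | succ n ih =>
    have key : ∀ g ∈ I ^ n * I, ∀ hg : g ∈ I ^ (n + 1),
        reesMonomial hg ∈
          (Ideal.span {p | ∃ a, ∃ ha : a ∈ I ^ 1, p = reesMonomial ha}) ^ (n + 1) := by
      intro g hg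
      induction hg using Submodule.mul_induction_on' with
      | mem_mul_mem a ha b hb =>
        intro hg
        have hb' : b ∈ I ^ 1 := by rwa [pow_one]
        have : reesMonomial hg = reesMonomial ha * reesMonomial hb' := by
          apply Subtype.ext
          change monomial (n + 1) (a * b) = monomial n a * monomial 1 b
          rw [monomial_mul_monomial]
        rw [this, pow_succ]
        exact Ideal.mul_mem_mul (ih ha) (Ideal.subset_span ⟨b, hb', rfl⟩)
      | add a ha b hb iha ihb =>
        intro hg
        rw [← pow_succ] at ha hb
        have : reesMonomial hg = reesMonomial ha + reesMonomial hb := by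
          apply Subtype.ext
          change monomial _ (a + b) = monomial _ a + monomial _ b
          rw [map_add]
        rw [this]
        exact add_mem (iha ha) (ihb hb)
    exact key f (by rwa [← pow_succ]) h

end Monomial

section Existence

lemma exists_forall_succ_eq_of_bounded {d : ℕ → ℕ∞} (hd : ∀ j, d j ≤ d (j + 1)) {c : ℕ∞}
    (hc : c ≠ ⊤) (h : ∀ j, d j ≤ c) : ∃ j₀, ∀ j ≥ j₀, d (j + 1) = d j := by
  have hmono : Monotone d := monotone_nat_of_le_succ hd
  obtain ⟨j₀, hj₀⟩ : ∃ j₀, ∀ j, d j ≤ d j₀ := by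
    by_contra! hcon
    choose f hf using hcon
    have hn : ∀ n : ℕ, ∃ j, (n : ℕ∞) ≤ d j := by
      intro n
      induction n with
      | zero => exact ⟨0, by simp⟩
      | succ n ih =>
        obtain ⟨j, hj⟩ := ih
        refine ⟨f j, ?_⟩
        push_cast
        exact Order.add_one_le_of_lt (lt_of_le_of_lt hj (hf j))
    obtain ⟨c', rfl⟩ := ENat.ne_top_iff_exists.mp hc
    obtain ⟨j, hj⟩ := hn (c' + 1)
    have h3 := hj.trans (h j)
    have h4 : c' + 1 ≤ c' := by exact_mod_cast h3
    omega
  exact ⟨j₀, fun j hj => le_antisymm ((hj₀ _).trans (hmono hj)) (hd j)⟩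

variable {R : Type*} [CommRing R] [IsLocalRing R] {I : Ideal R}

/-- For `x ∈ I ^ r` and `s ≥ 0`, the part of degree `r j` of the ideal of all elements of the
fiber cone of `I` that are killed by the `s`-th power of the class of `x`. -/
def fiberAnnihilator (I : Ideal R) (r : ℕ) (x : R) (s j : ℕ) : Ideal R :=
  I ^ (r * j) ⊓
    Submodule.comap (LinearMap.mulLeft R (x ^ s)) (maximalIdeal R * I ^ (r * j + r * s))

lemma mem_fiberAnnihilator {r : ℕ} {x : R} {s j : ℕ} {f : R} :
    f ∈ fiberAnnihilator I r x s j ↔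
      f ∈ I ^ (r * j) ∧ x ^ s * f ∈ maximalIdeal R * I ^ (r * j + r * s) := Iff.rfl

variable [IsNoetherianRing R] [IsOneDimCM R]

lemma exists_pow_le_sup_fiberAnnihilator (hIm : I ≤ maximalIdeal R) {t : R} (htI : t ∈ I)
    (ht : t ∈ nonZeroDivisors R) {r : ℕ} {x : R} (hx : x ∈ I ^ r) {s : ℕ}
    (hs : ∀ j f, f ∈ I ^ (r * j) →
      x ^ (s + 1) * f ∈ maximalIdeal R * I ^ (r * j + r * (s + 1)) →
      x ^ s * f ∈ maximalIdeal R * I ^ (r * j + r * s)) :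
    ∃ j₀, ∀ i, ∀ g ∈ I ^ (r * (j₀ + i)), ∃ f ∈ I ^ (r * j₀),
      ∃ κ ∈ fiberAnnihilator I r x s (j₀ + i), g = x ^ i * f + κ := by
  set K := fiberAnnihilator I r x s with hK
  have hxK : ∀ j, ∀ f ∈ K j, x * f ∈ K (j + 1) := by
    rintro j f ⟨hf1, hf2⟩
    refine mem_fiberAnnihilator.mpr ⟨?_, ?_⟩
    · rw [Nat.mul_succ, pow_add, mul_comm x f]
      exact Ideal.mul_mem_mul hf1 hx
    · have h1 : x ^ s * (x * f) = x ^ s * f * x := by ring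
      rw [h1, Nat.mul_succ, add_right_comm, pow_add, ← mul_assoc]
      exact Ideal.mul_mem_mul hf2 hx
  have hxinj : ∀ j, ∀ f ∈ I ^ (r * j), x * f ∈ K (j + 1) → f ∈ K j := by
    intro j f hf h
    refine mem_fiberAnnihilator.mpr ⟨hf, hs j f hf ?_⟩
    have h1 := (mem_fiberAnnihilator.mp h).2
    rwa [← mul_assoc, ← pow_succ, Nat.mul_succ, add_assoc, add_comm r, ← Nat.mul_succ] at h1
  have hxI : ∀ j, ∀ f ∈ I ^ (r * j), x * f ∈ I ^ (r * (j + 1)) := by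
    intro j f hf
    rw [Nat.mul_succ, pow_add, mul_comm x f]
    exact Ideal.mul_mem_mul hf hx
  have hreg : IsSMulRegular R t := (isRegular_iff_mem_nonZeroDivisors.mpr ht).left
  have htK : ∀ j, t • I ^ (r * j) ≤ K j := by
    intro j f hf
    obtain ⟨g, hg, rfl⟩ := (Submodule.mem_smul_pointwise_iff_exists _ _ _).mp hf
    refine mem_fiberAnnihilator.mpr ⟨Ideal.mul_mem_left _ _ hg, ?_⟩
    have h1 : x ^ s * (t • g) = t * (g * x ^ s) := by simp only [smul_eq_mul]; ring
    rw [h1, pow_add, pow_mul I r s]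
    exact Ideal.mul_mem_mul (hIm htI) (Ideal.mul_mem_mul hg (Ideal.pow_mem_pow hx s))
  have hfg : ∀ J : Ideal R, J.FG := fun J => J.fg_of_isNoetherianRing
  have hfinK : ∀ j, relLength (I ^ (r * j)) (K j) ≠ ⊤ := fun j =>
    relLength_ne_top (hfg _) ht (htK j)
  have hbound : ∀ j, relLength (I ^ (r * j)) (K j) ≤ relLength (⊤ : Ideal R) (t • ⊤) := by
    intro j
    have h1 : relLength (⊤ : Ideal R) (I ^ (r * j)) ≠ ⊤ := by
      refine relLength_ne_top (hfg _) (pow_mem ht (r * j)) ?_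
      intro f hf
      obtain ⟨g, -, rfl⟩ := (Submodule.mem_smul_pointwise_iff_exists _ _ _).mp hf
      exact Ideal.mul_mem_right _ _ (Ideal.pow_mem_pow htI _)
    rw [← relLength_smul_self_eq hreg le_top h1]
    exact relLength_le_of_comap_le LinearMap.id (fun v hv => hv) (fun v _ hv => htK j hv)
  have hle : ∀ j, ∀ P : Ideal R, (∀ f ∈ I ^ (r * j), x * f ∈ P) →
      relLength (I ^ (r * j)) (K j) ≤ relLength P (K (j + 1)) := by
    intro j P hP
    exact relLength_le_of_comap_le (LinearMap.mulLeft R x) hP (fun v hv h => hxinj j v hv h)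
  obtain ⟨j₀, hj₀⟩ := exists_forall_succ_eq_of_bounded
    (d := fun j => relLength (I ^ (r * j)) (K j)) (fun j => hle j _ (hxI j))
    (relLength_ne_top (hfg _) ht le_rfl) hbound
  have hstep : ∀ j ≥ j₀, ∀ g ∈ I ^ (r * (j + 1)), ∃ f ∈ I ^ (r * j), ∃ κ ∈ K (j + 1),
      g = x * f + κ := by
    intro j hj g hg
    let P : Ideal R := Submodule.map (LinearMap.mulLeft R x) (I ^ (r * j)) ⊔ K (j + 1)
    have hP1 : K (j + 1) ≤ P := le_sup_right
    have hP2 : P ≤ I ^ (r * (j + 1)) := by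
      refine sup_le ?_ inf_le_left
      rintro - ⟨f, hf, rfl⟩
      exact hxI j f hf
    have h1 := relLength_add hP1 hP2
    have h2 := hle j P (fun f hf => Submodule.mem_sup_left ⟨f, hf, rfl⟩)
    have h3 : relLength (I ^ (r * (j + 1))) P = 0 := by
      have h4 : relLength (I ^ (r * j)) (K j) + relLength (I ^ (r * (j + 1))) P ≤
          relLength (I ^ (r * j)) (K j) + 0 := by
        rw [add_zero]
        conv_rhs => rw [← hj₀ j hj, h1]
        gcongr
      exact le_antisymm ((ENat.add_le_add_iff_left (hfinK j)).mp h4) zero_le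
    obtain ⟨y, hy, κ, hκ, rfl⟩ := Submodule.mem_sup.mp (relLength_eq_zero_iff.mp h3 hg)
    obtain ⟨f, hf, rfl⟩ := hy
    exact ⟨f, hf, κ, hκ, rfl⟩
  refine ⟨j₀, fun i => ?_⟩
  induction i with
  | zero => exact fun g hg => ⟨g, hg, 0, zero_mem _, by simp⟩
  | succ i ih =>
    intro g hg
    obtain ⟨f₁, hf₁, κ₁, hκ₁, rfl⟩ := hstep (j₀ + i) (by omega) g hg
    obtain ⟨f, hf, κ, hκ, rfl⟩ := ih f₁ hf₁
    refine ⟨f, hf, x * κ + κ₁, add_mem (hxK _ κ hκ) hκ₁, by ring⟩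

/-- Every regular proper ideal of a one-dimensional Cohen–Macaulay local ring has a power with a
principal reduction. -/
theorem exists_isReduction (hIm : I ≤ maximalIdeal R) (hI : IsRegularIdeal I) :
    ∃ r x, IsReduction I r x := by
  obtain ⟨t, htI, ht⟩ := hI
  let 𝔐 : Ideal (reesAlgebra I) := (maximalIdeal R).map (algebraMap R (reesAlgebra I))
  let S : Set (Ideal (reesAlgebra I)) :=
    {J | ∃ r, 1 ≤ r ∧ ∃ x, ∃ hx : x ∈ I ^ r, J = (Ideal.span {reesMonomial hx} ⊔ 𝔐).radical}
  have hS : S.Nonempty := ⟨_, 1, le_rfl, 0, zero_mem _, rfl⟩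
  obtain ⟨J, ⟨r, hr, x, hx, rfl⟩, hmax⟩ :=
    set_has_maximal_iff_noetherian.mpr (inferInstance : IsNoetherianRing (reesAlgebra I)) S hS
  set X := reesMonomial hx with hX
  have hrad : ∀ a, ∀ ha : a ∈ I ^ 1, reesMonomial ha ∈ (Ideal.span {X} ⊔ 𝔐).radical := by
    by_contra! hcon
    obtain ⟨a, ha, haX⟩ := hcon
    let L : ℕ →o Ideal (reesAlgebra I) :=
      { toFun := fun j => Submodule.comap (LinearMap.mulLeft (reesAlgebra I) (X ^ j)) 𝔐
        monotone' := monotone_nat_of_le_succ (by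
          intro j p hp
          have hp' : X ^ j * p ∈ 𝔐 := hp
          change X ^ (j + 1) * p ∈ 𝔐
          rw [pow_succ', mul_assoc]
          exact 𝔐.mul_mem_left _ hp') }
    obtain ⟨s₀, hs₀⟩ := monotone_stabilizes_iff_noetherian.mpr
      (inferInstance : IsNoetherianRing (reesAlgebra I)) L
    obtain ⟨s, hs1, hs⟩ : ∃ s, 1 ≤ s ∧ L s = L (s + 1) :=
      ⟨s₀ + 1, by omega, by rw [← hs₀ (s₀ + 1) (by omega), ← hs₀ (s₀ + 1 + 1) (by omega)]⟩
    have hmon : ∀ k n f (hf : f ∈ I ^ n), X ^ k * reesMonomial hf ∈ 𝔐 ↔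
        x ^ k * f ∈ maximalIdeal R * I ^ (n + r * k) := by
      intro k n f hf
      have hf' : x ^ k * f ∈ I ^ (n + r * k) := by
        rw [pow_add, mul_comm (x ^ k), pow_mul]
        exact Ideal.mul_mem_mul hf (Ideal.pow_mem_pow hx k)
      rw [← reesMonomial_mem_map_iff hf']
      have : X ^ k * reesMonomial hf = reesMonomial hf' := by
        apply Subtype.ext
        change (monomial r x) ^ k * monomial n f = monomial _ _
        rw [monomial_pow, monomial_mul_monomial, add_comm]
      rw [this]
    obtain ⟨j₀, hj₀⟩ := exists_pow_le_sup_fiberAnnihilator hIm htI ht hx (s := s) (by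
      intro j f hf h
      rw [← hmon _ _ _ hf] at h ⊢
      have h' : reesMonomial hf ∈ L (s + 1) := h
      rw [← hs] at h'
      exact h')
    set b := r * (j₀ + s) with hb
    have hsb : s ≤ b := by
      calc s ≤ j₀ + s := by omega
        _ ≤ b := Nat.le_mul_of_pos_left _ hr
    obtain ⟨f, hf, κ, hκ, hab⟩ := hj₀ s (a ^ b) (Ideal.pow_mem_pow (by simpa using ha) b)
    obtain ⟨hκ1, hκ2⟩ := mem_fiberAnnihilator.mp hκ
    have hw : x ^ b + κ ^ r ∈ I ^ (r * b) := by
      refine add_mem ?_ ?_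
      · rw [pow_mul]; exact Ideal.pow_mem_pow hx b
      · rw [mul_comm, pow_mul]; exact Ideal.pow_mem_pow hκ1 r
    set κ' := reesMonomial hκ1 with hκ'
    have hXκ : X ^ s * κ' ∈ 𝔐 := (hmon _ _ _ hκ1).mpr hκ2
    have hW : reesMonomial hw = X ^ b + κ' ^ r := by
      apply Subtype.ext
      change monomial _ _ = (monomial r x) ^ b + (monomial _ κ) ^ r
      rw [monomial_pow, monomial_pow, map_add, mul_comm (r * _) r]
    set W := reesMonomial hw with hWdef
    have hWmem : W ∈ Ideal.span {W} ⊔ 𝔐 :=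
      Ideal.mem_sup_left (Ideal.mem_span_singleton_self W)
    have h𝔐 : 𝔐 ≤ Ideal.span {W} ⊔ 𝔐 := le_sup_right
    have hXW : X ∈ (Ideal.span {W} ⊔ 𝔐).radical := by
      refine ⟨s + b, ?_⟩
      have h1 : X ^ (s + b) = X ^ s * W - κ' ^ (r - 1) * (X ^ s * κ') := by
        obtain ⟨r', rfl⟩ := Nat.exists_eq_add_of_le' hr
        rw [hW, Nat.add_sub_cancel]; ring
      rw [h1]
      exact sub_mem (Ideal.mul_mem_left _ _ hWmem) (h𝔐 (Ideal.mul_mem_left _ _ hXκ))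
    have hκW : κ' ∈ (Ideal.span {W} ⊔ 𝔐).radical := by
      refine ⟨r + 1, ?_⟩
      have h1 : κ' ^ (r + 1) = κ' * W - X ^ (b - s) * (X ^ s * κ') := by
        have h2 : X ^ b = X ^ (b - s) * X ^ s := by rw [← pow_add, Nat.sub_add_cancel hsb]
        rw [hW, h2]; ring
      rw [h1]
      exact sub_mem (Ideal.mul_mem_left _ _ hWmem) (h𝔐 (Ideal.mul_mem_left _ _ hXκ))
    refine hmax _ ⟨r * b, ?_, x ^ b + κ ^ r, hw, rfl⟩ (lt_of_le_of_ne ?_ ?_)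
    · exact Nat.mul_pos hr (lt_of_lt_of_le hs1 hsb)
    · rw [Ideal.radical_le_radical_iff]
      refine sup_le ?_ (h𝔐.trans Ideal.le_radical)
      rw [Ideal.span_singleton_le_iff_mem]
      exact hXW
    · intro heq
      rw [← heq] at hκW
      refine haX ((Ideal.radical_isRadical _) ⟨b, ?_⟩)
      have h1 : reesMonomial ha ^ b = X ^ s * reesMonomial hf + κ' := by
        apply Subtype.ext
        change (monomial 1 a) ^ b = (monomial r x) ^ s * monomial _ f + monomial _ κ
        rw [monomial_pow, monomial_pow, monomial_mul_monomial, hab, one_mul, map_add,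
          ← Nat.mul_add, add_comm s]
      rw [h1]
      refine add_mem ?_ hκW
      obtain ⟨s', rfl⟩ := Nat.exists_eq_add_of_le' hs1
      rw [pow_succ', mul_assoc]
      refine Ideal.mul_mem_right _ _ (Ideal.le_radical ?_)
      exact Ideal.mem_sup_left (Ideal.mem_span_singleton_self X)
  obtain ⟨k, hk⟩ := Ideal.exists_pow_le_of_le_radical_of_fg
    (I := Ideal.span {p | ∃ a, ∃ ha : a ∈ I ^ 1, p = reesMonomial ha})
    (J := Ideal.span {X} ⊔ 𝔐) (Ideal.span_le.mpr (by
      rintro - ⟨a, ha, rfl⟩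
      exact hrad a ha)) (Ideal.fg_of_isNoetherianRing _)
  refine ⟨r, x, hr, hx, k, fun n hn => ?_⟩
  refine Submodule.le_of_le_smul_of_le_jacobson_bot (Ideal.fg_of_isNoetherianRing _)
    (maximalIdeal_le_jacobson _) (fun f hf => ?_)
  refine mem_of_reesMonomial_mem_span_sup hx hf (hk ?_)
  exact Ideal.pow_le_pow_right (by omega) (reesMonomial_mem_pow hf)

end Existence

end Reduction

end UlrichSplit

namespace UlrichSplit

section Convolution

open scoped Pointwise

variable {R : Type*} [CommRing R] {I : Ideal R} {M : Type*} [AddCommGroup M] [Module R M]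

lemma IsReduction.mem_of_forall_smul_mem {r : ℕ} {x : R} {n₀ : ℕ} (hx : x ∈ I ^ r) (hr : 1 ≤ r)
    (hn₀ : ∀ n ≥ n₀, I ^ (n + r) ≤ Ideal.span {x} * I ^ n) (hreg : IsSMulRegular M x)
    {Q : Submodule R M} {N : ℕ} (hN : n₀ ≤ N) {v : M}
    (h : ∀ a ∈ I, a • v ∈ I ^ (N + 1) • Q) : v ∈ I ^ N • Q := by
  have h1 : I • (R ∙ v) ≤ I ^ (N + 1) • Q := by
    rw [Submodule.smul_le]
    intro a ha w hw
    obtain ⟨c, rfl⟩ := Submodule.mem_span_singleton.mp hw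
    rw [smul_comm]
    exact Submodule.smul_mem _ _ (h a ha)
  have h2 : x • v ∈ I ^ (N + r) • Q := by
    have h3 : x • v ∈ I ^ (r - 1) • (I • (R ∙ v)) := by
      rw [← mul_smul, ← pow_succ, Nat.sub_add_cancel hr]
      exact Submodule.smul_mem_smul hx (Submodule.mem_span_singleton_self v)
    have h4 := Submodule.smul_mono (le_refl (I ^ (r - 1))) h1 h3
    rwa [← mul_smul, ← pow_add, show r - 1 + (N + 1) = N + r by omega] at h4
  have h5 : x • v ∈ x • (I ^ N • Q) := by
    rw [← Submodule.ideal_span_singleton_smul, ← mul_smul]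
    exact Submodule.smul_mono_left (hn₀ N hN) h2
  obtain ⟨w, hw, hwv⟩ := (Submodule.mem_smul_pointwise_iff_exists _ _ _).mp h5
  rwa [← hreg hwv]

/-- A variant of McCoy's theorem: if the product of a polynomial, whose coefficients `a` generate
`I`, and a polynomial `g` with coefficients in a module has coefficients in `I ^ (N + 1) Q`, then
`g` has coefficients in `I ^ N Q`. -/
lemma mem_of_conv_mem {n₀ : ℕ} {Q : Submodule R M}
    (hcolon : ∀ N, n₀ ≤ N → ∀ v : M, (∀ a ∈ I, a • v ∈ I ^ (N + 1) • Q) → v ∈ I ^ N • Q)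
    {a : ℕ → R} {s : ℕ} (has : ∀ i, s < i → a i = 0) (ha : Ideal.span (Set.range a) = I)
    (d N : ℕ) (hN : n₀ ≤ N) (g : ℕ → M) (hg : ∀ j, d ≤ j → g j = 0)
    (h : ∀ n, ∑ j ∈ Finset.range (n + 1), a (n - j) • g j ∈ I ^ (N + 1) • Q) (j : ℕ) :
    g j ∈ I ^ N • Q := by
  induction d generalizing N g j with
  | zero => rw [hg j (Nat.zero_le j)]; exact zero_mem _
  | succ m ih =>
    have haI : ∀ i, a i ∈ I := fun i => ha ▸ Ideal.subset_span ⟨i, rfl⟩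
    have key : ∀ k i, s < i + k → ∀ j, a i • g j ∈ I ^ (N + 1) • Q := by
      intro k
      induction k with
      | zero => intro i hi j; rw [has i hi, zero_smul]; exact zero_mem _
      | succ k ihk =>
        intro i hi
        have htop : a i • g m ∈ I ^ (N + 1) • Q := by
          have h1 := h (i + m)
          rw [← Finset.sum_filter_add_sum_filter_not _ (fun j => j = m)] at h1
          have h2 : ∑ j ∈ Finset.range (i + m + 1) with j = m, a (i + m - j) • g j =
              a i • g m := by
            rw [Finset.sum_filter, Finset.sum_ite_eq' , if_pos (by simp), Nat.add_sub_cancel]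
          rw [h2] at h1
          refine (Submodule.add_mem_iff_left _ (Submodule.sum_mem _ fun j hj => ?_)).mp h1
          obtain ⟨hj1, hj2⟩ := Finset.mem_filter.mp hj
          rcases lt_or_gt_of_ne hj2 with hjm | hjm
          · exact ihk _ (by omega) j
          · rw [hg j hjm, smul_zero]; exact zero_mem _
        let g' : ℕ → M := fun j => if j = m then 0 else a i • g j
        have hg' : ∀ j, g' j ∈ I ^ (N + 1) • Q := by
          refine ih (N + 1) (by omega) g' ?_ ?_
          · intro j hj
            by_cases hjm : j = m
            · simp [g', hjm]
            · simp [g', hjm, hg j (by omega)]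
          · intro n
            have h1 : a i • ∑ j ∈ Finset.range (n + 1), a (n - j) • g j ∈
                I ^ (N + 1 + 1) • Q := by
              rw [pow_succ', mul_smul]
              exact Submodule.smul_mem_smul (haI i) (h n)
            have h2 : ∑ j ∈ Finset.range (n + 1), a (n - j) • g' j =
                a i • (∑ j ∈ Finset.range (n + 1), a (n - j) • g j) -
                  ∑ j ∈ Finset.range (n + 1), if j = m then a (n - j) • (a i • g j) else 0 := by
              rw [Finset.smul_sum, ← Finset.sum_sub_distrib]
              refine Finset.sum_congr rfl fun j _ => ?_
              by_cases hjm : j = m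
              · simp [g', hjm, smul_comm (a i)]
              · simp [g', hjm, smul_comm (a i)]
            rw [h2]
            refine Submodule.sub_mem _ h1 (Submodule.sum_mem _ fun j _ => ?_)
            split_ifs with hjm
            · rw [pow_succ', mul_smul, hjm]
              exact Submodule.smul_mem_smul (haI _) htop
            · exact zero_mem _
        intro j
        by_cases hjm : j = m
        · rw [hjm]; exact htop
        · simpa [g', hjm] using hg' j
    refine hcolon N hN _ fun b hb => ?_
    rw [← ha] at hb
    induction hb using Submodule.span_induction with
    | mem b hb =>
      obtain ⟨i, rfl⟩ := hb
      exact key (s + 1) i (by omega) j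
    | zero => rw [zero_smul]; exact zero_mem _
    | add b b' _ _ hb hb' => rw [add_smul]; exact add_mem hb hb'
    | smul c b _ hb => rw [smul_assoc]; exact Submodule.smul_mem _ _ hb

lemma mul_relLength_le_of_conv {A Q P C : Submodule R M} {a : ℕ → R} {s : ℕ}
    (has : ∀ i, s < i → a i = 0) (hP : ∀ i, ∀ v ∈ Q, a i • v ∈ P)
    (d : ℕ) (h : ∀ g : ℕ → M, (∀ j, d ≤ j → g j = 0) → (∀ j, g j ∈ Q) →
      (∀ n, ∑ j ∈ Finset.range (n + 1), a (n - j) • g j ∈ C) → ∀ j, g j ∈ A) :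
    d * relLength Q A ≤ (d + s : ℕ) * relLength P C := by
  let c : Fin (d + s) → Fin d → R := fun n j => if (j : ℕ) ≤ n then a (n - j) else 0
  have hc : ∀ n j, ∀ v ∈ Q, c n j • v ∈ P := by
    intro n j v hv
    simp only [c]
    split_ifs
    · exact hP _ v hv
    · rw [zero_smul]; exact zero_mem _
  let ψ : (Fin d → Q) →ₗ[R] (Fin (d + s) → (P ⧸ C.comap P.subtype)) :=
    LinearMap.pi fun n => (C.comap P.subtype).mkQ ∘ₗ
      (∑ j, c n j • (Q.subtype ∘ₗ LinearMap.proj j)).codRestrict P (by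
        intro g
        rw [LinearMap.sum_apply]
        exact Submodule.sum_mem _ fun j _ => hc n j _ (g j).2)
  have hψ : LinearMap.ker ψ ≤ Submodule.pi Set.univ fun _ => A.comap Q.subtype := by
    intro g hg
    have hg' : ∀ n, ∑ j, c n j • (g j : M) ∈ C := by
      intro n
      have h1 := congrFun (LinearMap.mem_ker.mp hg) n
      have h2 := (Submodule.Quotient.mk_eq_zero (C.comap P.subtype)).mp h1
      simpa [LinearMap.sum_apply] using h2
    let G : ℕ → M := fun j => if hj : j < d then g ⟨j, hj⟩ else 0
    have hG : ∀ j : Fin d, G j = g j := fun j => by simp [G]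
    have hG0 : ∀ j, d ≤ j → G j = 0 := fun j hj => by simp [G, not_lt.mpr hj]
    have hGA := h G hG0 ?_ ?_
    · rw [Submodule.mem_pi]
      intro j _
      have := hGA j
      rwa [hG j] at this
    · intro j
      by_cases hj : j < d
      · simp [G, hj]
      · rw [hG0 j (by omega)]; exact zero_mem _
    · intro n
      by_cases hn : n < d + s
      · have h1 := hg' ⟨n, hn⟩
        have h2 : ∑ j ∈ Finset.range (n + 1), a (n - j) • G j =
            ∑ j : Fin d, c ⟨n, hn⟩ j • (g j : M) := by
          have h3 : ∀ j : Fin d, c ⟨n, hn⟩ j • (g j : M) =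
              (fun j : ℕ => if j ≤ n then a (n - j) • G j else 0) j := by
            intro j
            simp only [c, hG]
            split_ifs <;> simp
          rw [Finset.sum_congr rfl fun j _ => h3 j,
            Fin.sum_univ_eq_sum_range (fun j : ℕ => if j ≤ n then a (n - j) • G j else 0) d,
            ← Finset.sum_filter]
          have h4 : ∀ j ∈ Finset.range (n + 1), j ∉ {j ∈ Finset.range d | j ≤ n} →
              a (n - j) • G j = 0 := by
            intro j hj hj'
            rw [hG0 j ?_, smul_zero]
            simp only [Finset.mem_filter, Finset.mem_range, not_and] at hj hj'
            by_contra hcon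
            exact hj' (by omega) (by omega)
          refine (Finset.sum_subset ?_ h4).symm
          intro j hj
          simp only [Finset.mem_filter, Finset.mem_range] at hj ⊢
          omega
        rw [h2]
        exact h1
      · refine Submodule.sum_mem _ fun j _ => ?_
        by_cases hj : j < d
        · rw [has _ (by omega), zero_smul]; exact zero_mem _
        · rw [hG0 j (by omega), smul_zero]; exact zero_mem _
  have h1 : Module.length R (Fin d → (Q ⧸ A.comap Q.subtype)) ≤
      Module.length R (Fin (d + s) → (P ⧸ C.comap P.subtype)) := by
    rw [← (Submodule.quotientPi fun _ : Fin d => A.comap Q.subtype).length_eq]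
    calc _ ≤ Module.length R ((Fin d → Q) ⧸ LinearMap.ker ψ) := by
          refine Module.length_le_of_surjective (Submodule.mapQ (LinearMap.ker ψ) _
            LinearMap.id hψ) ?_
          intro x
          obtain ⟨x, rfl⟩ := Submodule.Quotient.mk_surjective _ x
          exact ⟨Submodule.Quotient.mk x, rfl⟩
      _ ≤ _ := Module.length_le_of_injective ((LinearMap.ker ψ).liftQ ψ le_rfl) (by
          rw [← LinearMap.ker_eq_bot, Submodule.ker_liftQ_eq_bot _ _ _ le_rfl])
  rwa [Module.length_pi, Module.length_pi, ENat.card_eq_coe_fintype_card,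
    ENat.card_eq_coe_fintype_card, Fintype.card_fin, Fintype.card_fin] at h1

end Convolution

end UlrichSplit

namespace UlrichSplit

open scoped Pointwise

section Lengths

variable {R : Type*} [CommRing R] {M M' : Type*} [AddCommGroup M] [Module R M]
  [AddCommGroup M'] [Module R M']

lemma relLength_anti {P N N' : Submodule R M} (h : N' ≤ N) : relLength P N ≤ relLength P N' :=
  relLength_le_of_comap_le LinearMap.id (fun _ hv => hv) (fun _ _ hv => h hv)

lemma length_quotient_eq_add (f : M →ₗ[R] M') (hf : Function.Surjective f) (N : Submodule R M) :
    Module.length R (M ⧸ N) =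
      relLength (LinearMap.ker f) N + Module.length R (M' ⧸ N.map f) := by
  let i : (LinearMap.ker f ⧸ N.comap (LinearMap.ker f).subtype) →ₗ[R] (M ⧸ N) :=
    Submodule.mapQ _ _ (LinearMap.ker f).subtype le_rfl
  let p : (M ⧸ N) →ₗ[R] (M' ⧸ N.map f) := Submodule.mapQ _ _ f (Submodule.le_comap_map f N)
  refine Module.length_eq_add_of_exact i p ?_ ?_ ?_
  · rw [← LinearMap.ker_eq_bot, LinearMap.ker_eq_bot']
    intro v hv
    obtain ⟨v, rfl⟩ := Submodule.Quotient.mk_surjective _ v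
    rw [Submodule.Quotient.mk_eq_zero]
    exact (Submodule.Quotient.mk_eq_zero N).mp hv
  · intro v
    obtain ⟨v, rfl⟩ := Submodule.Quotient.mk_surjective _ v
    obtain ⟨w, rfl⟩ := hf v
    exact ⟨Submodule.Quotient.mk w, rfl⟩
  · intro v
    obtain ⟨v, rfl⟩ := Submodule.Quotient.mk_surjective _ v
    constructor
    · intro hv
      obtain ⟨n, hn, hnv⟩ := (Submodule.Quotient.mk_eq_zero (N.map f)).mp hv
      refine ⟨Submodule.Quotient.mk ⟨v - n, by simp [hnv]⟩, ?_⟩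
      refine (Submodule.Quotient.eq N).mpr ?_
      simpa using hn
    · rintro ⟨z, hz⟩
      obtain ⟨z, rfl⟩ := Submodule.Quotient.mk_surjective _ z
      have h3 : (z : M) - v ∈ N := (Submodule.Quotient.eq N).mp hz
      refine (Submodule.Quotient.mk_eq_zero (N.map f)).mpr ⟨v - z, ?_, ?_⟩
      · rw [← neg_sub]; exact N.neg_mem h3
      · simp [LinearMap.mem_ker.mp z.2]

lemma length_quotient_smul_top (Q : Submodule R M) (I : Ideal R) :
    Module.length R (Q ⧸ (I • ⊤ : Submodule R Q)) = relLength Q (I • Q) := by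
  rw [← relLength_top, ← relLength_map Q.subtype Q.injective_subtype, Submodule.map_smul'',
    Submodule.map_subtype_top]

lemma relLength_eq_sum (I : Ideal R) (Q : Submodule R M) (n k : ℕ) :
    relLength (I ^ n • Q) (I ^ (n + k) • Q) =
      ∑ j ∈ Finset.range k, relLength (I ^ (n + j) • Q) (I ^ (n + j + 1) • Q) := by
  induction k with
  | zero => simp [relLength_self]
  | succ k ih =>
    have h1 : I ^ (n + k + 1) • Q ≤ I ^ (n + k) • Q :=
      Submodule.smul_mono_left (Ideal.pow_le_pow_right (by omega))
    have h2 : I ^ (n + k) • Q ≤ I ^ n • Q :=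
      Submodule.smul_mono_left (Ideal.pow_le_pow_right (by omega))
    have h3 := relLength_add h1 h2
    rw [Finset.sum_range_succ, ← ih, ← add_assoc n k 1, h3, add_comm]

end Lengths

section Reduction

variable {R : Type*} [CommRing R] {I : Ideal R} {r : ℕ} {x : R}

lemma IsReduction.mem_nonZeroDivisors {R : Type u} [CommRing R] {I : Ideal R} {x : R}
    (hx : IsReduction I r x) (hI : IsRegularIdeal I) : x ∈ nonZeroDivisors R := by
  obtain ⟨t, htI, ht⟩ := hI
  obtain ⟨n, hn⟩ := hx.exists_forall_le
  have h1 : t ^ (n + r) ∈ Ideal.span {x} :=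
    Ideal.mul_le_left (hn n le_rfl (Ideal.pow_mem_pow htI _))
  obtain ⟨y, hy⟩ := Ideal.mem_span_singleton'.mp h1
  have h2 : y * x ∈ nonZeroDivisors R := hy ▸ pow_mem ht _
  exact (mul_mem_nonZeroDivisors.mp h2).2

lemma IsReduction.exists_forall_eq (hx : IsReduction I r x) :
    ∃ n₀, ∀ n ≥ n₀, I ^ (n + r) = Ideal.span {x} * I ^ n := by
  obtain ⟨n₀, hn₀⟩ := hx.exists_forall_le
  refine ⟨n₀, fun n hn => le_antisymm (hn₀ n hn) ?_⟩
  rw [add_comm, pow_add]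
  exact Ideal.mul_mono_left (by simpa [Ideal.span_le] using hx.mem)

lemma isSMulRegular_of_mem_nonZeroDivisors {t : R} (ht : t ∈ nonZeroDivisors R) (M : Type*)
    [AddCommGroup M] [Module R M] [Module.IsTorsionFree R M] : IsSMulRegular M t :=
  Module.IsTorsionFree.isSMulRegular (isRegular_iff_mem_nonZeroDivisors.mpr ht)

lemma length_quotient_pi_le {M : Type*} [AddCommGroup M] [Module R M] {s : ℕ} (h : Module.length R (M ⧸ (x • ⊤ : Submodule R M)) ≤
      r * Module.length R (M ⧸ (I • ⊤ : Submodule R M))) :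
    Module.length R ((Fin s → M) ⧸ (x • ⊤ : Submodule R (Fin s → M))) ≤
      r * Module.length R ((Fin s → M) ⧸ (I • ⊤ : Submodule R (Fin s → M))) := by
  have h1 : Module.length R ((Fin s → M) ⧸ (x • ⊤ : Submodule R (Fin s → M))) ≤
      s * Module.length R (M ⧸ (x • ⊤ : Submodule R M)) := by
    have h2 := (Submodule.quotientPi fun _ : Fin s => (x • ⊤ : Submodule R M)).length_eq
    rw [Module.length_pi, ENat.card_eq_coe_fintype_card, Fintype.card_fin] at h2
    rw [← h2]
    refine Module.length_le_of_surjective (Submodule.mapQ _ _ LinearMap.id ?_) ?_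
    · intro v hv
      rw [Submodule.mem_pi] at hv
      choose w _ hw using fun i => (Submodule.mem_smul_pointwise_iff_exists _ _ _).mp (hv i trivial)
      exact (Submodule.mem_smul_pointwise_iff_exists _ _ _).mpr ⟨w, trivial, funext hw⟩
    · intro v
      obtain ⟨v, rfl⟩ := Submodule.Quotient.mk_surjective _ v
      exact ⟨Submodule.Quotient.mk v, rfl⟩
  have h3 : s * Module.length R (M ⧸ (I • ⊤ : Submodule R M)) ≤
      Module.length R ((Fin s → M) ⧸ (I • ⊤ : Submodule R (Fin s → M))) := by
    have h2 := (Submodule.quotientPi fun _ : Fin s => (I • ⊤ : Submodule R M)).length_eq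
    rw [Module.length_pi, ENat.card_eq_coe_fintype_card, Fintype.card_fin] at h2
    rw [← h2]
    refine Module.length_le_of_surjective (Submodule.mapQ _ _ LinearMap.id ?_) ?_
    · intro v hv
      change v ∈ Submodule.pi _ _
      rw [Submodule.mem_pi]
      intro i _
      have h4 := Submodule.mem_map_of_mem (f := (LinearMap.proj i : (Fin s → M) →ₗ[R] M)) hv
      rw [Submodule.map_smul''] at h4
      exact Submodule.smul_mono le_rfl le_top h4
    · intro v
      obtain ⟨v, rfl⟩ := Submodule.Quotient.mk_surjective _ v
      exact ⟨Submodule.Quotient.mk v, rfl⟩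
  calc _ ≤ _ := h1
    _ ≤ s * (r * Module.length R (M ⧸ (I • ⊤ : Submodule R M))) := by gcongr
    _ = r * (s * Module.length R (M ⧸ (I • ⊤ : Submodule R M))) := by ring
    _ ≤ _ := by gcongr

end Reduction

section Sharp

variable {R : Type u} [CommRing R] [IsLocalRing R] [IsNoetherianRing R] [IsOneDimCM R]
  {I : Ideal R} {r : ℕ} {x : R}
  {M : Type*} [AddCommGroup M] [Module R M] [Module.Finite R M]

lemma relLength_pow_ne_top (hI : IsRegularIdeal I) (Q : Submodule R M) (n k : ℕ) :
    relLength (I ^ n • Q) (I ^ (n + k) • Q) ≠ ⊤ := by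
  obtain ⟨t, htI, ht⟩ := hI
  refine relLength_ne_top (IsNoetherian.noetherian _) (pow_mem ht k) ?_
  rw [← Submodule.ideal_span_singleton_smul, ← mul_smul, add_comm n, pow_add]
  refine Submodule.smul_mono_left (Ideal.mul_mono_left ?_)
  simpa [Ideal.span_le] using Ideal.pow_mem_pow htI k

lemma relLength_smul_ne_top (ht : x ∈ nonZeroDivisors R) (Q : Submodule R M) :
    relLength Q (x • Q) ≠ ⊤ :=
  relLength_ne_top (IsNoetherian.noetherian _) ht le_rfl

variable [Module.IsTorsionFree R M]

lemma relLength_le_relLength_smul (hx : IsReduction I r x) (hI : IsRegularIdeal I)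
    (Q : Submodule R M) : ∃ n₀, ∀ N ≥ n₀,
      relLength Q (I ^ N • Q) ≤ relLength (I • Q) (I ^ (N + 1) • Q) := by
  obtain ⟨n₀, hn₀⟩ := hx.exists_forall_le
  refine ⟨n₀, fun N hN => ?_⟩
  obtain ⟨S, hS⟩ := (IsNoetherian.noetherian I : I.FG)
  let a : ℕ → R := fun i => if h : i < S.card then S.equivFin.symm ⟨i, h⟩ else 0
  have ha : Ideal.span (Set.range a) = I := by
    rw [← hS]
    refine le_antisymm (Ideal.span_le.mpr ?_) (Ideal.span_mono ?_ |>.trans le_rfl)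
    · rintro _ ⟨i, rfl⟩
      by_cases h : i < S.card
      · simp only [a, h, dif_pos]
        exact Ideal.subset_span (S.equivFin.symm ⟨i, h⟩).2
      · simp [a, h]
    · intro z hz
      refine ⟨S.equivFin ⟨z, hz⟩, ?_⟩
      simp [a]
  have has : ∀ i, S.card < i → a i = 0 := fun i hi => by simp [a, not_lt.mpr hi.le]
  have haI : ∀ i, a i ∈ I := fun i => ha ▸ Ideal.subset_span ⟨i, rfl⟩
  have hreg := isSMulRegular_of_mem_nonZeroDivisors (hx.mem_nonZeroDivisors hI) M
  have key : ∀ d : ℕ, d * relLength Q (I ^ N • Q) ≤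
      (d + S.card : ℕ) * relLength (I • Q) (I ^ (N + 1) • Q) := by
    intro d
    refine mul_relLength_le_of_conv has (fun i v hv => Submodule.smul_mem_smul (haI i) hv) d ?_
    intro g hg _ h
    exact mem_of_conv_mem (fun N hN v hv =>
      IsReduction.mem_of_forall_smul_mem hx.mem hx.one_le hn₀ hreg hN hv) has ha d N hN g hg h
  have h1 : relLength Q (I ^ N • Q) ≠ ⊤ := by
    simpa using relLength_pow_ne_top hI Q 0 N
  have h2 : relLength (I • Q) (I ^ (N + 1) • Q) ≠ ⊤ := by
    have := relLength_pow_ne_top hI Q 1 N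
    rwa [pow_one, add_comm] at this
  lift relLength Q (I ^ N • Q) to ℕ using h1 with α
  lift relLength (I • Q) (I ^ (N + 1) • Q) to ℕ using h2 with β
  have h3 := key (S.card * β + 1)
  norm_cast at h3 ⊢
  by_contra! hcon
  nlinarith [Nat.mul_le_mul_left (S.card * β + 1) (Nat.succ_le_of_lt hcon)]

lemma smul_relLength_le (hx : IsReduction I r x) (hI : IsRegularIdeal I) (Q : Submodule R M) :
    r * relLength Q (I • Q) ≤ relLength Q (x • Q) := by
  obtain ⟨n₁, hn₁⟩ := relLength_le_relLength_smul hx hI Q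
  obtain ⟨n₂, hn₂⟩ := hx.exists_forall_eq
  have hreg := isSMulRegular_of_mem_nonZeroDivisors (hx.mem_nonZeroDivisors hI) M
  set n := max n₁ n₂
  have h1 : ∀ j, relLength Q (I • Q) ≤ relLength (I ^ (n + j) • Q) (I ^ (n + j + 1) • Q) := by
    intro j
    have h2 := hn₁ (n + j) (by omega)
    have hle : I ^ (n + j + 1) • Q ≤ I • Q := Submodule.smul_mono_left (Ideal.pow_le_self (by omega))
    have h3 := relLength_add hle (Submodule.smul_le_right (I := I) (N := Q))
    have h4 := relLength_add (Submodule.smul_mono_left (Ideal.pow_le_pow_right (by omega)) :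
      I ^ (n + j + 1) • Q ≤ I ^ (n + j) • Q) Submodule.smul_le_right
    rw [h3] at h4
    have h5 : relLength Q (I ^ (n + j) • Q) ≠ ⊤ := by
      simpa using relLength_pow_ne_top hI Q 0 (n + j)
    rw [add_comm] at h4
    have h6 : relLength Q (I • Q) + relLength Q (I ^ (n + j) • Q) ≤
        relLength (I ^ (n + j) • Q) (I ^ (n + j + 1) • Q) + relLength Q (I ^ (n + j) • Q) := by
      rw [← h4]
      gcongr
    exact (ENat.add_le_add_iff_right h5).mp h6
  have h2 : I ^ (n + r) • Q = x • (I ^ n • Q) := by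
    rw [hn₂ n (le_max_right _ _), mul_smul, Submodule.ideal_span_singleton_smul]
  have h3 : relLength (I ^ n • Q) (x • (I ^ n • Q)) = relLength Q (x • Q) :=
    relLength_smul_self_eq hreg Submodule.smul_le_right
      (by simpa using relLength_pow_ne_top hI Q 0 n)
  rw [← h3, ← h2, relLength_eq_sum]
  calc _ = ∑ j ∈ Finset.range r, relLength Q (I • Q) := by simp
    _ ≤ _ := Finset.sum_le_sum fun j _ => h1 j

lemma smul_length_le (hx : IsReduction I r x) (hI : IsRegularIdeal I) :
    r * Module.length R (M ⧸ (I • ⊤ : Submodule R M)) ≤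
      Module.length R (M ⧸ (x • ⊤ : Submodule R M)) := by
  rw [← relLength_top, ← relLength_top]
  exact smul_relLength_le hx hI ⊤

lemma smul_length_eq_of_surjective {M' : Type*} [AddCommGroup M'] [Module R M']
    [Module.IsTorsionFree R M'] (hx : IsReduction I r x) (hI : IsRegularIdeal I)
    (f : M →ₗ[R] M') (hf : Function.Surjective f)
    (h : Module.length R (M ⧸ (x • ⊤ : Submodule R M)) ≤
      r * Module.length R (M ⧸ (I • ⊤ : Submodule R M))) :
    Module.length R (M' ⧸ (x • ⊤ : Submodule R M')) =
      r * Module.length R (M' ⧸ (I • ⊤ : Submodule R M')) := by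
  have : Module.Finite R M' := .of_surjective f hf
  have hx0 := hx.mem_nonZeroDivisors hI
  have h1 := length_quotient_eq_add f hf (x • ⊤)
  have h2 := length_quotient_eq_add f hf (I • ⊤)
  have h3 : (x • ⊤ : Submodule R M).map f = x • ⊤ := by
    rw [← Submodule.ideal_span_singleton_smul, Submodule.map_smul'', Submodule.map_top,
      LinearMap.range_eq_top.mpr hf, Submodule.ideal_span_singleton_smul]
  rw [h3] at h1
  rw [Submodule.map_smul'', Submodule.map_top, LinearMap.range_eq_top.mpr hf] at h2
  have h4 : relLength (LinearMap.ker f) (x • LinearMap.ker f) ≤ relLength (LinearMap.ker f) (x • ⊤) := by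
    refine relLength_le_of_comap_le LinearMap.id (fun _ hv => hv) fun v hv hv' => ?_
    obtain ⟨w, -, rfl⟩ := (Submodule.mem_smul_pointwise_iff_exists _ _ _).mp hv'
    refine Submodule.smul_mem_pointwise_smul _ _ _ ?_
    have h5 : x • f w = 0 := by rw [← map_smul]; exact hv
    exact (isSMulRegular_of_mem_nonZeroDivisors hx0 M').right_eq_zero_of_smul h5
  have h5 := smul_relLength_le hx hI (LinearMap.ker f)
  have h6 : relLength (LinearMap.ker f) (I • ⊤) ≤ relLength (LinearMap.ker f) (I • LinearMap.ker f) :=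
    relLength_anti (Submodule.smul_mono le_rfl le_top)
  have h7 := smul_length_le (M := M') hx hI
  refine le_antisymm ?_ h7
  rw [h1, h2, mul_add] at h
  have h8 : relLength (LinearMap.ker f) (x • ⊤) ≠ ⊤ :=
    relLength_ne_top (IsNoetherian.noetherian _) hx0 (Submodule.map_mono le_top)
  refine (ENat.add_le_add_iff_left h8).mp (h.trans ?_)
  gcongr
  exact (mul_le_mul' le_rfl h6).trans (h5.trans h4)

lemma smul_length_eq_ideal_smul (hx : IsReduction I r x) (hI : IsRegularIdeal I)
    (h : Module.length R (M ⧸ (x • ⊤ : Submodule R M)) ≤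
      r * Module.length R (M ⧸ (I • ⊤ : Submodule R M))) (J : Ideal R) :
    Module.length R ((J • ⊤ : Submodule R M) ⧸ (x • ⊤ : Submodule R (J • ⊤ : Submodule R M))) =
      r * Module.length R
        ((J • ⊤ : Submodule R M) ⧸ (I • ⊤ : Submodule R (J • ⊤ : Submodule R M))) := by
  obtain ⟨S, hS⟩ := (IsNoetherian.noetherian J : J.FG)
  let f : (Fin S.card → M) →ₗ[R] M :=
    ∑ i, (S.equivFin.symm i : R) • LinearMap.proj i
  have hf : LinearMap.range f = J • ⊤ := by
    refine le_antisymm ?_ ?_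
    · rintro _ ⟨v, rfl⟩
      rw [LinearMap.sum_apply]
      refine Submodule.sum_mem _ fun i _ => Submodule.smul_mem_smul ?_ trivial
      rw [← hS]
      exact Submodule.subset_span (S.equivFin.symm i).2
    · rw [← hS, Submodule.span_smul_eq, Submodule.set_smul_le_iff]
      intro a v ha _
      refine ⟨Pi.single (S.equivFin ⟨a, ha⟩) v, ?_⟩
      rw [LinearMap.sum_apply, Finset.sum_eq_single (S.equivFin ⟨a, ha⟩)]
      · simp
      · intro i _ hi
        simp [Pi.single_eq_of_ne hi]
      · simp
  let g : (Fin S.card → M) →ₗ[R] (J • ⊤ : Submodule R M) :=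
    f.codRestrict _ fun v => hf ▸ LinearMap.mem_range_self f v
  refine smul_length_eq_of_surjective hx hI g ?_ (length_quotient_pi_le h)
  rintro ⟨v, hv⟩
  rw [← hf] at hv
  obtain ⟨w, rfl⟩ := hv
  exact ⟨w, rfl⟩

/-- Equality `r ℓ(M / I M) = ℓ(M / x M)` for a reduction `x ∈ I ^ r`. -/
theorem smul_length_eq_iff (hx : IsReduction I r x) (hI : IsRegularIdeal I) :
    Module.length R (M ⧸ (x • ⊤ : Submodule R M)) =
      r * Module.length R (M ⧸ (I • ⊤ : Submodule R M)) ↔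
    (I ^ r • ⊤ : Submodule R M) = x • ⊤ := by
  have hx0 := hx.mem_nonZeroDivisors hI
  have hreg := isSMulRegular_of_mem_nonZeroDivisors hx0 M
  have hE : ∀ j, relLength (I ^ j • ⊤ : Submodule R M) (x • (I ^ j • ⊤)) =
      relLength ⊤ (x • ⊤ : Submodule R M) := fun j =>
    relLength_smul_self_eq hreg le_top (by simpa using relLength_pow_ne_top hI (⊤ : Submodule R M) 0 j)
  have hle : (x • ⊤ : Submodule R M) ≤ I ^ r • ⊤ := by
    rw [← Submodule.ideal_span_singleton_smul]
    exact Submodule.smul_mono_left (by simpa [Ideal.span_le] using hx.mem)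
  have hsum := relLength_eq_sum I (⊤ : Submodule R M) 0 r
  simp only [zero_add, pow_zero, Ideal.one_eq_top, Submodule.top_smul] at hsum
  have hH : ∀ j, relLength (I ^ j • ⊤ : Submodule R M) (I ^ (j + 1) • ⊤) =
      relLength (I ^ j • ⊤ : Submodule R M) (I • (I ^ j • ⊤)) := fun j => by
    rw [← mul_smul, ← pow_succ']
  constructor
  · intro h
    have h1 : ∀ j, r * relLength (I ^ j • ⊤ : Submodule R M) (I ^ (j + 1) • ⊤) =
        relLength ⊤ (x • ⊤ : Submodule R M) := by
      intro j
      have h2 := smul_length_eq_ideal_smul hx hI h.le (I ^ j)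
      rw [length_quotient_smul_top, ← Submodule.ideal_span_singleton_smul,
        length_quotient_smul_top, Submodule.ideal_span_singleton_smul, hE] at h2
      rw [hH, h2]
    have h3 : r * relLength ⊤ (I ^ r • ⊤ : Submodule R M) =
        r * relLength ⊤ (x • ⊤ : Submodule R M) := by
      rw [hsum, Finset.mul_sum, Finset.sum_congr rfl fun j _ => h1 j]
      simp
    have h4 : relLength ⊤ (I ^ r • ⊤ : Submodule R M) ≠ ⊤ := by
      simpa using relLength_pow_ne_top hI (⊤ : Submodule R M) 0 r
    have h5 := relLength_smul_ne_top hx0 (⊤ : Submodule R M)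
    have h6 := relLength_add hle le_top
    refine le_antisymm ?_ hle
    rw [← relLength_eq_zero_iff]
    have h7 : relLength (I ^ r • ⊤ : Submodule R M) (x • ⊤) ≠ ⊤ := by
      intro h
      rw [h, top_add] at h6
      exact h5 h6
    have hr := hx.one_le
    lift relLength ⊤ (I ^ r • ⊤ : Submodule R M) to ℕ using h4 with α
    lift relLength ⊤ (x • ⊤ : Submodule R M) to ℕ using h5 with β
    lift relLength (I ^ r • ⊤ : Submodule R M) (x • ⊤) to ℕ using h7 with γ
    norm_cast at h3 h6 ⊢
    have := Nat.eq_of_mul_eq_mul_left hr h3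
    omega
  · intro h
    rw [← relLength_top, ← relLength_top]
    have h1 : ∀ j, r * relLength (I ^ j • ⊤ : Submodule R M) (I ^ (j + 1) • ⊤) ≤
        relLength ⊤ (x • ⊤ : Submodule R M) := by
      intro j
      rw [hH, ← hE j]
      exact smul_relLength_le hx hI _
    have h2 : ∑ j ∈ Finset.range r, r * relLength (I ^ j • ⊤ : Submodule R M) (I ^ (j + 1) • ⊤) =
        ∑ j ∈ Finset.range r, relLength ⊤ (x • ⊤ : Submodule R M) := by
      rw [← Finset.mul_sum, ← hsum, h]
      simp
    have hfin := relLength_smul_ne_top hx0 (⊤ : Submodule R M)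
    by_contra hne
    have h0 := h1 0
    simp only [zero_add, pow_zero, Ideal.one_eq_top, Submodule.top_smul, pow_one] at h0
    have hlt := lt_of_le_of_ne h0 (Ne.symm hne)
    have h3 : ∀ j ∈ Finset.range r, r * relLength (I ^ j • ⊤ : Submodule R M) (I ^ (j + 1) • ⊤) ≠ ⊤ :=
      fun j _ => ne_top_of_le_ne_top hfin (h1 j)
    lift relLength ⊤ (x • ⊤ : Submodule R M) to ℕ using hfin with β
    have h4 : ∀ j, ∃ c : ℕ, r * relLength (I ^ j • ⊤ : Submodule R M) (I ^ (j + 1) • ⊤) = c :=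
      fun j => ⟨_, (ENat.natCast_toNat (ne_top_of_le_ne_top (ENat.natCast_ne_top β) (h1 j))).symm⟩
    choose c hc using h4
    simp only [hc] at h1 h2
    have h5 := hc 0
    simp only [zero_add, pow_zero, Ideal.one_eq_top, Submodule.top_smul, pow_one] at h5
    rw [h5] at hlt
    norm_cast at h1 h2 hlt
    exact absurd h2 (Finset.sum_lt_sum (fun j _ => h1 j)
      ⟨0, Finset.mem_range.mpr hx.one_le, hlt⟩).ne

end Sharp

end UlrichSplit

namespace UlrichSplit

open scoped Pointwise

lemma tendsto_div_of_forall_add_eq {f : ℕ → ℕ} {r n₀ E : ℕ} (hr : 1 ≤ r)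
    (hf : ∀ n ≥ n₀, f (n + r) = f n + E) :
    Tendsto (fun n : ℕ => (f n : ℝ) / n) atTop (𝓝 ((E : ℝ) / r)) := by
  let h : ℕ → ℝ := fun n => r * f n - E * n
  obtain ⟨C, hC⟩ : ∃ C, ∀ n < n₀ + r, |h n| ≤ C := by
    obtain ⟨C, hC⟩ := ((Finset.range (n₀ + r)).image fun n => |h n|).bddAbove
    exact ⟨C, fun n hn => hC (by
      simp only [Finset.coe_image, Set.mem_image, Finset.coe_range]
      exact ⟨n, hn, rfl⟩)⟩
  have hC' : ∀ n, |h n| ≤ C := by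
    intro n
    induction n using Nat.strong_induction_on with
    | _ n ih =>
      by_cases hn : n < n₀ + r
      · exact hC n hn
      · obtain ⟨k, rfl⟩ := Nat.exists_eq_add_of_le (not_lt.mp hn)
        have h1 : h (n₀ + r + k) = h (n₀ + k) := by
          simp only [h]
          rw [show n₀ + r + k = n₀ + k + r by ring, hf _ (by omega)]
          push_cast
          ring
        rw [h1]
        exact ih _ (by omega)
  have hr' : (r : ℝ) ≠ 0 := by positivity
  have h2 : Tendsto (fun n : ℕ => h n / n) atTop (𝓝 0) := by
    refine squeeze_zero_norm (fun n => ?_) (tendsto_const_div_atTop_nhds_zero_nat C)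
    rw [norm_div, Real.norm_eq_abs, Real.norm_natCast]
    gcongr
    exact hC' n
  have h3 : Tendsto (fun n : ℕ => (E : ℝ) / r + h n / n / r) atTop (𝓝 ((E : ℝ) / r)) := by
    simpa using tendsto_const_nhds.add (h2.div_const (r : ℝ))
  refine h3.congr' ?_
  filter_upwards [eventually_ge_atTop 1] with n hn
  have hn' : (n : ℝ) ≠ 0 := by positivity
  simp only [h]
  field_simp
  ring

section

variable {R : Type u} [CommRing R] [IsLocalRing R] [IsNoetherianRing R] [IsOneDimCM R]
  {I : Ideal R} {r : ℕ} {x : R}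

lemma hasMultiplicity_iff (hx : IsReduction I r x) (hI : IsRegularIdeal I)
    (M : Type u) [AddCommGroup M] [Module R M] [Module.Finite R M] [Module.IsTorsionFree R M]
    (e : ℕ) :
    HasMultiplicity I M e ↔ Module.length R (M ⧸ (x • ⊤ : Submodule R M)) = r * e := by
  have hx0 := hx.mem_nonZeroDivisors hI
  have hreg := isSMulRegular_of_mem_nonZeroDivisors hx0 M
  have hfin : ∀ n, Module.length R (M ⧸ (I ^ n • ⊤ : Submodule R M)) ≠ ⊤ := fun n => by
    rw [← relLength_top]
    simpa using relLength_pow_ne_top hI (⊤ : Submodule R M) 0 n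
  have hE : Module.length R (M ⧸ (x • ⊤ : Submodule R M)) ≠ ⊤ := by
    rw [← relLength_top]
    exact relLength_smul_ne_top hx0 _
  obtain ⟨E, hE⟩ := ENat.ne_top_iff_exists.mp hE
  choose f hf using fun n => ENat.ne_top_iff_exists.mp (hfin n)
  obtain ⟨n₀, hn₀⟩ := hx.exists_forall_eq
  have hrec : ∀ n ≥ n₀, f (n + r) = f n + E := by
    intro n hn
    have h1 : relLength (I ^ n • ⊤ : Submodule R M) (I ^ (n + r) • ⊤) =
        relLength ⊤ (x • ⊤ : Submodule R M) := by
      rw [hn₀ n hn, mul_smul, Submodule.ideal_span_singleton_smul]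
      exact relLength_smul_self_eq hreg le_top
        (by rw [relLength_top]; exact hfin n)
    have h2 := relLength_add (Submodule.smul_mono_left (Ideal.pow_le_pow_right (by omega)) :
      (I ^ (n + r) • ⊤ : Submodule R M) ≤ I ^ n • ⊤) le_top
    rw [h1, relLength_top, relLength_top, relLength_top, ← hE, ← hf, ← hf] at h2
    norm_cast at h2
    omega
  have hlim := tendsto_div_of_forall_add_eq hx.one_le hrec
  have hlim' : Tendsto (fun n : ℕ => ENNReal.ofReal ((f n : ℝ) / n)) atTop
      (𝓝 (ENNReal.ofReal ((E : ℝ) / r))) := (ENNReal.continuous_ofReal.tendsto _).comp hlim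
  have hr' : (r : ℝ) ≠ 0 := by have := hx.one_le; positivity
  have key : ∀ e : ℝ≥0∞, HasMultiplicity I M e ↔ e = ENNReal.ofReal ((E : ℝ) / r) := by
    intro e
    have hl : ∀ c, Tendsto (fun n : ℕ => (((1 : ℕ) ! : ℕ) : ℝ≥0∞) *
        (Module.length R (M ⧸ (I ^ n • ⊤ : Submodule R M)) : ℝ≥0∞) / (n : ℝ≥0∞) ^ 1) atTop (𝓝 c) ↔
        Tendsto (fun n : ℕ => ENNReal.ofReal ((f n : ℝ) / n)) atTop (𝓝 c) := by
      intro c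
      refine tendsto_congr' ?_
      filter_upwards [eventually_ge_atTop 1] with n hn
      rw [← hf, ENNReal.ofReal_div_of_pos (by positivity)]
      simp
    constructor
    · rintro ⟨d, hd, h⟩
      rw [IsOneDimCM.ringKrullDim_eq] at hd
      have hd' : d = 1 := by exact_mod_cast hd.symm
      subst hd'
      exact tendsto_nhds_unique ((hl e).mp h) hlim'
    · rintro rfl
      exact ⟨1, IsOneDimCM.ringKrullDim_eq, (hl _).mpr hlim'⟩
  rw [key, ← hE]
  constructor
  · intro h
    have h1 : (e : ℝ) = E / r := by
      have h2 := congrArg ENNReal.toReal h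
      rwa [ENNReal.toReal_natCast, ENNReal.toReal_ofReal (by positivity)] at h2
    rw [eq_div_iff hr'] at h1
    have h3 : e * r = E := by exact_mod_cast h1
    rw [← h3]
    push_cast
    ring
  · intro h
    have h3 : E = r * e := by exact_mod_cast h
    rw [h3]
    push_cast
    rw [mul_div_cancel_left₀ _ hr', ENNReal.ofReal_natCast]

theorem isUlrichWrt_iff (hx : IsReduction I r x) (hI : IsRegularIdeal I)
    (M : Type u) [AddCommGroup M] [Module R M] :
    IsUlrichWrt I M ↔ Module.Finite R M ∧ Module.IsTorsionFree R M ∧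
      (I ^ r • ⊤ : Submodule R M) = x • ⊤ := by
  rw [IsUlrichWrt, isMCM_iff, and_assoc]
  refine and_congr_right fun hfin => and_congr_right fun htf => ?_
  rw [← smul_length_eq_iff hx hI]
  have h1 : Module.length R (M ⧸ (I • ⊤ : Submodule R M)) ≠ ⊤ := by
    rw [← relLength_top]
    simpa using relLength_pow_ne_top hI (⊤ : Submodule R M) 0 1
  obtain ⟨e, he⟩ := ENat.ne_top_iff_exists.mp h1
  rw [← he, ← hasMultiplicity_iff hx hI]
  simp

lemma mu_eq_length {R : Type u} [CommRing R] [IsLocalRing R] (M : Type u) [AddCommGroup M] [Module R M] [Module.Finite R M] :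
    (mu R M : ℕ∞) = Module.length R (M ⧸ (maximalIdeal R • ⊤ : Submodule R M)) := by
  rw [← relLength_top, ← length_quotient_smul_top, mu,
    IsLocalRing.spanFinrank_eq_finrank_quotient _ Module.Finite.fg_top]
  let : Field (R ⧸ maximalIdeal R) := Ideal.Quotient.field _
  have : Module.Finite (R ⧸ maximalIdeal R)
      ((⊤ : Submodule R M) ⧸ (maximalIdeal R • ⊤ : Submodule R (⊤ : Submodule R M))) :=
    Module.Finite.of_restrictScalars_finite R _ _
  rw [← Module.length_eq_finrank]
  exact (Module.length_eq_of_surjective Ideal.Quotient.mk_surjective).symm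

theorem isUlrich_iff {R : Type u} [CommRing R] [IsLocalRing R] (M : Type u) [AddCommGroup M] [Module R M] :
    IsUlrich R M ↔ IsUlrichWrt (maximalIdeal R) M := by
  refine and_congr_right fun h => ?_
  have := h.1
  rw [← mu_eq_length]
  simp

end

end UlrichSplit

namespace UlrichSplit

/-- Every maximal ideal of `B` becomes principal in the localization at it. -/
def MaxLocPrincipal (B : Type*) [CommRing B] : Prop :=
  ∀ n : Ideal B, n.IsMaximal → ∃ a ∈ n, ∃ u ∉ n, ∀ z ∈ n, a ∣ u * z

section LocalPrincipal

variable {A : Type*} [CommRing A] [IsLocalRing A] [IsNoetherianRing A] {a : A}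

lemma exists_isUnit_mul_pow (hm : maximalIdeal A = Ideal.span {a}) {b : A} (hb : b ≠ 0) :
    ∃ (i : ℕ) (u : A), IsUnit u ∧ b = u * a ^ i := by
  have h1 : ∃ i, b ∉ maximalIdeal A ^ i := by
    by_contra! h
    refine hb ?_
    have h2 : b ∈ (⨅ i, maximalIdeal A ^ i : Ideal A) := by simpa [Ideal.mem_iInf] using h
    rwa [Ideal.iInf_pow_eq_bot_of_isLocalRing _ (Ideal.IsPrime.ne_top'), Ideal.mem_bot] at h2
  classical
  have h3 := Nat.find_spec h1
  have h4 : Nat.find h1 ≠ 0 := by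
    intro h
    rw [h] at h3
    simp at h3
  obtain ⟨i, hi⟩ := Nat.exists_eq_succ_of_ne_zero h4
  have h5 : b ∈ maximalIdeal A ^ i := not_not.mp (Nat.find_min h1 (by omega))
  rw [hm, Ideal.span_singleton_pow, Ideal.mem_span_singleton'] at h5
  obtain ⟨u, hu⟩ := h5
  refine ⟨i, u, ?_, hu.symm⟩
  by_contra hcon
  have h6 : u ∈ maximalIdeal A := hcon
  rw [hi] at h3
  refine h3 ?_
  rw [← hu, pow_succ']
  exact Ideal.mul_mem_mul h6 (hm ▸ Ideal.pow_mem_pow (Ideal.mem_span_singleton_self a) i)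

lemma isDomain_of_maximalIdeal_eq_span (hm : maximalIdeal A = Ideal.span {a})
    (ha : a ∈ nonZeroDivisors A) : IsDomain A := by
  have : NoZeroDivisors A := by
    refine ⟨fun {b c} hbc => ?_⟩
    by_contra! hcon
    obtain ⟨i, u, hu, hb⟩ := exists_isUnit_mul_pow hm hcon.1
    obtain ⟨j, v, hv, hc⟩ := exists_isUnit_mul_pow hm hcon.2
    have h1 : u * v * a ^ (i + j) = 0 := by
      rw [← hbc, hb, hc]; ring
    have h2 : u * v = 0 := (mem_nonZeroDivisors_iff_right.mp (pow_mem ha _)) _ h1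
    exact (hu.mul hv).ne_zero h2
  exact NoZeroDivisors.to_isDomain A

lemma isTorsionFree_of_maximalIdeal_eq_span (hm : maximalIdeal A = Ideal.span {a}) {M : Type*}
    [AddCommGroup M] [Module A M] (ha : IsSMulRegular M a) : Module.IsTorsionFree A M := by
  refine ⟨fun r hr => ?_⟩
  obtain ⟨i, u, hu, rfl⟩ := exists_isUnit_mul_pow hm hr.ne_zero
  exact (hu.isSMulRegular M).mul (ha.pow i)

end LocalPrincipal

section

variable {B : Type*} [CommRing B] {n : Ideal B} [hn : n.IsPrime] {t : B}

lemma maximalIdeal_localization_eq_span {a u : B} (ha : a ∈ n) (hu : u ∉ n)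
    (h : ∀ z ∈ n, a ∣ u * z) :
    maximalIdeal (Localization.AtPrime n) =
      Ideal.span {algebraMap B (Localization.AtPrime n) a} := by
  rw [← Localization.AtPrime.map_eq_maximalIdeal]
  refine le_antisymm (Ideal.map_le_iff_le_comap.mpr fun z hz => ?_) ?_
  · obtain ⟨b, hb⟩ := h z hz
    have h1 : IsUnit (algebraMap B (Localization.AtPrime n) u) :=
      IsLocalization.map_units _ (⟨u, hu⟩ : n.primeCompl)
    rw [Ideal.mem_comap, ← Ideal.unit_mul_mem_iff_mem _ h1, ← map_mul, hb, map_mul]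
    exact Ideal.mul_mem_right _ _ (Ideal.mem_span_singleton_self _)
  · rw [Ideal.span_singleton_le_iff_mem]
    exact Ideal.mem_map_of_mem _ ha

lemma isSMulRegular_localizedModule {M : Type*} [AddCommGroup M] [Module B M]
    (ht : IsSMulRegular M t) :
    IsSMulRegular (LocalizedModule n.primeCompl M) (algebraMap B (Localization.AtPrime n) t) := by
  rw [isSMulRegular_iff_right_eq_zero_of_smul]
  intro v hv
  obtain ⟨⟨m, s⟩, hm⟩ := IsLocalizedModule.surj n.primeCompl
    (LocalizedModule.mkLinearMap n.primeCompl M) v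
  have h1 : LocalizedModule.mkLinearMap n.primeCompl M (t • m) = 0 := by
    rw [map_smul, ← hm, smul_comm, ← algebraMap_smul (Localization.AtPrime n) t v, hv, smul_zero]
  rw [IsLocalizedModule.eq_zero_iff n.primeCompl] at h1
  obtain ⟨c, hc⟩ := h1
  have h2 : c • m = 0 := by
    refine ht.right_eq_zero_of_smul (x := c • m) ?_
    rw [smul_comm, hc]
  have h3 : LocalizedModule.mkLinearMap n.primeCompl M m = 0 :=
    (IsLocalizedModule.eq_zero_iff n.primeCompl _).mpr ⟨c, h2⟩
  rw [h3] at hm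
  refine IsLocalizedModule.smul_injective (LocalizedModule.mkLinearMap n.primeCompl M) s ?_
  simpa using hm

end

section MaxLocPrincipal

variable {B : Type*} [CommRing B] {t : B}

lemma isSMulRegular_of_dvd {M : Type*} [AddCommGroup M] [Module B M] {a b : B} (h : a ∣ b)
    (hb : IsSMulRegular M b) : IsSMulRegular M a := by
  obtain ⟨c, rfl⟩ := h
  exact IsSMulRegular.of_mul (a := c) (by rwa [mul_comm])

variable [IsNoetherianRing B]

lemma MaxLocPrincipal.isDomain_localization (h : MaxLocPrincipal B) (ht : t ∈ nonZeroDivisors B)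
    {n : Ideal B} [hn : n.IsMaximal] (htn : t ∈ n) :
    ∃ a ∈ n, maximalIdeal (Localization.AtPrime n) =
      Ideal.span {algebraMap B (Localization.AtPrime n) a} ∧
      algebraMap B (Localization.AtPrime n) a ∣ algebraMap B (Localization.AtPrime n) t ∧
      IsDomain (Localization.AtPrime n) ∧ IsPrincipalIdealRing (Localization.AtPrime n) := by
  obtain ⟨a, ha, u, hu, hz⟩ := h n hn
  have hm := maximalIdeal_localization_eq_span ha hu hz
  have hdvd : algebraMap B (Localization.AtPrime n) a ∣ algebraMap B (Localization.AtPrime n) t := by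
    rw [← Ideal.mem_span_singleton, ← hm, ← Localization.AtPrime.map_eq_maximalIdeal]
    exact Ideal.mem_map_of_mem _ htn
  refine ⟨a, ha, hm, hdvd, ?_⟩
  have h1 : algebraMap B (Localization.AtPrime n) t ∈ nonZeroDivisors (Localization.AtPrime n) :=
    IsLocalization.map_nonZeroDivisors_le n.primeCompl _ ⟨t, ht, rfl⟩
  have h2 : algebraMap B (Localization.AtPrime n) a ∈ nonZeroDivisors (Localization.AtPrime n) := by
    obtain ⟨c, hc⟩ := hdvd
    rw [hc] at h1
    exact (mul_mem_nonZeroDivisors.mp h1).1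
  have := isDomain_of_maximalIdeal_eq_span hm h2
  have h3 : (maximalIdeal (Localization.AtPrime n)).IsPrincipal := ⟨_, hm⟩
  exact ⟨this, ((tfae_of_isNoetherianRing_of_isLocalRing_of_isDomain _).out 4 0).mp h3⟩

theorem MaxLocPrincipal.projective (h : MaxLocPrincipal B) (ht : t ∈ nonZeroDivisors B)
    (htn : ∀ n : Ideal B, n.IsMaximal → t ∈ n) (M : Type*) [AddCommGroup M] [Module B M]
    [Module.Finite B M] (htM : IsSMulRegular M t) : Module.Projective B M := by
  have : Module.FinitePresentation B M := Module.finitePresentation_of_finite B M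
  refine Module.projective_of_localization_maximal fun n hn => ?_
  obtain ⟨a, ha, hm, hdvd, hdom, hpir⟩ := h.isDomain_localization ht (htn n hn)
  have h1 := isSMulRegular_of_dvd hdvd (isSMulRegular_localizedModule (n := n) htM)
  have := isTorsionFree_of_maximalIdeal_eq_span hm h1
  infer_instance

theorem MaxLocPrincipal.isRegularRing (h : MaxLocPrincipal B) (ht : t ∈ nonZeroDivisors B)
    (htn : ∀ n : Ideal B, n.IsMaximal → t ∈ n) : IsRegularRing B := by
  rw [isRegularRing_iff]
  intro p hp
  by_cases hpm : p.IsMaximal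
  · obtain ⟨a, ha, hm, hdvd, hdom, hpir⟩ := h.isDomain_localization ht (htn p hpm)
    infer_instance
  · obtain ⟨n, hn, hpn⟩ := Ideal.exists_le_maximal p hp.ne_top
    obtain ⟨a, ha, hm, hdvd, hdom, hpir⟩ := h.isDomain_localization ht (htn n hn)
    have hap : a ∉ p := by
      intro hap
      obtain ⟨a', ha', u, hu, hz⟩ := h n hn
      have h1 : algebraMap B (Localization.AtPrime n) a' ∈ maximalIdeal _ := by
        rw [← Localization.AtPrime.map_eq_maximalIdeal]
        exact Ideal.mem_map_of_mem _ ha'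
      refine hpm ?_
      suffices p = n by rwa [this]
      refine le_antisymm hpn fun z hz' => ?_
      have h2 : algebraMap B (Localization.AtPrime n) z ∈ p.map (algebraMap B (Localization.AtPrime n)) := by
        have h3 : algebraMap B (Localization.AtPrime n) z ∈ maximalIdeal (Localization.AtPrime n) := by
          rw [← Localization.AtPrime.map_eq_maximalIdeal]
          exact Ideal.mem_map_of_mem _ hz'
        rw [hm] at h3
        refine (Ideal.span_singleton_le_iff_mem _).mpr ?_ h3
        exact Ideal.mem_map_of_mem _ hap
      rw [IsLocalization.algebraMap_mem_map_algebraMap_iff n.primeCompl] at h2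
      obtain ⟨c, hc, hcz⟩ := h2
      exact (hp.mem_or_mem hcz).resolve_left fun hcp => hc (hpn hcp)
    have hzero : ∀ z ∈ p, algebraMap B (Localization.AtPrime p) z = 0 := by
      intro z hz
      suffices hz0 : algebraMap B (Localization.AtPrime n) z = 0 by
        rw [IsLocalization.map_eq_zero_iff n.primeCompl] at hz0
        obtain ⟨c, hc⟩ := hz0
        rw [IsLocalization.map_eq_zero_iff p.primeCompl]
        exact ⟨⟨c, fun hcp => c.2 (hpn hcp)⟩, hc⟩
      by_contra hz0
      obtain ⟨i, u, hu, hzu⟩ := exists_isUnit_mul_pow hm hz0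
      have h2 : algebraMap B (Localization.AtPrime n) (a ^ i) ∈
          p.map (algebraMap B (Localization.AtPrime n)) := by
        rw [map_pow, ← Ideal.unit_mul_mem_iff_mem _ hu, ← hzu]
        exact Ideal.mem_map_of_mem _ hz
      rw [IsLocalization.algebraMap_mem_map_algebraMap_iff n.primeCompl] at h2
      obtain ⟨c, hc, hcz⟩ := h2
      rcases hp.mem_or_mem hcz with h3 | h3
      · exact hc (hpn h3)
      · exact hap (hp.mem_of_pow_mem _ h3)
    have hbot : maximalIdeal (Localization.AtPrime p) = ⊥ := by
      rw [← Localization.AtPrime.map_eq_maximalIdeal, eq_bot_iff, Ideal.map_le_iff_le_comap]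
      exact fun z hz => hzero z hz
    let : Field (Localization.AtPrime p) := (isField_iff_maximalIdeal_eq.mpr hbot).toField
    infer_instance

theorem maxLocPrincipal_of_isRegularRing {B : Type*} [CommRing B] {t : B} [IsRegularRing B]
    (htn : ∀ n : Ideal B, n.IsMaximal → t ∈ n)
    (htp : ∀ p : Ideal B, p.IsPrime → t ∈ p → p.IsMaximal) : MaxLocPrincipal B := by
  intro n hn
  have hmin : n ∈ (Ideal.span {t}).minimalPrimes := by
    refine ⟨⟨hn.isPrime, by simpa [Ideal.span_le] using htn n hn⟩, ?_⟩
    rintro q ⟨hq, htq⟩ hqn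
    have hqm := htp q hq (htq (Ideal.mem_span_singleton_self t))
    exact (hqm.eq_of_le hn.ne_top hqn).ge
  have hht : n.height ≤ 1 := Ideal.height_le_one_of_isPrincipal_of_mem_minimalPrimes _ n hmin
  have h1 : (maximalIdeal (Localization.AtPrime n)).IsPrincipal := by
    have h2 := (isRegularLocalRing_iff (Localization.AtPrime n)).mp
      (IsRegularRing.isRegularLocalRing_localization n)
    rw [IsLocalization.AtPrime.ringKrullDim_eq_height n] at h2
    have h3 : (maximalIdeal (Localization.AtPrime n)).spanFinrank ≤ 1 := by
      have h4 : ((maximalIdeal (Localization.AtPrime n)).spanFinrank : WithBot ℕ∞) ≤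
          ((1 : ℕ) : WithBot ℕ∞) := by
        rw [h2]; exact_mod_cast hht
      exact_mod_cast h4
    have hfg : (maximalIdeal (Localization.AtPrime n)).FG := IsNoetherian.noetherian _
    rcases Nat.le_one_iff_eq_zero_or_eq_one.mp h3 with h4 | h4
    · rw [Submodule.spanFinrank_eq_zero_iff_eq_bot hfg] at h4
      rw [h4]
      infer_instance
    · exact ((Submodule.spanFinrank_eq_one_iff _).mp h4).1
  obtain ⟨α, hα⟩ := h1
  have hαm : α ∈ maximalIdeal (Localization.AtPrime n) := hα ▸ Submodule.mem_span_singleton_self α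
  obtain ⟨a, s, rfl⟩ := IsLocalization.exists_mk'_eq n.primeCompl α
  have han : a ∈ n := (IsLocalization.AtPrime.mk'_mem_maximal_iff _ n a s).mp hαm
  have h5 : ∀ z ∈ n, ∃ u ∉ n, a ∣ u * z := by
    intro z hz
    have h6 : algebraMap B (Localization.AtPrime n) z ∈ maximalIdeal (Localization.AtPrime n) := by
      rw [← Localization.AtPrime.map_eq_maximalIdeal]
      exact Ideal.mem_map_of_mem _ hz
    rw [hα] at h6
    have h7 : algebraMap B (Localization.AtPrime n) z ∈
        (Ideal.span {a}).map (algebraMap B (Localization.AtPrime n)) := by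
      rw [Ideal.map_span, Set.image_singleton]
      refine (Ideal.span_singleton_le_span_singleton.mpr ?_ : Ideal.span _ ≤ _) h6
      exact ⟨IsLocalization.mk' _ 1 s, IsLocalization.mk'_eq_mul_mk'_one a s⟩
    rw [IsLocalization.algebraMap_mem_map_algebraMap_iff n.primeCompl] at h7
    obtain ⟨c, hc, hcz⟩ := h7
    exact ⟨c, hc, Ideal.mem_span_singleton.mp hcz⟩
  obtain ⟨S, hS⟩ := (IsNoetherian.noetherian n : n.FG)
  choose! u hu hdvd using h5
  have hSn : ∀ z ∈ S, z ∈ n := fun z hz => hS ▸ Submodule.subset_span hz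
  refine ⟨a, han, ∏ z ∈ S, u z, ?_, fun z hz => ?_⟩
  · rw [hn.isPrime.prod_mem_iff]
    push Not
    exact fun z hz => hu z (hSn z hz)
  · have h8 : n ≤ Submodule.comap (LinearMap.mulLeft B (∏ z ∈ S, u z)) (Ideal.span {a}) := by
      conv_lhs => rw [← hS]
      rw [Submodule.span_le]
      intro w hw
      change (∏ z ∈ S, u z) * w ∈ Ideal.span {a}
      rw [Ideal.mem_span_singleton]
      exact (hdvd w (hSn w hw)).trans (mul_dvd_mul_right (Finset.dvd_prod_of_mem u hw) w)
    exact Ideal.mem_span_singleton.mp (h8 hz)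

end MaxLocPrincipal

end UlrichSplit

namespace UlrichSplit

section FractionRing

variable {R : Type*} [CommRing R]

lemma isUnit_algebraMap_fractionRing {z : R} (hz : z ∈ nonZeroDivisors R) :
    IsUnit (algebraMap R (FractionRing R) z) :=
  IsLocalization.map_units (FractionRing R) (⟨z, hz⟩ : nonZeroDivisors R)

lemma exists_smul_eq_algebraMap (q : FractionRing R) :
    ∃ z ∈ nonZeroDivisors R, ∃ a : R, z • q = algebraMap R _ a := by
  obtain ⟨⟨a, z⟩, h⟩ := IsLocalization.surj (nonZeroDivisors R) q
  refine ⟨z, z.2, a, ?_⟩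
  rw [Algebra.smul_def, mul_comm]
  exact h

lemma smul_fractionRing_cancel {z : R} (hz : z ∈ nonZeroDivisors R) {p q : FractionRing R}
    (h : z • p = z • q) : p = q := by
  rw [Algebra.smul_def, Algebra.smul_def] at h
  exact (isUnit_algebraMap_fractionRing hz).mul_left_cancel h

/-- Linear maps from a module embedded in `Q(R)` to `Q(R)` are multiplications by elements of
`Q(R)`. -/
lemma exists_forall_eq_mul {X : Type*} [AddCommGroup X] [Module R X] (i : X →ₗ[R] FractionRing R)
    (hi : Function.Injective i) {x₀ : X} (hx₀ : IsUnit (i x₀)) (g : X →ₗ[R] FractionRing R) :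
    ∃ q : FractionRing R, ∀ v, g v = q * i v := by
  obtain ⟨w, hw⟩ := hx₀.exists_right_inv
  refine ⟨g x₀ * w, fun v => ?_⟩
  obtain ⟨z, hz, a, ha⟩ := exists_smul_eq_algebraMap (i v)
  obtain ⟨y, hy, c, hc⟩ := exists_smul_eq_algebraMap (i x₀)
  have h1 : (c * z) • v = (a * y) • x₀ := by
    apply hi
    rw [map_smul, map_smul, mul_smul, ha, mul_smul, hc, Algebra.smul_def, Algebra.smul_def]
    ring
  have h2 : (c * z) • g v = (a * y) • g x₀ := by rw [← map_smul, h1, map_smul]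
  have hcz : algebraMap R (FractionRing R) c * w = algebraMap R (FractionRing R) y := by
    rw [← hc, Algebra.smul_def, mul_assoc, hw, mul_one]
  refine smul_fractionRing_cancel (mul_mem hz hy) ?_
  simp only [Algebra.smul_def, map_mul] at h2 ha ⊢
  linear_combination w * h2 - algebraMap R (FractionRing R) z * g v * hcz +
    (- algebraMap R (FractionRing R) y * g x₀ * w) * ha

end FractionRing

/-- A shortcut for instance search, which otherwise looks for `Module A n` first. -/
instance (priority := high) moduleIdealSubalgebra {R A : Type*} [CommRing R] [CommRing A]
    [Algebra R A] (B : Subalgebra R A) (n : Ideal B) : Module B n := Submodule.module n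

section SubalgebraModules

variable {R : Type*} [CommRing R] {B : Subalgebra R (FractionRing R)}

lemma subalgebra_exists_smul_eq (b : B) :
    ∃ z ∈ nonZeroDivisors R, ∃ a : R, z • b = algebraMap R B a := by
  obtain ⟨z, hz, a, h⟩ := exists_smul_eq_algebraMap (b : FractionRing R)
  exact ⟨z, hz, a, Subtype.ext h⟩

lemma algebraMap_mem_nonZeroDivisors (B : Subalgebra R (FractionRing R)) {t : R}
    (ht : t ∈ nonZeroDivisors R) : algebraMap R B t ∈ nonZeroDivisors B := by
  rw [mem_nonZeroDivisors_iff_right]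
  intro b hb
  have h1 : (b : FractionRing R) * algebraMap R _ t = 0 := congrArg Subtype.val hb
  exact Subtype.ext ((isUnit_algebraMap_fractionRing ht).mul_left_eq_zero.mp h1)

instance isTorsionFree_subalgebra (B : Subalgebra R (FractionRing R)) : Module.IsTorsionFree R B := by
  refine ⟨fun t ht b c h => ?_⟩
  exact Subtype.ext (smul_fractionRing_cancel (isRegular_iff_mem_nonZeroDivisors.mp ht)
    (congrArg Subtype.val h))

end SubalgebraModules

/-- Every element of the `R`-algebra `B` is a fraction of elements of `R`. -/
class IsBirational (R B : Type*) [CommRing R] [CommRing B] [Algebra R B] : Prop where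
  exists_smul_eq : ∀ b : B, ∃ z ∈ nonZeroDivisors R, ∃ a : R, z • b = algebraMap R B a

instance {R : Type*} [CommRing R] (B : Subalgebra R (FractionRing R)) : IsBirational R B :=
  ⟨subalgebra_exists_smul_eq⟩

instance {R : Type*} [CommRing R] : Module.IsTorsionFree R (FractionRing R) :=
  ⟨fun _ ht _ _ h => smul_fractionRing_cancel (isRegular_iff_mem_nonZeroDivisors.mp ht) h⟩

section Birational

variable {R B : Type*} [CommRing R] [CommRing B] [Algebra R B] [IsBirational R B]
  {M N : Type*} [AddCommGroup M] [Module R M] [Module B M] [IsScalarTower R B M]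
  [AddCommGroup N] [Module R N] [Module B N] [IsScalarTower R B N] [Module.IsTorsionFree R N]

lemma map_birational_smul (f : M →ₗ[R] N) (b : B) (v : M) : f (b • v) = b • f v := by
  obtain ⟨z, hz, a, h⟩ := IsBirational.exists_smul_eq (R := R) b
  refine Module.IsTorsionFree.isSMulRegular (isRegular_iff_mem_nonZeroDivisors.mpr hz) ?_
  simp only
  rw [← map_smul, ← smul_assoc, ← smul_assoc, h, algebraMap_smul, algebraMap_smul, map_smul]

variable (B) in
/-- A linear map between modules over a birational extension `B` of `R`, the target being
torsion-free, is `B`-linear. -/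
def extendLinear (f : M →ₗ[R] N) : M →ₗ[B] N where
  toFun := f
  map_add' := map_add f
  map_smul' := map_birational_smul f

lemma projective_of_section {k : ℕ} [Module.IsTorsionFree R B] (f : (Fin k → B) →ₗ[B] M)
    (s : M →ₗ[R] (Fin k → B)) (hs : f.restrictScalars R ∘ₗ s = LinearMap.id) :
    Module.Projective B M :=
  Module.Projective.of_split (extendLinear B s) f
    (LinearMap.ext fun v => LinearMap.congr_fun hs v)

end Birational

lemma exists_forall_mem_iff_dvd {B : Type*} [CommRing B] [IsNoetherianRing B] {t : B} {n : Ideal B}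
    (hn : n ∈ (Ideal.span {t}).minimalPrimes) : ∃ b, ∀ z, z ∈ n ↔ t ∣ z * b := by
  have h1 : (Ideal.span {t} : Submodule B B).colon {1} = Ideal.span {t} := by
    ext z
    simp [Submodule.mem_colon_singleton]
  rw [← h1] at hn
  obtain ⟨b, hb⟩ := Submodule.exists_eq_colon_of_mem_minimalPrimes hn
  refine ⟨b, fun z => ?_⟩
  rw [hb, Submodule.mem_colon_singleton, smul_eq_mul, Ideal.mem_span_singleton]

section Subalgebra

variable {R : Type*} [CommRing R] {B : Subalgebra R (FractionRing R)}

/-- A finitely generated projective module embedded in `Q(R)` is invertible. -/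
lemma exists_sum_mul_eq_one {X : Type*} [AddCommGroup X] [Module R X] [Module B X]
    [IsScalarTower R B X] [Module.Finite B X] [Module.Projective B X] (i : X →ₗ[R] FractionRing R)
    (hi : Function.Injective i) {x₀ : X} (hx₀ : IsUnit (i x₀)) :
    ∃ (k : ℕ) (x : Fin k → X) (q : Fin k → FractionRing R),
      (∀ j v, q j * i v ∈ B) ∧ ∑ j, q j * i (x j) = 1 := by
  obtain ⟨k, f, hf⟩ := Module.Finite.exists_fin' B X
  obtain ⟨s, hs⟩ := Module.projective_lifting_property f LinearMap.id hf
  let g : Fin k → X →ₗ[R] FractionRing R := fun j =>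
    B.val.toLinearMap ∘ₗ ((LinearMap.proj j ∘ₗ s).restrictScalars R)
  choose q hq using fun j => exists_forall_eq_mul i hi hx₀ (g j)
  have hfs : ∀ v, f (s v) = v := fun v => LinearMap.congr_fun hs v
  refine ⟨k, fun j => f (Pi.single j 1), q, fun j v => ?_, ?_⟩
  · rw [← hq]
    exact (s v j).2
  · have h1 : i (f (s x₀)) = ∑ j, g j x₀ * i (f (Pi.single j 1)) := by
      rw [pi_eq_sum_univ' (s x₀), map_sum, map_sum]
      refine Finset.sum_congr rfl fun j _ => ?_
      rw [map_smul, map_birational_smul i]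
      simp only [Subalgebra.smul_def, smul_eq_mul, g]
      congr 2
    rw [hfs] at h1
    simp only [hq] at h1
    refine hx₀.mul_right_cancel ?_
    rw [one_mul]
    conv_rhs => rw [h1]
    rw [Finset.sum_mul]
    exact Finset.sum_congr rfl fun j _ => by ring

lemma algebraMap_mem_of_isMaximal [IsLocalRing R] [Module.Finite R B] {n : Ideal B} (hn : n.IsMaximal) {t : R}
    (ht : t ∈ maximalIdeal R) : algebraMap R B t ∈ n := by
  have h1 : (n.comap (algebraMap R B)).IsMaximal :=
    Ideal.isMaximal_comap_of_isIntegral_of_isMaximal n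
  rw [← IsLocalRing.eq_maximalIdeal h1] at ht
  exact ht

lemma isNoetherianRing_subalgebra [IsNoetherianRing R] [Module.Finite R B] : IsNoetherianRing B :=
  isNoetherian_of_tower R inferInstance

lemma isIntegral_of_forall_mul_mem {X : Submodule R (FractionRing R)} (hX : X.FG)
    {x₀ : FractionRing R} (hx₀ : x₀ ∈ X) (hunit : IsUnit x₀) {q : FractionRing R}
    (h : ∀ v ∈ X, q * v ∈ X) : IsIntegral R q := by
  have : Module.Finite R X := Module.Finite.iff_fg.mpr hX
  let f : Module.End R X := (LinearMap.mulLeft R q).restrict h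
  obtain ⟨p, hp, hpf⟩ := (Algebra.IsIntegral.isIntegral f : IsIntegral R f)
  refine ⟨p, hp, ?_⟩
  have h1 : ∀ p : Polynomial R, ∀ v : X, ((Polynomial.aeval f p v : X) : FractionRing R) =
      Polynomial.aeval q p * v := by
    intro p v
    induction p using Polynomial.induction_on with
    | C a => simp [Algebra.smul_def]
    | add p₁ p₂ h₁ h₂ => simp [h₁, h₂, add_mul]
    | monomial n a ih =>
      have h2 : ∀ n : ℕ, (((f ^ n) v : X) : FractionRing R) = q ^ n * v := by
        intro n
        induction n with
        | zero => simp
        | succ n ihn =>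
          rw [pow_succ', Module.End.mul_apply]
          change q * (((f ^ n) v : X) : FractionRing R) = _
          rw [ihn]; ring
      simp [h2, Algebra.smul_def, mul_assoc]
  have h2 := h1 p ⟨x₀, hx₀⟩
  change Polynomial.aeval f p = 0 at hpf
  rw [hpf] at h2
  exact hunit.mul_left_eq_zero.mp h2.symm

end Subalgebra

section OneDim

variable {R : Type u} [CommRing R] [IsLocalRing R] [IsNoetherianRing R] [IsOneDimCM R]
  {B : Subalgebra R (FractionRing R)} [Module.Finite R B]

lemma isMaximal_of_algebraMap_mem {p : Ideal B} (hp : p.IsPrime) {t : R}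
    (ht : t ∈ nonZeroDivisors R) (htp : algebraMap R B t ∈ p) : p.IsMaximal := by
  refine Ideal.isMaximal_of_isIntegral_of_isMaximal_comap (R := R) p ?_
  obtain ⟨k, hk⟩ := exists_pow_le_span ht
  have h1 : maximalIdeal R ≤ p.comap (algebraMap R B) := by
    have : (p.comap (algebraMap R B)).IsPrime := inferInstance
    refine this.le_of_pow_le (n := k) (hk.trans ?_)
    rwa [Ideal.span_singleton_le_iff_mem, Ideal.mem_comap]
  rw [← (maximalIdeal.isMaximal R).eq_of_le (Ideal.IsPrime.ne_top inferInstance) h1]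
  exact maximalIdeal.isMaximal R

theorem isRegularRing_iff_maxLocPrincipal : IsRegularRing B ↔ MaxLocPrincipal B := by
  have : IsNoetherianRing B := isNoetherianRing_subalgebra
  obtain ⟨t, htm, ht⟩ := IsOneDimCM.exists_mem (R := R)
  constructor
  · intro h
    exact maxLocPrincipal_of_isRegularRing (t := algebraMap R B t)
      (fun n hn => algebraMap_mem_of_isMaximal hn htm)
      (fun p hp htp => isMaximal_of_algebraMap_mem hp ht htp)
  · intro h
    exact h.isRegularRing (algebraMap_mem_nonZeroDivisors B ht)
      (fun n hn => algebraMap_mem_of_isMaximal hn htm)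

lemma MaxLocPrincipal.projective_of_isTorsionFree (h : MaxLocPrincipal B) (M : Type*)
    [AddCommGroup M] [Module R M] [Module B M] [IsScalarTower R B M] [Module.Finite R M]
    [Module.IsTorsionFree R M] : Module.Projective B M := by
  have : IsNoetherianRing B := isNoetherianRing_subalgebra
  have : Module.Finite B M := Module.Finite.of_restrictScalars_finite R B M
  obtain ⟨t, htm, ht⟩ := IsOneDimCM.exists_mem (R := R)
  refine h.projective (algebraMap_mem_nonZeroDivisors B ht)
    (fun n hn => algebraMap_mem_of_isMaximal hn htm) M ?_
  have h1 := isSMulRegular_of_mem_nonZeroDivisors ht M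
  intro v w hvw
  simp only [algebraMap_smul] at hvw
  exact h1 hvw

lemma maxLocPrincipal_of_projective (h : ∀ n : Ideal B, n.IsMaximal → Module.Projective B n) :
    MaxLocPrincipal B := by
  have : IsNoetherianRing B := isNoetherianRing_subalgebra
  obtain ⟨t, htm, ht⟩ := IsOneDimCM.exists_mem (R := R)
  intro n hn
  have := h n hn
  let i : n →ₗ[R] FractionRing R := B.val.toLinearMap ∘ₗ (n.subtype.restrictScalars R)
  have hi : Function.Injective i := Subtype.val_injective.comp n.injective_subtype
  obtain ⟨k, x, q, hq, hsum⟩ := exists_sum_mul_eq_one (B := B) i hi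
    (x₀ := ⟨algebraMap R B t, algebraMap_mem_of_isMaximal hn htm⟩) (isUnit_algebraMap_fractionRing ht)
  have h1 : ∃ j, (⟨_, hq j (x j)⟩ : B) ∉ n := by
    by_contra! hcon
    refine hn.ne_top ((Ideal.eq_top_iff_one n).mpr ?_)
    have h2 : (1 : B) = ∑ j, (⟨_, hq j (x j)⟩ : B) := by
      apply Subtype.ext
      push_cast
      exact hsum.symm
    rw [h2]
    exact Ideal.sum_mem _ fun j _ => hcon j
  obtain ⟨j, hj⟩ := h1
  refine ⟨x j, (x j).2, _, hj, fun z hz => ⟨⟨_, hq j ⟨z, hz⟩⟩, Subtype.ext ?_⟩⟩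
  change q j * (x j : B) * (z : FractionRing R) = (x j : B) * (q j * (z : FractionRing R))
  ring

/-- Regularity implies normality. -/
theorem MaxLocPrincipal.integralClosure_le (h : MaxLocPrincipal B) :
    integralClosure R (FractionRing R) ≤ B := by
  intro q hq
  let C : Subalgebra R (FractionRing R) := B ⊔ Algebra.adjoin R {q}
  have hBC : B ≤ C := le_sup_left
  have hqC : q ∈ C := le_sup_right (a := B) (Algebra.self_mem_adjoin_singleton R q)
  have hfin : Module.Finite R C := by
    have h1 : (Subalgebra.toSubmodule B).FG := Module.Finite.iff_fg.mp ‹_›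
    have h2 := h1.mul (IsIntegral.fg_adjoin_singleton (R := R) hq)
    rw [Subalgebra.mul_toSubmodule] at h2
    exact Module.Finite.iff_fg.mpr h2
  let : Module B C := (Subalgebra.inclusion hBC).toRingHom.toModule
  have hsmul : ∀ (b : B) (c : C), ((b • c : C) : FractionRing R) = b * c := fun b c => rfl
  have : IsScalarTower R B C := ⟨fun r b c => Subtype.ext (by simp [hsmul])⟩
  have := h.projective_of_isTorsionFree C
  have : Module.Finite B C := Module.Finite.of_restrictScalars_finite R B C
  obtain ⟨k, x, p, hp, hsum⟩ := exists_sum_mul_eq_one (B := B) C.val.toLinearMap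
    Subtype.val_injective (x₀ := 1) isUnit_one
  have h3 : q = ∑ j, p j * ((x j : FractionRing R) * q) := by
    simp_rw [← mul_assoc]
    rw [← Finset.sum_mul]
    exact (one_mul q).symm.trans (congrArg (· * q) hsum.symm)
  rw [h3]
  exact Subalgebra.sum_mem _ fun j _ => hp j (x j * ⟨q, hqC⟩)

/-- Normality implies regularity in dimension one. -/
theorem maxLocPrincipal_of_integralClosure_le (h : integralClosure R (FractionRing R) ≤ B) :
    MaxLocPrincipal B := by
  have : IsNoetherianRing B := isNoetherianRing_subalgebra
  obtain ⟨t, htm, ht⟩ := IsOneDimCM.exists_mem (R := R)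
  intro n hn
  have htn : algebraMap R B t ∈ n := algebraMap_mem_of_isMaximal hn htm
  have hmin : n ∈ (Ideal.span {algebraMap R B t}).minimalPrimes := by
    refine ⟨⟨hn.isPrime, by simpa [Ideal.span_le] using htn⟩, ?_⟩
    rintro p ⟨hp, htp⟩ hpn
    have hpm := isMaximal_of_algebraMap_mem hp ht (htp (Ideal.mem_span_singleton_self _))
    exact (hpm.eq_of_le hn.ne_top hpn).ge
  obtain ⟨b, hb⟩ := exists_forall_mem_iff_dvd hmin
  obtain ⟨w, hw⟩ := (isUnit_algebraMap_fractionRing ht).exists_right_inv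
  set q : FractionRing R := b * w with hq
  have hqn : ∀ z ∈ n, q * (z : FractionRing R) ∈ B := by
    intro z hz
    obtain ⟨c, hc⟩ := (hb z).mp hz
    have hc' : (z : FractionRing R) * b = algebraMap R _ t * c := congrArg Subtype.val hc
    have : q * (z : FractionRing R) = c := by
      rw [hq]; linear_combination w * hc' + (c : FractionRing R) * hw
    rw [this]
    exact c.2
  have hqB : q ∉ B := by
    intro hqB
    refine hn.ne_top ((Ideal.eq_top_iff_one n).mpr ((hb 1).mpr ⟨⟨q, hqB⟩, Subtype.ext ?_⟩))
    change 1 * (b : FractionRing R) = algebraMap R _ t * q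
    rw [hq]; linear_combination -(b : FractionRing R) * hw
  have h1 : ∃ a, ∃ ha : a ∈ n, (⟨_, hqn a ha⟩ : B) ∉ n := by
    by_contra! hcon
    refine hqB (h ?_)
    refine isIntegral_of_forall_mul_mem (R := R)
      (X := (n.restrictScalars R).map B.val.toLinearMap) ?_ (x₀ := algebraMap R _ t) ?_
      (isUnit_algebraMap_fractionRing ht) ?_
    · exact (IsNoetherian.noetherian (n.restrictScalars R)).map _
    · exact ⟨algebraMap R B t, htn, rfl⟩
    · rintro _ ⟨a, ha, rfl⟩
      exact ⟨_, hcon a ha, rfl⟩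
  obtain ⟨a, ha, hqa⟩ := h1
  refine ⟨a, ha, _, hqa, fun z hz => ⟨⟨_, hqn z hz⟩, Subtype.ext ?_⟩⟩
  change q * a * z = a * (q * z : FractionRing R)
  ring

end OneDim

end UlrichSplit

namespace UlrichSplit

open scoped Pointwise

section Module

variable {R : Type*} [CommRing R] {B : Subalgebra R (FractionRing R)}
  {M : Type*} [AddCommGroup M] [Module R M] [Module.IsTorsionFree R M]

lemma smul_torsionFree_cancel {z : R} (hz : z ∈ nonZeroDivisors R) {v w : M}
    (h : z • v = z • w) : v = w :=
  Module.IsTorsionFree.isSMulRegular (isRegular_iff_mem_nonZeroDivisors.mpr hz) h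

/-- A torsion-free module that is closed under a birational extension `B` of `R` is a
`B`-module. -/
lemma exists_module_of_forall (h : ∀ (b : B) (v : M), ∃ w : M, ∃ z ∈ nonZeroDivisors R, ∃ a : R,
      z • b = algebraMap R B a ∧ z • w = a • v) :
    ∃ _ : Module B M, IsScalarTower R B M := by
  choose F Z hZ A hA hF using h
  have hinj : Function.Injective (algebraMap R B) := fun a c hac =>
    IsFractionRing.injective R (FractionRing R) (congrArg Subtype.val hac)
  have key : ∀ (b : B) (v : M) (z a : R), z • b = algebraMap R B a → z • F b v = a • v := by
    intro b v z a hza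
    refine smul_torsionFree_cancel (hZ b v) ?_
    rw [smul_comm, hF, smul_smul, smul_smul]
    congr 1
    have h1 : algebraMap R (FractionRing R) (z * A b v) = algebraMap R (FractionRing R) (Z b v * a) := by
      have h2 := congrArg (Subtype.val) (hA b v)
      have h3 := congrArg (Subtype.val) hza
      change Z b v • (b : FractionRing R) = algebraMap R (FractionRing R) (A b v) at h2
      change z • (b : FractionRing R) = algebraMap R (FractionRing R) a at h3
      rw [map_mul, map_mul, ← h2, ← h3, Algebra.smul_def, Algebra.smul_def]
      ring
    exact IsFractionRing.injective R (FractionRing R) h1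
  have ext : ∀ (b : B) (v w : M), (∀ z ∈ nonZeroDivisors R, ∀ a : R, z • b = algebraMap R B a →
      z • w = a • v) → F b v = w := by
    intro b v w hw
    obtain ⟨z, hz, a, hza⟩ := subalgebra_exists_smul_eq b
    refine smul_torsionFree_cancel hz ?_
    rw [key b v z a hza, hw z hz a hza]
  let inst : Module B M :=
    { smul := F
      one_smul := fun v => ext 1 v v fun z hz a hza => by
        congr 1
        refine hinj ?_
        rw [← hza, Algebra.smul_def, mul_one]
      mul_smul := fun b c v => by
        change F (b * c) v = F b (F c v)
        obtain ⟨z, hz, a, hza⟩ := subalgebra_exists_smul_eq b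
        obtain ⟨y, hy, d, hyd⟩ := subalgebra_exists_smul_eq c
        refine smul_torsionFree_cancel (mul_mem hz hy) ?_
        rw [key (b * c) v (z * y) (a * d) (by
          rw [map_mul, ← hza, ← hyd, smul_mul_smul_comm]), mul_comm z y, mul_smul y z (F b (F c v)),
          key b _ z a hza, smul_comm y a, key c v y d hyd, smul_smul]
      smul_zero := fun b => ext b 0 0 fun z hz a hza => by simp
      smul_add := fun b v w => by
        change F b (v + w) = F b v + F b w
        obtain ⟨z, hz, a, hza⟩ := subalgebra_exists_smul_eq b
        refine smul_torsionFree_cancel hz ?_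
        rw [smul_add, key _ _ z a hza, key _ _ z a hza, key _ _ z a hza, smul_add]
      add_smul := fun b c v => by
        change F (b + c) v = F b v + F c v
        obtain ⟨z, hz, a, hza⟩ := subalgebra_exists_smul_eq b
        obtain ⟨y, hy, d, hyd⟩ := subalgebra_exists_smul_eq c
        refine smul_torsionFree_cancel (mul_mem hz hy) ?_
        rw [key (b + c) v (z * y) (y * a + z * d) (by
          rw [smul_add, map_add, map_mul, map_mul, ← hza, ← hyd, mul_comm z y, mul_smul,
            mul_comm y z, mul_smul, Algebra.smul_def y (z • b), Algebra.smul_def z (y • c)]),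
          smul_add, mul_comm z y, mul_smul, key b v z a hza, mul_comm y z, mul_smul,
          key c v y d hyd, add_smul, smul_smul, smul_smul]
      zero_smul := fun v => ext 0 v 0 fun z hz a hza => by
        rw [smul_zero] at hza
        rw [(map_eq_zero_iff _ hinj).mp hza.symm, zero_smul,
          smul_zero] }
  refine ⟨inst, ⟨fun c b v => ?_⟩⟩
  change F (c • b) v = c • F b v
  obtain ⟨z, hz, a, hza⟩ := subalgebra_exists_smul_eq b
  refine smul_torsionFree_cancel hz ?_
  rw [key (c • b) v z (c * a) (by rw [smul_comm, hza, map_mul, Algebra.smul_def]), smul_comm,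
    key b v z a hza, smul_smul]

end Module

section BlowUp

variable {R : Type u} [CommRing R] {I : Ideal R} {r : ℕ} {x : R}

lemma mem_inQ {J : Ideal R} {q : FractionRing R} :
    q ∈ inQ J ↔ ∃ a ∈ J, algebraMap R (FractionRing R) a = q :=
  IsLocalization.mem_coeSubmodule _ _

lemma inQ_mul (J J' : Ideal R) : inQ (J * J') = inQ J * inQ J' :=
  IsLocalization.coeSubmodule_mul _ _ _

lemma smul_mem_inQ_iff {J : Ideal R} {z : R} (hz : z ∈ nonZeroDivisors R) {q : FractionRing R} :
    z • q ∈ inQ (Ideal.span {z} * J) ↔ q ∈ inQ J := by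
  simp only [mem_inQ, Ideal.mem_span_singleton_mul]
  constructor
  · rintro ⟨_, ⟨a, ha, rfl⟩, h⟩
    refine ⟨a, ha, smul_fractionRing_cancel hz ?_⟩
    rw [← h, map_mul, Algebra.smul_def]
  · rintro ⟨a, ha, rfl⟩
    exact ⟨_, ⟨a, ha, rfl⟩, by rw [map_mul, Algebra.smul_def]⟩

lemma mem_blowUp {q : FractionRing R} :
    q ∈ blowUp I ↔ ∃ n, 1 ≤ n ∧ q ∈ inQ (I ^ n) / inQ (I ^ n) := Iff.rfl

lemma IsReduction.exists_forall_pow_eq (hx : IsReduction I r x) :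
    ∃ n₀, ∀ n ≥ n₀, ∀ j, I ^ (n + r * j) = Ideal.span {x ^ j} * I ^ n := by
  obtain ⟨n₀, hn₀⟩ := hx.exists_forall_eq
  refine ⟨n₀, fun n hn j => ?_⟩
  induction j with
  | zero => simp
  | succ j ih =>
    rw [mul_add, mul_one, ← add_assoc, hn₀ _ (by omega), ih, ← mul_assoc,
      Ideal.span_singleton_mul_span_singleton, pow_succ']

lemma IsReduction.mem_blowUp_of_mem (hx : IsReduction I r x) (hI : IsRegularIdeal I) {j : ℕ}
    {q : FractionRing R} (hq : x ^ j • q ∈ inQ (I ^ (r * j))) : q ∈ blowUp I := by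
  obtain ⟨n₀, hn₀⟩ := hx.exists_forall_pow_eq
  refine ⟨n₀ + 1, by omega, ?_⟩
  rw [Submodule.mem_div_iff_forall_mul_mem]
  intro y hy
  rw [← smul_mem_inQ_iff (pow_mem (hx.mem_nonZeroDivisors hI) j), ← hn₀ _ (by omega), add_comm,
    pow_add, inQ_mul, ← smul_mul_assoc]
  exact Submodule.mul_mem_mul hq hy

lemma IsReduction.exists_forall_mem_blowUp_iff (hx : IsReduction I r x) (hI : IsRegularIdeal I) :
    ∃ j₀, ∀ j ≥ j₀, ∀ q, q ∈ blowUp I ↔ x ^ j • q ∈ inQ (I ^ (r * j)) := by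
  obtain ⟨n₀, hn₀⟩ := hx.exists_forall_pow_eq
  refine ⟨n₀, fun j hj q => ⟨fun hq => ?_, hx.mem_blowUp_of_mem hI⟩⟩
  obtain ⟨n, hn, hq⟩ := mem_blowUp.mp hq
  have hr := hx.one_le
  have hle : n ≤ r * n := Nat.le_mul_of_pos_left _ hr
  have hle' : j ≤ r * j := Nat.le_mul_of_pos_left _ hr
  have h1 := colon_mono I (show n ≤ r * j + r * n by omega) hq
  rw [Submodule.mem_div_iff_forall_mul_mem] at h1
  have h2 := h1 (algebraMap R _ (x ^ (j + n))) (mem_inQ.mpr ⟨_, by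
    rw [← mul_add, pow_mul]
    exact Ideal.pow_mem_pow hx.mem _, rfl⟩)
  rw [hn₀ _ (by omega)] at h2
  rw [← smul_mem_inQ_iff (pow_mem (hx.mem_nonZeroDivisors hI) n), smul_smul, ← pow_add, add_comm n]
  rwa [mul_comm q, ← Algebra.smul_def] at h2

lemma IsReduction.exists_smul_eq (hx : IsReduction I r x) (hI : IsRegularIdeal I) {a : R}
    (ha : a ∈ I ^ r) : ∃ b : blowUp I, x • b = algebraMap R _ a := by
  obtain ⟨w, hw⟩ := (isUnit_algebraMap_fractionRing (hx.mem_nonZeroDivisors hI)).exists_right_inv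
  have h1 : x • (algebraMap R (FractionRing R) a * w) = algebraMap R _ a := by
    rw [Algebra.smul_def]; linear_combination algebraMap R (FractionRing R) a * hw
  refine ⟨⟨algebraMap R (FractionRing R) a * w, hx.mem_blowUp_of_mem hI (j := 1) ?_⟩,
    Subtype.ext h1⟩
  rw [pow_one, mul_one, h1]
  exact mem_inQ.mpr ⟨a, ha, rfl⟩

lemma IsReduction.finite_blowUp [IsNoetherianRing R] (hx : IsReduction I r x)
    (hI : IsRegularIdeal I) : Module.Finite R (blowUp I) := by
  obtain ⟨j, hj⟩ := hx.exists_forall_mem_blowUp_iff hI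
  have hfg : (inQ (I ^ (r * j))).FG := (IsNoetherian.noetherian (I ^ (r * j))).map _
  have : Module.Finite R (inQ (I ^ (r * j))) := Module.Finite.iff_fg.mpr hfg
  have : IsNoetherian R (inQ (I ^ (r * j))) := isNoetherian_of_isNoetherianRing_of_finite R _
  let f : blowUp I →ₗ[R] inQ (I ^ (r * j)) :=
    ((LinearMap.lsmul R (FractionRing R) (x ^ j)) ∘ₗ (blowUp I).val.toLinearMap).codRestrict _
      (fun b => (hj j le_rfl b).mp b.2)
  refine Module.Finite.of_injective f fun b c hbc => Subtype.ext ?_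
  exact smul_fractionRing_cancel (pow_mem (hx.mem_nonZeroDivisors hI) j) (congrArg Subtype.val hbc)

lemma IsReduction.exists_forall_mul_blowUp (hx : IsReduction I r x) (hI : IsRegularIdeal I) :
    ∃ n₀, ∀ n ≥ n₀, inQ (I ^ n) * Subalgebra.toSubmodule (blowUp I) = inQ (I ^ n) ∧
      inQ (I ^ n) * (Subalgebra.toSubmodule (blowUp I) / inQ (I ^ n)) =
        Subalgebra.toSubmodule (blowUp I) := by
  obtain ⟨n₀, hn₀⟩ := hx.exists_forall_pow_eq
  obtain ⟨j₀, hj₀⟩ := hx.exists_forall_mem_blowUp_iff hI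
  have hx0 := hx.mem_nonZeroDivisors hI
  refine ⟨n₀, fun n hn => ?_⟩
  have h1 : inQ (I ^ n) * Subalgebra.toSubmodule (blowUp I) ≤ inQ (I ^ n) := by
    rw [Submodule.mul_le]
    intro p hp b hb
    rw [← smul_mem_inQ_iff (pow_mem hx0 j₀), ← hn₀ n hn, pow_add, inQ_mul, mul_comm p,
      ← smul_mul_assoc, mul_comm (x ^ j₀ • b)]
    exact Submodule.mul_mem_mul hp ((hj₀ j₀ le_rfl b).mp hb)
  have hone : (1 : FractionRing R) ∈ Subalgebra.toSubmodule (blowUp I) := one_mem (blowUp I)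
  refine ⟨le_antisymm h1 fun p hp => by
    simpa using Submodule.mul_mem_mul hp hone, ?_⟩
  refine le_antisymm (by rw [mul_comm]; exact Submodule.le_div_iff_mul_le.mp le_rfl) ?_
  set j := j₀ + n
  have hr := hx.one_le
  have hle : n ≤ r * j := (Nat.le_add_left n j₀).trans (Nat.le_mul_of_pos_left _ hr)
  obtain ⟨k, hk⟩ := Nat.exists_eq_add_of_le hle
  obtain ⟨w, hw⟩ := (isUnit_algebraMap_fractionRing (pow_mem hx0 j)).exists_right_inv
  have hw' : ∀ q : FractionRing R, x ^ j • (q * w) = q := fun q => by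
    rw [Algebra.smul_def]; linear_combination q * hw
  have h2 : ∀ c ∈ inQ (I ^ k), c * w ∈ Subalgebra.toSubmodule (blowUp I) / inQ (I ^ n) := by
    intro c hc
    rw [Submodule.mem_div_iff_forall_mul_mem]
    intro p hp
    refine hx.mem_blowUp_of_mem hI (j := j) ?_
    rw [mul_right_comm, hw', hk, pow_add, inQ_mul, mul_comm c]
    exact Submodule.mul_mem_mul hp hc
  intro b hb
  have h3 := (hj₀ j (by omega) b).mp hb
  rw [hk, pow_add, inQ_mul] at h3
  have h4 : ∀ q ∈ inQ (I ^ n) * inQ (I ^ k), q * w ∈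
      inQ (I ^ n) * (Subalgebra.toSubmodule (blowUp I) / inQ (I ^ n)) := by
    intro q hq
    induction hq using Submodule.mul_induction_on' with
    | mem_mul_mem p hp c hc =>
      rw [mul_assoc]
      exact Submodule.mul_mem_mul hp (h2 c hc)
    | add p _ c _ hp hc => rw [add_mul]; exact add_mem hp hc
  have h5 := h4 _ h3
  rwa [smul_mul_assoc, hw'] at h5

variable [IsLocalRing R] [IsNoetherianRing R] [IsOneDimCM R]

lemma IsReduction.exists_module (hx : IsReduction I r x) (hI : IsRegularIdeal I) {M : Type u}
    [AddCommGroup M] [Module R M] (hM : IsUlrichWrt I M) :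
    ∃ _ : Module (blowUp I) M, IsScalarTower R (blowUp I) M := by
  obtain ⟨hfin, htf, hM⟩ := (isUlrichWrt_iff hx hI M).mp hM
  obtain ⟨j, hj⟩ := hx.exists_forall_mem_blowUp_iff hI
  have hpow : ∀ j : ℕ, (I ^ (r * j) • ⊤ : Submodule R M) = x ^ j • ⊤ := by
    intro j
    induction j with
    | zero => simp
    | succ j ih =>
      rw [mul_add, mul_one, pow_add, mul_smul, hM, ← Submodule.ideal_span_singleton_smul,
        ← mul_smul, mul_comm, mul_smul, ih, ← Submodule.ideal_span_singleton_smul, ← mul_smul,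
        Ideal.span_singleton_mul_span_singleton, ← pow_succ', Submodule.ideal_span_singleton_smul]
  refine exists_module_of_forall fun b v => ?_
  obtain ⟨a, ha, hab⟩ := mem_inQ.mp ((hj j le_rfl b).mp b.2)
  have h1 : a • v ∈ (x ^ j • ⊤ : Submodule R M) := by
    rw [← hpow]
    exact Submodule.smul_mem_smul ha trivial
  obtain ⟨w, -, hw⟩ := (Submodule.mem_smul_pointwise_iff_exists _ _ _).mp h1
  exact ⟨w, x ^ j, pow_mem (hx.mem_nonZeroDivisors hI) j, a, Subtype.ext hab.symm, hw⟩

lemma IsReduction.isUlrichWrt_of_module (hx : IsReduction I r x) (hI : IsRegularIdeal I)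
    (M : Type u) [AddCommGroup M] [Module R M] [Module.Finite R M] [Module.IsTorsionFree R M]
    [Module (blowUp I) M] [IsScalarTower R (blowUp I) M] : IsUlrichWrt I M := by
  refine (isUlrichWrt_iff hx hI M).mpr ⟨inferInstance, inferInstance, le_antisymm ?_ ?_⟩
  · rw [Submodule.smul_le]
    intro a ha v _
    obtain ⟨b, hb⟩ := hx.exists_smul_eq hI ha
    refine (Submodule.mem_smul_pointwise_iff_exists _ _ _).mpr ⟨b • v, trivial, ?_⟩
    rw [← smul_assoc, hb, algebraMap_smul]
  · rw [← Submodule.ideal_span_singleton_smul]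
    exact Submodule.smul_mono_left (by simpa [Ideal.span_le] using hx.mem)

end BlowUp

end UlrichSplit

namespace UlrichSplit

section Split

variable {R : Type u} [CommRing R] [IsLocalRing R] [IsNoetherianRing R] [IsOneDimCM R]
  {I : Ideal R} {r : ℕ} {x : R}

/-- If finite torsion-free modules over a birational extension `B` split, then `B` is regular. -/
lemma maxLocPrincipal_of_forall_split {B : Subalgebra R (FractionRing R)} [Module.Finite R B]
    (h : ∀ (n : Ideal B), n.IsMaximal → ∀ (k : ℕ) (f : (Fin k → B) →ₗ[B] n),
      Function.Surjective f → ∃ s : n →ₗ[R] (Fin k → B), f.restrictScalars R ∘ₗ s = LinearMap.id) :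
    MaxLocPrincipal B := by
  have : IsNoetherianRing B := isNoetherianRing_subalgebra
  refine maxLocPrincipal_of_projective fun n hn => ?_
  obtain ⟨k, f, hf⟩ := Module.Finite.exists_fin' B n
  obtain ⟨s, hs⟩ := h n hn k f hf
  exact projective_of_section (R := R) (M := n) f s hs

lemma AllSplit.exists_section {R : Type u} [CommRing R] [IsNoetherianRing R] {B : Type u} [CommRing B]
    [Algebra R B] [Module.Finite R B] [Module.IsTorsionFree R B]
    {P : ∀ (M : Type u) [AddCommGroup M] [Module R M], Prop} (h : AllSplit R P)
    (hP : ∀ (M : Type u) [AddCommGroup M] [Module R M] [Module.Finite R M]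
      [Module.IsTorsionFree R M] [Module B M] [IsScalarTower R B M], P M)
    (n : Ideal B) {k : ℕ} (f : (Fin k → B) →ₗ[B] n) (hf : Function.Surjective f) :
    ∃ s : n →ₗ[R] (Fin k → B), f.restrictScalars R ∘ₗ s = LinearMap.id := by
  have hn0 : IsNoetherian R B := isNoetherian_of_isNoetherianRing_of_finite R _
  have : Module.IsTorsionFree R n :=
    Function.Injective.moduleIsTorsionFree (n.subtype.restrictScalars R) n.injective_subtype (by simp)
  have : Module.IsTorsionFree R (LinearMap.ker f) :=
    Function.Injective.moduleIsTorsionFree ((LinearMap.ker f).subtype.restrictScalars R)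
      (LinearMap.ker f).injective_subtype (by simp)
  have : Module.Finite R n := Module.Finite.of_injective (n.subtype.restrictScalars R)
    n.injective_subtype
  have : Module.Finite R (LinearMap.ker f) := Module.Finite.of_injective
    ((LinearMap.ker f).subtype.restrictScalars R) (LinearMap.ker f).injective_subtype
  exact h (LinearMap.ker f) (Fin k → B) n (hP _) (hP _) (hP _)
    ((LinearMap.ker f).subtype.restrictScalars R) (f.restrictScalars R)
    (LinearMap.ker f).injective_subtype (LinearMap.exact_subtype_ker_map f) hf

theorem IsReduction.ulrichSequencesSplit_iff (hx : IsReduction I r x) (hI : IsRegularIdeal I) :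
    UlrichSequencesSplit I ↔ MaxLocPrincipal (blowUp I) := by
  have hfin := hx.finite_blowUp hI
  constructor
  · intro h
    refine maxLocPrincipal_of_forall_split fun n hn k f hf => ?_
    exact h.exists_section (fun M _ _ _ _ _ _ => hx.isUlrichWrt_of_module hI M) n f hf
  · intro h A N C _ _ _ _ _ _ _ hN hC f g _ _ hg
    obtain ⟨_, _⟩ := hx.exists_module hI hN
    obtain ⟨_, _⟩ := hx.exists_module hI hC
    obtain ⟨_, _, _⟩ := (isUlrichWrt_iff hx hI C).mp hC
    have := h.projective_of_isTorsionFree C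
    obtain ⟨s, hs⟩ := Module.projective_lifting_property (extendLinear (blowUp I) g)
      LinearMap.id hg
    exact ⟨s.restrictScalars R, LinearMap.ext fun v => LinearMap.congr_fun hs v⟩

end Split

section Colon

variable {R : Type u} [CommRing R] {J : Ideal R}

lemma exists_forall_algebraMap_eq {X : Type*} [AddCommGroup X] [Module R X]
    (g : X →ₗ[R] FractionRing R) (hg : ∀ v, g v ∈ (1 : Submodule R (FractionRing R))) :
    ∃ f : X →ₗ[R] R, ∀ v, algebraMap R (FractionRing R) (f v) = g v := by
  have hinj : Function.Injective (Algebra.linearMap R (FractionRing R)) :=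
    IsFractionRing.injective R (FractionRing R)
  let e := LinearEquiv.ofInjective (Algebra.linearMap R (FractionRing R)) hinj
  have hg' : ∀ v, g v ∈ LinearMap.range (Algebra.linearMap R (FractionRing R)) := fun v => by
    rw [← Submodule.one_eq_range]
    exact hg v
  refine ⟨e.symm.toLinearMap ∘ₗ g.codRestrict _ hg', fun v => ?_⟩
  exact congrArg Subtype.val (e.apply_symm_apply (g.codRestrict _ hg' v))

lemma exists_linearMap_of_mem_colon {q : FractionRing R}
    (hq : q ∈ (1 : Submodule R (FractionRing R)) / inQ J) :
    ∃ f : J →ₗ[R] R, ∀ p : J, algebraMap R (FractionRing R) (f p) = q * algebraMap R _ (p : R) := by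
  rw [Submodule.mem_div_iff_forall_mul_mem] at hq
  exact exists_forall_algebraMap_eq
    (LinearMap.mulLeft R q ∘ₗ Algebra.linearMap R (FractionRing R) ∘ₗ J.subtype)
    fun p => hq _ (mem_inQ.mpr ⟨p, p.2, rfl⟩)

lemma exists_mem_colon (hJ : IsRegularIdeal J) (f : J →ₗ[R] R) :
    ∃ q ∈ (1 : Submodule R (FractionRing R)) / inQ J,
      ∀ p : J, algebraMap R (FractionRing R) (f p) = q * algebraMap R _ (p : R) := by
  obtain ⟨z, hzJ, hz⟩ := hJ
  obtain ⟨q, hq⟩ := exists_forall_eq_mul (Algebra.linearMap R (FractionRing R) ∘ₗ J.subtype)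
    ((IsFractionRing.injective R (FractionRing R)).comp J.injective_subtype) (x₀ := ⟨z, hzJ⟩)
    (isUnit_algebraMap_fractionRing hz) (Algebra.linearMap R (FractionRing R) ∘ₗ f)
  refine ⟨q, ?_, hq⟩
  rw [Submodule.mem_div_iff_forall_mul_mem]
  intro y hy
  obtain ⟨a, ha, rfl⟩ := mem_inQ.mp hy
  rw [show q * algebraMap R (FractionRing R) a = algebraMap R _ (f ⟨a, ha⟩) from (hq ⟨a, ha⟩).symm]
  exact Submodule.algebraMap_mem _

lemma inQ_traceIdeal (hJ : IsRegularIdeal J) :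
    inQ (traceIdeal R J) = (1 : Submodule R (FractionRing R)) / inQ J * inQ J := by
  refine le_antisymm ?_ ?_
  · rw [inQ, IsLocalization.coeSubmodule, traceIdeal, Submodule.map_iSup, iSup_le_iff]
    rintro f _ ⟨_, ⟨p, rfl⟩, rfl⟩
    obtain ⟨q, hq, hf⟩ := exists_mem_colon hJ f
    rw [Algebra.linearMap_apply, hf p]
    exact Submodule.mul_mem_mul hq (mem_inQ.mpr ⟨p, p.2, rfl⟩)
  · rw [Submodule.mul_le]
    intro q hq y hy
    obtain ⟨a, ha, rfl⟩ := mem_inQ.mp hy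
    obtain ⟨f, hf⟩ := exists_linearMap_of_mem_colon hq
    refine mem_inQ.mpr ⟨f ⟨a, ha⟩, ?_, hf ⟨a, ha⟩⟩
    exact Submodule.mem_iSup_of_mem f (LinearMap.mem_range_self f _)

lemma inQ_conductorIdeal :
    inQ (conductorIdeal R) = (1 : Submodule R (FractionRing R)) /
      Subalgebra.toSubmodule (integralClosure R (FractionRing R)) := by
  refine le_antisymm (Submodule.map_comap_le _ _) fun q hq => ?_
  have h1 : q ∈ (1 : Submodule R (FractionRing R)) := by
    have h2 := Submodule.mem_div_iff_forall_mul_mem.mp hq 1 (one_mem (integralClosure R _))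
    rwa [mul_one] at h2
  obtain ⟨a, rfl⟩ := Submodule.mem_one.mp h1
  exact ⟨a, hq, rfl⟩

lemma isReflexive_iff (hJ : IsRegularIdeal J) :
    Module.IsReflexive R J ↔
      (1 : Submodule R (FractionRing R)) / ((1 : Submodule R (FractionRing R)) / inQ J) ≤ inQ J := by
  obtain ⟨z, hzJ, hz⟩ := id hJ
  obtain ⟨w, hw⟩ := (isUnit_algebraMap_fractionRing hz).exists_right_inv
  have hinj := IsFractionRing.injective R (FractionRing R)
  constructor
  · intro h q hq
    rw [Submodule.mem_div_iff_forall_mul_mem] at hq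
    obtain ⟨Φ, hΦ⟩ := exists_forall_algebraMap_eq (LinearMap.mulLeft R (q * w) ∘ₗ
      Algebra.linearMap R (FractionRing R) ∘ₗ LinearMap.applyₗ (⟨z, hzJ⟩ : J) :
        Module.Dual R J →ₗ[R] FractionRing R) (fun f => by
      obtain ⟨g, hg, hgf⟩ := exists_mem_colon hJ f
      have h1 := hq g hg
      have h2 := hgf ⟨z, hzJ⟩
      simp only [LinearMap.comp_apply, Algebra.linearMap_apply, LinearMap.mulLeft_apply,
        LinearMap.applyₗ_apply_apply]
      rw [h2]
      convert h1 using 1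
      linear_combination q * g * hw)
    obtain ⟨p, hp⟩ := h.bijective_dual_eval'.2 Φ
    have h1 := hΦ J.subtype
    rw [← hp] at h1
    simp only [Module.Dual.eval_apply, Submodule.subtype_apply, LinearMap.comp_apply,
      Algebra.linearMap_apply, LinearMap.mulLeft_apply, LinearMap.applyₗ_apply_apply] at h1
    refine mem_inQ.mpr ⟨p, p.2, ?_⟩
    rw [h1]
    linear_combination q * hw
  · intro h
    refine ⟨⟨?_, fun Φ => ?_⟩⟩
    · intro p p' hpp
      exact Subtype.ext (LinearMap.congr_fun hpp J.subtype)
    · have hf : ∀ f : Module.Dual R J, z * Φ f = f ⟨z, hzJ⟩ * Φ J.subtype := by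
        intro f
        have h1 : z • f = f ⟨z, hzJ⟩ • (J.subtype : Module.Dual R J) := by
          ext p
          simp only [LinearMap.smul_apply, smul_eq_mul, Submodule.subtype_apply]
          rw [← smul_eq_mul, ← map_smul, mul_comm, ← smul_eq_mul, ← map_smul]
          congr 1
          exact Subtype.ext (mul_comm _ _)
        have h2 := congrArg Φ h1
        rwa [map_smul, map_smul] at h2
      have h1 : algebraMap R (FractionRing R) (Φ J.subtype) ∈ inQ J := by
        refine h ?_
        rw [Submodule.mem_div_iff_forall_mul_mem]
        intro q hq
        obtain ⟨f, hqf⟩ := exists_linearMap_of_mem_colon hq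
        have h2 := congrArg (algebraMap R (FractionRing R)) (hf f)
        rw [map_mul, map_mul, hqf ⟨z, hzJ⟩] at h2
        have h3 : algebraMap R (FractionRing R) (Φ J.subtype) * q = algebraMap R _ (Φ f) := by
          refine (isUnit_algebraMap_fractionRing hz).mul_left_cancel ?_
          rw [h2]; ring
        rw [h3]
        exact Submodule.algebraMap_mem _
      obtain ⟨a, ha, haΦ⟩ := mem_inQ.mp h1
      have haΦ' := hinj haΦ
      refine ⟨⟨a, ha⟩, LinearMap.ext fun f => ?_⟩
      rw [Module.Dual.eval_apply]
      refine mem_nonZeroDivisors_iff_right.mp hz _ ?_ |> sub_eq_zero.mp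
      rw [sub_mul, mul_comm (Φ f), hf f, ← haΦ', mul_comm _ z, ← smul_eq_mul, ← map_smul,
        mul_comm _ a, ← smul_eq_mul a, ← map_smul, sub_eq_zero]
      congr 1
      exact Subtype.ext (mul_comm _ _)

variable {I : Ideal R} {r : ℕ} {x : R}

lemma isRegularIdeal_pow (hI : IsRegularIdeal I) (n : ℕ) : IsRegularIdeal (I ^ n) := by
  obtain ⟨t, htI, ht⟩ := hI
  exact ⟨t ^ n, Ideal.pow_mem_pow htI n, pow_mem ht n⟩

lemma le_integralClosure (B : Subalgebra R (FractionRing R)) [Module.Finite R B] :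
    B ≤ integralClosure R (FractionRing R) := fun b hb =>
  (Algebra.IsIntegral.isIntegral (R := R) (⟨b, hb⟩ : B)).map B.val

lemma colon_mul_self_le {A : Type*} [CommRing A] [Algebra R A] (P Q : Submodule R A) :
    P / Q * Q ≤ P := Submodule.le_div_iff_mul_le.mp le_rfl

lemma IsReduction.exists_mem_one_div (hx : IsReduction I r x) (hI : IsRegularIdeal I) :
    ∃ z ∈ nonZeroDivisors R, algebraMap R (FractionRing R) z ∈
      (1 : Submodule R (FractionRing R)) / Subalgebra.toSubmodule (blowUp I) := by
  obtain ⟨j, hj⟩ := hx.exists_forall_mem_blowUp_iff hI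
  refine ⟨x ^ j, pow_mem (hx.mem_nonZeroDivisors hI) j, ?_⟩
  rw [Submodule.mem_div_iff_forall_mul_mem]
  intro b hb
  obtain ⟨a, -, ha⟩ := mem_inQ.mp ((hj j le_rfl b).mp hb)
  rw [← Algebra.smul_def, ← ha]
  exact Submodule.algebraMap_mem _

end Colon

section Trace

variable {R : Type u} [CommRing R] [IsLocalRing R] [IsNoetherianRing R] [IsOneDimCM R]
  {I : Ideal R} {r : ℕ} {x : R}

theorem IsReduction.eventually_trace_iff (hx : IsReduction I r x) (hI : IsRegularIdeal I) :
    (∀ᶠ n : ℕ in atTop, traceIdeal R (I ^ n : Ideal R) = conductorIdeal R ∧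
      Module.IsReflexive R (I ^ n : Ideal R)) ↔ MaxLocPrincipal (blowUp I) := by
  have hfin := hx.finite_blowUp hI
  obtain ⟨n₀, hn₀⟩ := hx.exists_forall_mul_blowUp hI
  set B := Subalgebra.toSubmodule (blowUp I) with hB
  set C := Subalgebra.toSubmodule (integralClosure R (FractionRing R)) with hC
  have hone : (1 : FractionRing R) ∈ B := one_mem (blowUp I)
  have htr : ∀ n ≥ n₀, (1 : Submodule R (FractionRing R)) / inQ (I ^ n) * inQ (I ^ n) = 1 / B := by
    intro n hn
    obtain ⟨h1, h2⟩ := hn₀ n hn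
    refine le_antisymm ?_ ?_
    · rw [Submodule.le_div_iff_mul_le, mul_assoc, h1]
      exact colon_mul_self_le _ _
    · calc 1 / B ≤ 1 / B * B := fun q hq => by
            simpa using Submodule.mul_mem_mul hq hone
        _ = 1 / B * (B / inQ (I ^ n)) * inQ (I ^ n) := by rw [mul_assoc, mul_comm (B / _), h2]
        _ ≤ _ := by
          refine mul_le_mul' ?_ le_rfl
          rw [Submodule.le_div_iff_mul_le, mul_assoc]
          exact (mul_le_mul' le_rfl (colon_mul_self_le _ _)).trans (colon_mul_self_le _ _)
  constructor
  · intro h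
    obtain ⟨n, ⟨h1, h2⟩, hn⟩ := (h.and (eventually_ge_atTop (n₀ + 1))).exists
    rw [isReflexive_iff (isRegularIdeal_pow hI n)] at h2
    have h3 : 1 / B = 1 / C := by
      rw [← htr n (by omega), ← inQ_traceIdeal (isRegularIdeal_pow hI n), h1, inQ_conductorIdeal]
    refine maxLocPrincipal_of_integralClosure_le fun q hq => ?_
    refine mem_blowUp.mpr ⟨n, by omega, ?_⟩
    rw [Submodule.mem_div_iff_forall_mul_mem]
    intro p hp
    refine h2 ?_
    rw [Submodule.mem_div_iff_forall_mul_mem]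
    intro g hg
    have h4 : g * p ∈ 1 / C := by
      rw [← h3, ← htr n (by omega)]
      exact Submodule.mul_mem_mul hg hp
    have h5 := Submodule.mem_div_iff_forall_mul_mem.mp h4 q hq
    convert h5 using 1
    ring
  · intro h
    have hBC : B = C := le_antisymm (le_integralClosure (blowUp I)) h.integralClosure_le
    filter_upwards [eventually_ge_atTop n₀] with n hn
    obtain ⟨h1, h2⟩ := hn₀ n hn
    have hinj : Function.Injective (inQ : Ideal R → _) :=
      IsLocalization.coeSubmodule_injective (FractionRing R) le_rfl
    refine ⟨hinj ?_, ?_⟩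
    · rw [inQ_conductorIdeal, inQ_traceIdeal (isRegularIdeal_pow hI n), htr n hn, hBC]
    · rw [isReflexive_iff (isRegularIdeal_pow hI n)]
      set P := inQ (I ^ n)
      have h3 : (1 / (1 / P)) * (B / P) ≤ B := by
        have h4 : (1 / (1 / P)) * (B / P) ≤ (1 / B) / (1 / B) := by
          rw [Submodule.le_div_iff_mul_le, Submodule.le_div_iff_mul_le]
          calc 1 / (1 / P) * (B / P) * (1 / B) * B = 1 / (1 / P) * ((1 / B) * B * (B / P)) := by ring
            _ ≤ 1 / (1 / P) * (1 / P) := by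
              refine mul_le_mul' le_rfl ?_
              rw [Submodule.le_div_iff_mul_le, mul_assoc]
              calc _ ≤ 1 / B * B * B := mul_le_mul' le_rfl (colon_mul_self_le _ _)
                _ = 1 / B * B := by rw [mul_assoc, (blowUp I).isIdempotentElem_toSubmodule.eq]
                _ ≤ 1 := colon_mul_self_le _ _
            _ ≤ 1 := colon_mul_self_le _ _
        intro q hq
        have h5 := Submodule.mem_div_iff_forall_mul_mem.mp (h4 hq)
        rw [hBC]
        obtain ⟨z, hz, hzB⟩ := hx.exists_mem_one_div hI
        have hle : 1 / B ≤ 1 := fun c hc => by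
          simpa using Submodule.mem_div_iff_forall_mul_mem.mp hc 1 (one_mem (blowUp I))
        have hfg : (1 / B).FG := by
          have h6 : ((1 / B).comap (Algebra.linearMap R (FractionRing R))).map
              (Algebra.linearMap R (FractionRing R)) = 1 / B := by
            rw [Submodule.map_comap_eq, ← Submodule.one_eq_range, inf_eq_right]
            exact hle
          rw [← h6]
          exact (IsNoetherian.noetherian _).map _
        exact isIntegral_of_forall_mul_mem hfg hzB (isUnit_algebraMap_fractionRing hz) h5
      calc 1 / (1 / P) ≤ 1 / (1 / P) * B := fun q hq => by
            simpa using Submodule.mul_mem_mul hq hone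
        _ = 1 / (1 / P) * (B / P) * P := by rw [mul_assoc, mul_comm (B / P), h2]
        _ ≤ B * P := mul_le_mul' h3 le_rfl
        _ = P := by rw [mul_comm, h1]

end Trace

end UlrichSplit

namespace UlrichSplit

open scoped Pointwise

section FiberSquare

variable {R : Type u} [CommRing R] {I : Ideal R}

lemma mem_fiberSquare {p : R × R} : p ∈ fiberSquare I ↔ p.1 - p.2 ∈ I := by
  obtain ⟨a, b⟩ := p
  exact Ideal.Quotient.eq

variable (I) in
/-- The diagonal embedding `R → R ⋈ I`. -/
def fiberSquareDiag : R →+* fiberSquare I :=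
  ((RingHom.id R).prod (RingHom.id R)).codRestrict _ fun a => by
    simp [mem_fiberSquare]

variable (I) in
/-- The first projection `R ⋈ I → R`. -/
def fiberSquareFst : fiberSquare I →+* R := (RingHom.fst R R).comp (fiberSquare I).subtype

@[simp] lemma fiberSquareDiag_coe (a : R) : (fiberSquareDiag I a : R × R) = (a, a) := rfl

@[simp] lemma fiberSquareFst_apply (p : fiberSquare I) : fiberSquareFst I p = (p : R × R).1 := rfl

/-- The pair `(a, b)` with `a`, `b` in `I`, as an element of `R ⋈ I`. -/
def fiberSquareMk {a b : R} (ha : a ∈ I) (hb : b ∈ I) : fiberSquare I :=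
  ⟨(a, b), mem_fiberSquare.mpr (I.sub_mem ha hb)⟩

lemma mem_fiberSquareIdeal {p : fiberSquare I} :
    p ∈ fiberSquareIdeal I ↔ (p : R × R).1 ∈ I ∧ (p : R × R).2 ∈ I := Iff.rfl

lemma fiberSquareMk_mem {a b : R} (ha : a ∈ I) (hb : b ∈ I) :
    fiberSquareMk ha hb ∈ fiberSquareIdeal I := mem_fiberSquareIdeal.mpr ⟨ha, hb⟩

lemma exists_fst_mem_pow {n : ℕ} (hn : 1 ≤ n) {a : R} (ha : a ∈ I ^ n) :
    ∃ p ∈ fiberSquareIdeal I ^ n, (p : R × R) = (a, 0) := by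
  induction n, hn using Nat.le_induction generalizing a with
  | base =>
    rw [pow_one] at ha
    exact ⟨fiberSquareMk ha I.zero_mem, by rw [pow_one]; exact fiberSquareMk_mem _ _, rfl⟩
  | succ n hn ih =>
    rw [pow_succ] at ha
    induction ha using Submodule.mul_induction_on' with
    | mem_mul_mem b hb c hc =>
      obtain ⟨p, hp, hpb⟩ := ih hb
      refine ⟨p * fiberSquareMk hc I.zero_mem, ?_, ?_⟩
      · rw [pow_succ]
        exact Ideal.mul_mem_mul hp (fiberSquareMk_mem _ _)
      · rw [Subring.coe_mul, hpb]
        exact Prod.ext rfl (mul_zero _)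
    | add b _ c _ hb hc =>
      obtain ⟨p, hp, hpb⟩ := hb
      obtain ⟨q, hq, hqc⟩ := hc
      exact ⟨p + q, add_mem hp hq, by rw [Subring.coe_add, hpb, hqc]; simp⟩

lemma exists_snd_mem_pow {n : ℕ} (hn : 1 ≤ n) {a : R} (ha : a ∈ I ^ n) :
    ∃ p ∈ fiberSquareIdeal I ^ n, (p : R × R) = (0, a) := by
  induction n, hn using Nat.le_induction generalizing a with
  | base =>
    rw [pow_one] at ha
    exact ⟨fiberSquareMk I.zero_mem ha, by rw [pow_one]; exact fiberSquareMk_mem _ _, rfl⟩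
  | succ n hn ih =>
    rw [pow_succ] at ha
    induction ha using Submodule.mul_induction_on' with
    | mem_mul_mem b hb c hc =>
      obtain ⟨p, hp, hpb⟩ := ih hb
      refine ⟨p * fiberSquareMk I.zero_mem hc, ?_, ?_⟩
      · rw [pow_succ]
        exact Ideal.mul_mem_mul hp (fiberSquareMk_mem _ _)
      · rw [Subring.coe_mul, hpb]
        exact Prod.ext (mul_zero _) rfl
    | add b _ c _ hb hc =>
      obtain ⟨p, hp, hpb⟩ := hb
      obtain ⟨q, hq, hqc⟩ := hc
      exact ⟨p + q, add_mem hp hq, by rw [Subring.coe_add, hpb, hqc]; simp⟩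

lemma mem_fiberSquareIdeal_pow {n : ℕ} (hn : 1 ≤ n) {p : fiberSquare I} :
    p ∈ fiberSquareIdeal I ^ n ↔ (p : R × R).1 ∈ I ^ n ∧ (p : R × R).2 ∈ I ^ n := by
  constructor
  · intro hp
    have h1 : (fiberSquareIdeal I ^ n).map (fiberSquareFst I) ≤ I ^ n := by
      rw [Ideal.map_pow]
      exact Ideal.pow_right_mono (Ideal.map_le_iff_le_comap.mpr fun q hq =>
        (mem_fiberSquareIdeal.mp hq).1) n
    have h2 : (fiberSquareIdeal I ^ n).map ((RingHom.snd R R).comp (fiberSquare I).subtype) ≤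
        I ^ n := by
      rw [Ideal.map_pow]
      exact Ideal.pow_right_mono (Ideal.map_le_iff_le_comap.mpr fun q hq =>
        (mem_fiberSquareIdeal.mp hq).2) n
    exact ⟨h1 (Ideal.mem_map_of_mem _ hp), h2 (Ideal.mem_map_of_mem _ hp)⟩
  · rintro ⟨h1, h2⟩
    obtain ⟨q, hq, hqa⟩ := exists_fst_mem_pow hn h1
    obtain ⟨q', hq', hqa'⟩ := exists_snd_mem_pow hn h2
    have h3 : p = q + q' := Subtype.ext (by rw [Subring.coe_add, hqa, hqa']; simp)
    rw [h3]
    exact add_mem hq hq'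

lemma fiberSquareDiag_mem_nonZeroDivisors {z : R} (hz : z ∈ nonZeroDivisors R) :
    fiberSquareDiag I z ∈ nonZeroDivisors (fiberSquare I) := by
  rw [mem_nonZeroDivisors_iff_right] at hz ⊢
  intro p hp
  have h1 := congrArg Subtype.val hp
  exact Subtype.ext (Prod.ext (hz _ (congrArg Prod.fst h1)) (hz _ (congrArg Prod.snd h1)))

lemma fiberSquareFst_mem_nonZeroDivisors (hI : IsRegularIdeal I) {p : fiberSquare I}
    (hp : p ∈ nonZeroDivisors (fiberSquare I)) : fiberSquareFst I p ∈ nonZeroDivisors R := by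
  obtain ⟨t, htI, ht⟩ := hI
  rw [mem_nonZeroDivisors_iff_right] at hp ht ⊢
  intro c hc
  have h1 := hp (fiberSquareMk (I.mul_mem_left c htI) I.zero_mem) (Subtype.ext (Prod.ext (by
    change c * t * (p : R × R).1 = 0
    rw [mul_right_comm]
    rw [fiberSquareFst_apply] at hc
    rw [hc, zero_mul]) (zero_mul _)))
  exact ht c (congrArg Prod.fst (congrArg Subtype.val h1))

lemma finite_fiberSquareDiag [IsNoetherianRing R] : (fiberSquareDiag I).Finite := by
  let := (fiberSquareDiag I).toAlgebra
  let f : fiberSquare I →ₗ[R] R × R :=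
    { toFun := Subtype.val
      map_add' := fun _ _ => rfl
      map_smul' := fun _ _ => rfl }
  exact Module.Finite.of_injective f Subtype.val_injective

lemma isNoetherianRing_fiberSquare [IsNoetherianRing R] : IsNoetherianRing (fiberSquare I) := by
  let := (fiberSquareDiag I).toAlgebra
  have : Module.Finite R (fiberSquare I) := finite_fiberSquareDiag
  exact isNoetherian_of_tower R inferInstance

lemma isRegularIdeal_fiberSquareIdeal (hI : IsRegularIdeal I) :
    IsRegularIdeal (fiberSquareIdeal I) := by
  obtain ⟨t, htI, ht⟩ := hI
  exact ⟨fiberSquareDiag I t, mem_fiberSquareIdeal.mpr ⟨htI, htI⟩,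
    fiberSquareDiag_mem_nonZeroDivisors ht⟩

lemma isOneDimCM_fiberSquare [IsLocalRing R] [IsNoetherianRing R] [IsOneDimCM R]
    [IsLocalRing (fiberSquare I)] (hIm : I ≤ maximalIdeal R) (hI : IsRegularIdeal I) :
    IsOneDimCM (fiberSquare I) := by
  have := isNoetherianRing_fiberSquare (I := I)
  obtain ⟨t, htI, ht⟩ := hI
  obtain ⟨k, hk⟩ := exists_pow_le_span (mul_mem ht ht)
  have hloc : ∀ f : fiberSquare I →+* R, Function.Surjective f →
      (maximalIdeal (fiberSquare I) ^ k).map f ≤ Ideal.span {t * t} := by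
    intro f hf
    have : IsLocalHom f := IsLocalHom.of_surjective f hf
    rw [Ideal.map_pow]
    refine (Ideal.pow_right_mono ?_ k).trans hk
    exact ((local_hom_TFAE f).out 0 2).mp this
  refine isOneDimCM_of_pow_le (t := fiberSquareDiag I t) (k := k) ?_
    (fiberSquareDiag_mem_nonZeroDivisors ht) ?_
  · rw [mem_maximalIdeal]
    intro hu
    exact hIm htI (hu.map (fiberSquareFst I))
  · intro p hp
    have h1 := hloc (fiberSquareFst I) (fun a => ⟨fiberSquareDiag I a, rfl⟩)
      (Ideal.mem_map_of_mem _ hp)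
    have h2 := hloc ((RingHom.snd R R).comp (fiberSquare I).subtype)
      (fun a => ⟨fiberSquareDiag I a, rfl⟩) (Ideal.mem_map_of_mem _ hp)
    obtain ⟨a, ha⟩ := Ideal.mem_span_singleton'.mp h1
    obtain ⟨b, hb⟩ := Ideal.mem_span_singleton'.mp h2
    refine Ideal.mem_span_singleton'.mpr
      ⟨fiberSquareMk (I.mul_mem_left a htI) (I.mul_mem_left b htI), Subtype.ext (Prod.ext ?_ ?_)⟩
    · exact (mul_assoc a t t).trans ha
    · exact (mul_assoc b t t).trans hb

lemma IsReduction.isReduction_fiberSquareIdeal {r : ℕ} {x : R} (hx : IsReduction I r x) :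
    IsReduction (fiberSquareIdeal I) r (fiberSquareDiag I x) := by
  refine ⟨hx.one_le, (mem_fiberSquareIdeal_pow hx.one_le).mpr ⟨hx.mem, hx.mem⟩, ?_⟩
  obtain ⟨n₀, hn₀⟩ := hx.exists_forall_le
  refine ⟨n₀ + 1, fun n hn p hp => ?_⟩
  rw [mem_fiberSquareIdeal_pow (by omega)] at hp
  obtain ⟨a, ha, hap⟩ := Ideal.mem_span_singleton_mul.mp (hn₀ n (by omega) hp.1)
  obtain ⟨b, hb, hbp⟩ := Ideal.mem_span_singleton_mul.mp (hn₀ n (by omega) hp.2)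
  have hle : I ^ n ≤ I := Ideal.pow_le_self (by omega)
  refine Ideal.mem_span_singleton_mul.mpr ⟨fiberSquareMk (hle ha) (hle hb), ?_,
    Subtype.ext (Prod.ext hap hbp)⟩
  exact (mem_fiberSquareIdeal_pow (by omega)).mpr ⟨ha, hb⟩

variable {r : ℕ} {x : R}

/-- The action of the idempotent `(1, 0)` on a torsion-free module on which it is defined. -/
lemma exists_idempotent (hx : IsReduction I r x) (hI : IsRegularIdeal I)
    {M : Type u} [AddCommGroup M] [Module (fiberSquare I) M] [Module.IsTorsionFree (fiberSquare I) M]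
    (hM : (fiberSquareIdeal I ^ r • ⊤ : Submodule (fiberSquare I) M) = fiberSquareDiag I x • ⊤)
    {y : fiberSquare I} (hy : (y : R × R) = (x, 0)) :
    ∃ e : M →ₗ[fiberSquare I] M, (∀ v, fiberSquareDiag I x • e v = y • v) ∧
      (∀ (p : fiberSquare I) (v : M), p • e v = fiberSquareDiag I (p : R × R).1 • e v) ∧
      ∀ (p : fiberSquare I) (v : M),
        p • (v - e v) = fiberSquareDiag I (p : R × R).2 • (v - e v) := by
  have hy' : y ∈ fiberSquareIdeal I ^ r :=
    (mem_fiberSquareIdeal_pow hx.one_le).mpr (by rw [hy]; exact ⟨hx.mem, zero_mem _⟩)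
  have hreg : IsSMulRegular M (fiberSquareDiag I x) :=
    Module.IsTorsionFree.isSMulRegular (isRegular_iff_mem_nonZeroDivisors.mpr
      (fiberSquareDiag_mem_nonZeroDivisors (hx.mem_nonZeroDivisors hI)))
  have h1 : ∀ v : M, ∃ w, fiberSquareDiag I x • w = y • v := by
    intro v
    have h2 : y • v ∈ (fiberSquareDiag I x • ⊤ : Submodule (fiberSquare I) M) := by
      rw [← hM]
      exact Submodule.smul_mem_smul hy' trivial
    obtain ⟨w, -, hw⟩ := (Submodule.mem_smul_pointwise_iff_exists _ _ _).mp h2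
    exact ⟨w, hw⟩
  choose e he using h1
  refine ⟨{ toFun := e, map_add' := fun v w => hreg ?_, map_smul' := fun s v => hreg ?_ }, he,
    fun p v => hreg ?_, fun p v => hreg ?_⟩
  · simp only [smul_add, he]
  · simp only [RingHom.id_apply]
    rw [he, smul_comm (fiberSquareDiag I x), he, smul_comm]
  · simp only [LinearMap.coe_mk, AddHom.coe_mk]
    rw [smul_comm (fiberSquareDiag I x), he, smul_comm (fiberSquareDiag I x), he, smul_smul,
      smul_smul]
    congr 1
    exact Subtype.ext (Prod.ext (by simp [hy]) (by simp [hy]))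
  · simp only [LinearMap.coe_mk, AddHom.coe_mk]
    rw [smul_comm (fiberSquareDiag I x), smul_sub (fiberSquareDiag I x), he,
      smul_comm (fiberSquareDiag I x), smul_sub (fiberSquareDiag I x), he, ← sub_smul,
      smul_smul, smul_smul]
    congr 1
    exact Subtype.ext (Prod.ext (by simp [hy]) (by simp [hy]))

end FiberSquare

section Transfer

lemma isUlrichWrt_compHom {A A' : Type u} [CommRing A] [IsLocalRing A] [IsNoetherianRing A]
    [IsOneDimCM A] [CommRing A'] [IsLocalRing A'] [IsNoetherianRing A'] [IsOneDimCM A']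
    {f : A →+* A'} (hf : f.Finite) (hreg : ∀ z ∈ nonZeroDivisors A, f z ∈ nonZeroDivisors A')
    {I : Ideal A} {I' : Ideal A'} (hI : IsRegularIdeal I) (hI' : IsRegularIdeal I') {r : ℕ} {x : A}
    (hx : IsReduction I r x) (hx' : IsReduction I' r (f x)) (hII' : (I ^ r).map f ≤ I' ^ r)
    {M : Type u} [AddCommGroup M] [Module A' M] (hM : IsUlrichWrt I' M) :
    letI := Module.compHom M f
    IsUlrichWrt I M := by
  obtain ⟨hfin, htf, hM⟩ := (isUlrichWrt_iff hx' hI' M).mp hM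
  let := f.toAlgebra
  let := Module.compHom M f
  have : IsScalarTower A A' M := ⟨fun a b v => mul_smul (f a) b v⟩
  have : Module.Finite A A' := hf
  have hsm : ∀ (a : A) (v : M), a • v = f a • v := fun _ _ => rfl
  refine (isUlrichWrt_iff hx hI M).mpr ⟨Module.Finite.trans A' M, ⟨fun z hz => ?_⟩, ?_⟩
  · exact Module.IsTorsionFree.isSMulRegular (M := M) (r := f z) (isRegular_iff_mem_nonZeroDivisors.mpr
      (hreg z (isRegular_iff_mem_nonZeroDivisors.mp hz)))
  · refine le_antisymm ?_ ?_
    · rw [Submodule.smul_le]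
      intro a ha v _
      have h1 : f a • v ∈ (f x • ⊤ : Submodule A' M) := by
        rw [← hM]
        exact Submodule.smul_mem_smul (hII' (Ideal.mem_map_of_mem f ha)) trivial
      obtain ⟨w, -, hw⟩ := (Submodule.mem_smul_pointwise_iff_exists _ _ _).mp h1
      exact (Submodule.mem_smul_pointwise_iff_exists _ _ _).mpr ⟨w, trivial, hw⟩
    · rw [← Submodule.ideal_span_singleton_smul]
      exact Submodule.smul_mono_left (by simpa [Ideal.span_le] using hx.mem)

variable {R : Type u} [CommRing R] [IsLocalRing R] [IsNoetherianRing R] [IsOneDimCM R]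
  {I : Ideal R} {r : ℕ} {x : R}

theorem IsReduction.ulrichSequencesSplit_fiberSquare_iff (hx : IsReduction I r x)
    (hIm : I ≤ maximalIdeal R) (hI : IsRegularIdeal I) [IsLocalRing (fiberSquare I)] :
    UlrichSequencesSplit (fiberSquareIdeal I) ↔ UlrichSequencesSplit I := by
  have := isNoetherianRing_fiberSquare (I := I)
  have := isOneDimCM_fiberSquare hIm hI
  have hIS := isRegularIdeal_fiberSquareIdeal hI
  have hxS := hx.isReduction_fiberSquareIdeal
  have hdiag : ∀ {M : Type u} [AddCommGroup M] [Module (fiberSquare I) M],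
      IsUlrichWrt (fiberSquareIdeal I) M →
      letI := Module.compHom M (fiberSquareDiag I)
      IsUlrichWrt I M := fun hM =>
    isUlrichWrt_compHom finite_fiberSquareDiag
      (fun z hz => fiberSquareDiag_mem_nonZeroDivisors hz) hI hIS hx hxS
      (Ideal.map_le_iff_le_comap.mpr fun a ha =>
        (mem_fiberSquareIdeal_pow hx.one_le).mpr ⟨ha, ha⟩) hM
  have hfst : ∀ {M : Type u} [AddCommGroup M] [Module R M], IsUlrichWrt I M →
      letI := Module.compHom M (fiberSquareFst I)
      IsUlrichWrt (fiberSquareIdeal I) M := fun hM =>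
    isUlrichWrt_compHom
      (RingHom.Finite.of_surjective _ fun a => ⟨fiberSquareDiag I a, rfl⟩)
      (fun z hz => fiberSquareFst_mem_nonZeroDivisors hI hz) hIS hI hxS hx
      (Ideal.map_le_iff_le_comap.mpr fun a ha =>
        ((mem_fiberSquareIdeal_pow hx.one_le).mp ha).1) hM
  constructor
  · intro h A N C _ _ _ _ _ _ hA hN hC f g hf hfg hg
    let := Module.compHom A (fiberSquareFst I)
    let := Module.compHom N (fiberSquareFst I)
    let := Module.compHom C (fiberSquareFst I)
    let f' : A →ₗ[fiberSquare I] N := { f with map_smul' := fun s v => f.map_smul _ v }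
    let g' : N →ₗ[fiberSquare I] C := { g with map_smul' := fun s v => g.map_smul _ v }
    obtain ⟨s, hs⟩ := h A N C (hfst hA) (hfst hN) (hfst hC) f' g' hf hfg hg
    let s' : C →ₗ[R] N := { s with map_smul' := fun a v => s.map_smul (fiberSquareDiag I a) v }
    exact ⟨s', LinearMap.ext fun v => LinearMap.congr_fun hs v⟩
  · intro h A N C _ _ _ _ _ _ hA hN hC f g hf hfg hg
    obtain ⟨s, hs⟩ : ∃ s : C →+ N, (∀ (a : R) (v : C),
        s (fiberSquareDiag I a • v) = fiberSquareDiag I a • s v) ∧ ∀ v, g (s v) = v := by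
      let := Module.compHom A (fiberSquareDiag I)
      let := Module.compHom N (fiberSquareDiag I)
      let := Module.compHom C (fiberSquareDiag I)
      let f' : A →ₗ[R] N := { f with map_smul' := fun s v => f.map_smul _ v }
      let g' : N →ₗ[R] C := { g with map_smul' := fun s v => g.map_smul _ v }
      obtain ⟨s, hs⟩ := h A N C (hdiag hA) (hdiag hN) (hdiag hC) f' g' hf hfg hg
      exact ⟨s.toAddMonoidHom, fun a v => s.map_smul a v, fun v => LinearMap.congr_fun hs v⟩
    obtain ⟨-, htN, hN⟩ := (isUlrichWrt_iff hxS hIS N).mp hN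
    obtain ⟨-, htC, hC⟩ := (isUlrichWrt_iff hxS hIS C).mp hC
    obtain ⟨y, hy, hyx⟩ := exists_fst_mem_pow hx.one_le hx.mem
    obtain ⟨eN, heN, hfstN, hsndN⟩ := exists_idempotent hx hI hN hyx
    obtain ⟨eC, heC, hfstC, hsndC⟩ := exists_idempotent hx hI hC hyx
    have hX := fiberSquareDiag_mem_nonZeroDivisors (I := I) (hx.mem_nonZeroDivisors hI)
    have hge : ∀ v, g (eN v) = eC (g v) := by
      intro v
      refine smul_torsionFree_cancel hX ?_
      rw [heC, ← map_smul, heN, map_smul]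
    have hidem : ∀ v, eC (eC v) = eC v := by
      intro v
      refine smul_torsionFree_cancel hX ?_
      rw [heC, hfstC, hyx]
    let s' : C →ₗ[fiberSquare I] N :=
      { toFun := fun v => eN (s (eC v)) + (s (v - eC v) - eN (s (v - eC v)))
        map_add' := fun v w => by
          simp only [map_add, map_sub]
          abel
        map_smul' := fun p v => by
          simp only [RingHom.id_apply, smul_add]
          rw [hfstN, hsndN, map_smul, ← smul_sub, hfstC, hsndC, hs.1, hs.1, map_smul, map_smul,
            smul_sub] }
    refine ⟨s', LinearMap.ext fun v => ?_⟩
    change g (eN (s (eC v)) + (s (v - eC v) - eN (s (v - eC v)))) = v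
    rw [map_add, map_sub, hge, hge, hs.2, hs.2, hidem, map_sub eC, hidem]
    abel

end Transfer

end UlrichSplit

namespace UlrichSplit

section Ext

open CategoryTheory Abelian

variable {R : Type u} [CommRing R]

lemma smul_ext_eq_zero_iff {M N F : Type u} [AddCommGroup M] [Module R M] [AddCommGroup N]
    [Module R N] [AddCommGroup F] [Module R F] [Module.Projective R F] (p : F →ₗ[R] M)
    (hp : Function.Surjective p) (a : R) :
    (∀ y : Ext (ModuleCat.of R M) (ModuleCat.of R N) 1, a • y = 0) ↔
      ∀ f : LinearMap.ker p →ₗ[R] N, ∃ g : F →ₗ[R] N, ∀ w : LinearMap.ker p, g w = a • f w := by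
  have hS : p.shortComplexKer.ShortExact := LinearMap.shortExact_shortComplexKer hp
  have : Projective p.shortComplexKer.X₂ :=
    (IsProjective.iff_projective F).mp ‹_›
  constructor
  · intro h f
    obtain ⟨y, hy⟩ := Ext.contravariant_sequence_exact₁ hS (ModuleCat.of R N)
      (Ext.mk₀ (ModuleCat.ofHom (a • f))) (add_zero 1) (by
        have h1 : ModuleCat.ofHom (a • f) = a • ModuleCat.ofHom f := rfl
        rw [h1, Ext.mk₀_smul, Ext.comp_smul]
        exact h _)
    obtain ⟨g, rfl⟩ := Ext.homEquiv₀.symm.surjective y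
    refine ⟨g.hom, fun w => ?_⟩
    rw [Ext.homEquiv₀_symm_apply, Ext.mk₀_comp_mk₀] at hy
    have h2 := Ext.homEquiv₀.symm.injective (a₁ := p.shortComplexKer.f ≫ g)
      (a₂ := ModuleCat.ofHom (a • f)) hy
    exact congrArg (fun q => q.hom w) h2
  · intro h y
    obtain ⟨z, rfl⟩ := Ext.contravariant_sequence_exact₃ hS (ModuleCat.of R N) y
      (Ext.eq_zero_of_projective _) (add_zero 1)
    obtain ⟨f, rfl⟩ := Ext.homEquiv₀.symm.surjective z
    obtain ⟨g, hg⟩ := h f.hom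
    rw [Ext.homEquiv₀_symm_apply, ← Ext.comp_smul, ← Ext.mk₀_smul]
    have h1 : a • f = p.shortComplexKer.f ≫ ModuleCat.ofHom g := by
      ext w
      exact (hg w).symm
    rw [h1, ← Ext.mk₀_comp_mk₀]
    exact ShortComplex.ShortExact.extClass_comp_assoc _ _

end Ext

section Principal

lemma isPrincipal_of_mul_eq_span {B : Type*} [CommRing B]
    (hB : {n : Ideal B | n.IsMaximal}.Finite) {a b : Ideal B} {c : B} (hc : c ∈ nonZeroDivisors B)
    (h : a * b = Ideal.span {c}) : a.IsPrincipal := by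
  refine Ideal.IsPrincipal.of_finite_maximals_of_isUnit hB ?_
  refine isUnit_of_mul_isUnit_left (y := (b : FractionalIdeal (nonZeroDivisors B) (FractionRing B))) ?_
  rw [← FractionalIdeal.coeIdeal_mul, h, FractionalIdeal.coeIdeal_span_singleton]
  obtain ⟨w, hw⟩ := (isUnit_algebraMap_fractionRing hc).exists_right_inv
  refine IsUnit.of_mul_eq_one (FractionalIdeal.spanSingleton _ w) ?_
  rw [FractionalIdeal.spanSingleton_mul_spanSingleton, hw, FractionalIdeal.spanSingleton_one]

variable {R : Type u} [CommRing R] [IsLocalRing R] [IsNoetherianRing R] [IsOneDimCM R]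

lemma finite_setOf_isMaximal (B : Subalgebra R (FractionRing R)) [Module.Finite R B] :
    {n : Ideal B | n.IsMaximal}.Finite := by
  have : IsNoetherianRing B := isNoetherianRing_subalgebra
  obtain ⟨t, htm, ht⟩ := IsOneDimCM.exists_mem (R := R)
  refine (Ideal.finite_minimalPrimes_of_isNoetherianRing B
    (Ideal.span {algebraMap R B t})).subset fun n hn => ?_
  refine ⟨⟨Ideal.IsMaximal.isPrime hn, by
    simpa [Ideal.span_le] using algebraMap_mem_of_isMaximal hn htm⟩, ?_⟩
  rintro p ⟨hp, htp⟩ hpn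
  have hpm := isMaximal_of_algebraMap_mem hp ht (htp (Ideal.mem_span_singleton_self _))
  exact (hpm.eq_of_le (Ideal.IsMaximal.ne_top hn) hpn).ge

lemma IsReduction.exists_map_pow_eq {R : Type u} [CommRing R] {I : Ideal R} {r : ℕ} {x : R} (hx : IsReduction I r x)
    (hI : IsRegularIdeal I) :
    ∃ j, 1 ≤ j ∧ (I.map (algebraMap R (blowUp I))) ^ (r * j) =
      Ideal.span {algebraMap R (blowUp I) (x ^ j)} := by
  obtain ⟨j₀, hj₀⟩ := hx.exists_forall_mem_blowUp_iff hI
  refine ⟨j₀ + 1, by omega, ?_⟩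
  rw [← Ideal.map_pow]
  refine le_antisymm (Ideal.map_le_iff_le_comap.mpr fun a ha => ?_) ?_
  · obtain ⟨w, hw⟩ := (isUnit_algebraMap_fractionRing
      (pow_mem (hx.mem_nonZeroDivisors hI) (j₀ + 1))).exists_right_inv
    have h1 : x ^ (j₀ + 1) • (algebraMap R (FractionRing R) a * w) = algebraMap R _ a := by
      rw [Algebra.smul_def]; linear_combination algebraMap R (FractionRing R) a * hw
    refine Ideal.mem_span_singleton'.mpr ⟨⟨algebraMap R (FractionRing R) a * w,
      hx.mem_blowUp_of_mem hI (j := j₀ + 1) ?_⟩, Subtype.ext ?_⟩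
    · rw [h1]
      exact mem_inQ.mpr ⟨a, ha, rfl⟩
    · change algebraMap R (FractionRing R) a * w * algebraMap R _ (x ^ (j₀ + 1)) = algebraMap R _ a
      linear_combination algebraMap R (FractionRing R) a * hw
  · rw [Ideal.span_singleton_le_iff_mem]
    refine Ideal.mem_map_of_mem _ ?_
    rw [pow_mul]
    exact Ideal.pow_mem_pow hx.mem _

/-- The ideal `I B(I)` is generated by a regular element. -/
lemma IsReduction.exists_map_eq_span {I : Ideal R} {r : ℕ} {x : R} (hx : IsReduction I r x)
    (hI : IsRegularIdeal I) :
    ∃ y ∈ nonZeroDivisors (blowUp I), I.map (algebraMap R (blowUp I)) = Ideal.span {y} := by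
  have := hx.finite_blowUp hI
  obtain ⟨j, hj1, hj⟩ := hx.exists_map_pow_eq hI
  have hc := algebraMap_mem_nonZeroDivisors (blowUp I) (pow_mem (hx.mem_nonZeroDivisors hI) j)
  obtain ⟨k, hk⟩ := Nat.exists_eq_add_of_le' (Nat.mul_pos hx.one_le hj1 : 1 ≤ r * j)
  rw [hk, pow_succ'] at hj
  obtain ⟨y, hy⟩ := isPrincipal_of_mul_eq_span (finite_setOf_isMaximal (blowUp I)) hc hj
  refine ⟨y, ?_, hy⟩
  have h1 : algebraMap R (blowUp I) (x ^ j) ∈ I.map (algebraMap R (blowUp I)) := by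
    refine (hj ▸ Ideal.mul_le_left : Ideal.span {algebraMap R (blowUp I) (x ^ j)} ≤ _) ?_
    exact Ideal.mem_span_singleton_self _
  rw [hy] at h1
  obtain ⟨b, hb⟩ := Ideal.mem_span_singleton'.mp h1
  rw [← hb] at hc
  exact (mul_mem_nonZeroDivisors.mp hc).2

end Principal

section Commutator

variable {R B : Type*} [CommRing R] [CommRing B] [Algebra R B] {I : Ideal R} {y : B}

variable (I y) in
/-- The elements `γ` of `B` such that `y γ` is in the image of `I`. -/
def divSubmodule : Submodule R B :=
  Submodule.comap (LinearMap.mulLeft R y) (Submodule.map (Algebra.linearMap R B) I)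

lemma mem_divSubmodule {b : B} : b ∈ divSubmodule I y ↔ ∃ a ∈ I, algebraMap R B a = y * b :=
  Iff.rfl

lemma exists_mem_divSubmodule_pow (hyI : I.map (algebraMap R B) = Ideal.span {y}) (k : ℕ) {a : R}
    (ha : a ∈ I ^ k) : ∃ b ∈ divSubmodule I y ^ k, algebraMap R B a = y ^ k * b := by
  induction k generalizing a with
  | zero => exact ⟨algebraMap R B a, by simp [Submodule.mem_one], by simp⟩
  | succ k ih =>
    rw [pow_succ] at ha
    induction ha using Submodule.mul_induction_on' with
    | mem_mul_mem c hc d hd =>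
      obtain ⟨b, hb, hbc⟩ := ih hc
      have h1 : algebraMap R B d ∈ Ideal.span {y} := hyI ▸ Ideal.mem_map_of_mem _ hd
      obtain ⟨b', hb'⟩ := Ideal.mem_span_singleton'.mp h1
      refine ⟨b * b', ?_, ?_⟩
      · rw [pow_succ]
        exact Submodule.mul_mem_mul hb (mem_divSubmodule.mpr ⟨d, hd, by rw [← hb', mul_comm]⟩)
      · rw [map_mul, hbc, ← hb', pow_succ]; ring
    | add c _ d _ hc hd =>
      obtain ⟨b, hb, hbc⟩ := hc
      obtain ⟨b', hb', hbd⟩ := hd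
      exact ⟨b + b', add_mem hb hb', by rw [map_add, hbc, hbd, mul_add]⟩

lemma mem_divSubmodule_pow (hy : y ∈ nonZeroDivisors B)
    (hyI : I.map (algebraMap R B) = Ideal.span {y}) {k : ℕ}
    (hk : ∀ a ∈ I ^ k, ∀ b : B, ∃ a' ∈ I ^ k, algebraMap R B a' = b * algebraMap R B a) (b : B) :
    b ∈ divSubmodule I y ^ k := by
  have h1 : ∀ c ∈ (I ^ k).map (algebraMap R B), ∃ a ∈ I ^ k, algebraMap R B a = c := by
    intro c hc
    induction hc using Submodule.span_induction with
    | mem c hc => obtain ⟨a, ha, rfl⟩ := hc; exact ⟨a, ha, rfl⟩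
    | zero => exact ⟨0, zero_mem _, map_zero _⟩
    | add c d _ _ hc hd =>
      obtain ⟨a, ha, rfl⟩ := hc
      obtain ⟨a', ha', rfl⟩ := hd
      exact ⟨a + a', add_mem ha ha', map_add _ _ _⟩
    | smul c d _ hd =>
      obtain ⟨a, ha, rfl⟩ := hd
      exact hk a ha c
  obtain ⟨a, ha, hab⟩ := h1 (b * y ^ k) (by
    rw [Ideal.map_pow, hyI, Ideal.span_singleton_pow]
    exact Ideal.mul_mem_left _ _ (Ideal.mem_span_singleton_self _))
  obtain ⟨b', hb', hab'⟩ := exists_mem_divSubmodule_pow hyI k ha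
  have h2 : b = b' := by
    have h3 : (b - b') * y ^ k = 0 := by rw [sub_mul, ← hab, hab']; ring
    exact sub_eq_zero.mp (mem_nonZeroDivisors_iff_right.mp (pow_mem hy k) _ h3)
  rwa [h2]

/-- Let `I B = y B`, where `I ^ k` is an ideal of `B` for large `k`. Linear maps between
`B`-modules become `B`-linear after multiplication by elements of `y B`. This holds as the derivation
`b ↦ f b - b f` is killed by `y`. -/
lemma map_mul_smul_eq (hy : y ∈ nonZeroDivisors B)
    (hyI : I.map (algebraMap R B) = Ideal.span {y}) {n : ℕ}
    (hn : ∀ k ≥ n, ∀ a ∈ I ^ k, ∀ b : B, ∃ a' ∈ I ^ k, algebraMap R B a' = b * algebraMap R B a)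
    {X Y : Type*} [AddCommGroup X] [Module R X] [Module B X] [IsScalarTower R B X]
    [AddCommGroup Y] [Module R Y] [Module B Y] [IsScalarTower R B Y] (f : X →ₗ[R] Y)
    (b : B) (v : X) : f ((y * b) • v) = (y * b) • f v := by
  set S := divSubmodule I y
  have hS : ∀ k ≥ n, ∀ b, b ∈ S ^ k := fun k hk b => mem_divSubmodule_pow hy hyI (hn k hk) b
  let D : B → X → Y := fun b v => f (b • v) - b • f v
  have hD_mul : ∀ b c v, D (b * c) v = D b (c • v) + b • D c v := by
    intro b c v
    simp only [D, mul_smul, smul_sub]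
    abel
  have hD_add : ∀ b c v, D (b + c) v = D b v + D c v := by
    intro b c v
    simp only [D, add_smul, map_add]
    abel
  have hD_alg : ∀ (a : R) v, D (algebraMap R B a) v = 0 := by
    intro a v
    simp only [D, algebraMap_smul, map_smul, sub_self]
  have hD_smul : ∀ (a : R) b v, D (algebraMap R B a * b) v = algebraMap R B a • D b v := by
    intro a b v
    rw [hD_mul, hD_alg, zero_add]
  have hD_vadd : ∀ b v w, D b (v + w) = D b v + D b w := by
    intro b v w
    simp only [D, smul_add, map_add]
    abel
  have h1 : ∀ c ∈ S, ∀ v, D y (c • v) = -(y • D c v) := by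
    intro c hc v
    obtain ⟨a, ha, hac⟩ := mem_divSubmodule.mp hc
    have h2 := hD_mul y c v
    rw [← hac, hD_alg] at h2
    exact eq_neg_of_add_eq_zero_left h2.symm
  have h2 : ∀ c ∈ S, ∀ d ∈ S, ∀ v, c • D y (d • v) = d • D y (c • v) := by
    intro c hc d hd v
    rw [h1 c hc, h1 d hd, smul_neg, smul_neg, neg_inj, smul_smul, smul_smul]
    obtain ⟨a, ha, hac⟩ := mem_divSubmodule.mp hc
    obtain ⟨a', ha', had⟩ := mem_divSubmodule.mp hd
    rw [mul_comm c, mul_comm d, ← hac, ← had, ← hD_smul, ← hD_smul, hac, had]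
    congr 1
    ring
  have h3 : ∀ k, ∀ c ∈ S ^ k, ∀ d ∈ S ^ k, ∀ v, c • D y (d • v) = d • D y (c • v) := by
    intro k
    induction k with
    | zero =>
      intro c hc d hd v
      rw [pow_zero, Submodule.mem_one] at hc hd
      obtain ⟨a, rfl⟩ := hc
      obtain ⟨a', rfl⟩ := hd
      have h4 : ∀ (e : R) w, D y (algebraMap R B e • w) = algebraMap R B e • D y w := by
        intro e w
        rw [← hD_smul, mul_comm, hD_mul, hD_alg, smul_zero, add_zero]
      rw [h4, h4, smul_comm]
    | succ k ih =>
      intro c hc d hd v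
      rw [pow_succ] at hc hd
      induction hc using Submodule.mul_induction_on' with
      | mem_mul_mem c hc c' hc' =>
        induction hd using Submodule.mul_induction_on' with
        | mem_mul_mem d hd d' hd' =>
          rw [mul_smul, mul_comm d d', mul_smul, h2 c' hc' d' hd', smul_comm c d',
            smul_comm c' d v, ih c hc d hd, ← mul_smul, ← mul_smul]
        | add d _ d' _ hd hd' => rw [add_smul, hD_vadd, smul_add, hd, hd', add_smul]
      | add c _ c' _ hc hc' => rw [add_smul, hc, hc', add_smul, hD_vadd, smul_add]
  have h4 : ∀ (b : B) v, D y (b • v) = b • D y v := by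
    intro b v
    have h5 := h3 n 1 (hS n le_rfl 1) b (hS n le_rfl b) v
    rwa [one_smul, one_smul] at h5
  have h5 : ∀ k, ∀ c ∈ S ^ k, ∀ v, y • D c v = -(k • c • D y v) := by
    intro k
    induction k with
    | zero =>
      intro c hc v
      rw [pow_zero, Submodule.mem_one] at hc
      obtain ⟨a, rfl⟩ := hc
      rw [hD_alg, smul_zero, zero_smul, neg_zero]
    | succ k ih =>
      intro c hc v
      rw [pow_succ] at hc
      induction hc using Submodule.mul_induction_on' with
      | mem_mul_mem c hc c' hc' =>
        have h6 := h1 c' hc' v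
        rw [hD_mul, smul_add, ih c hc, smul_comm y c, eq_neg_iff_add_eq_zero.mpr
          ((add_comm _ _).trans (eq_neg_iff_add_eq_zero.mp h6)), h4, add_smul, one_smul, smul_neg,
          neg_add, mul_smul]
      | add c _ c' _ hc hc' => rw [hD_add, smul_add, hc, hc', add_smul c c', smul_add, neg_add]
  have h6 : ∀ v, D y v = 0 := by
    intro v
    have h7 := h5 n 1 (hS n le_rfl 1) v
    have h8 := h5 (n + 1) 1 (hS (n + 1) (by omega) 1) v
    rw [h7, add_smul, one_smul, one_smul, neg_add] at h8
    simpa using h8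
  have h7 : D (y * b) v = 0 := by
    rw [hD_mul, h6, zero_add, h5 n b (hS n le_rfl b), h6, smul_zero, smul_zero, neg_zero]
  exact sub_eq_zero.mp h7

end Commutator

end UlrichSplit

namespace UlrichSplit

section FreeCover

variable {R B : Type*} [CommRing R] [CommRing B] [Algebra R B] {k : ℕ}
  {M : Type*} [AddCommGroup M] [Module R M] [Module B M] [IsScalarTower R B M]

variable (R B k) in
/-- The canonical map `R ^ k → B ^ k`. -/
def freeMap : (Fin k → R) →ₗ[R] (Fin k → B) :=
  LinearMap.pi fun i => Algebra.linearMap R B ∘ₗ LinearMap.proj i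

@[simp] lemma freeMap_apply (v : Fin k → R) (i : Fin k) :
    freeMap R B k v i = algebraMap R B (v i) := rfl

lemma freeMap_single (i : Fin k) : freeMap R B k (Pi.single i 1) = Pi.single i 1 := by
  ext j
  rw [freeMap_apply, Pi.single_apply, Pi.single_apply]
  split_ifs <;> simp

variable (B) in
/-- The `B`-linear extension `B ^ k → M` of a linear map `R ^ k → M`. -/
def extendFree (p : (Fin k → R) →ₗ[R] M) : (Fin k → B) →ₗ[B] M :=
  Fintype.linearCombination B fun i => p (Pi.single i 1)

lemma extendFree_single {R B M : Type*} [CommRing R] [CommRing B] [AddCommGroup M] [Module R M]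
    [Module B M] (p : (Fin k → R) →ₗ[R] M) (i : Fin k) :
    extendFree B p (Pi.single i 1) = p (Pi.single i 1) := by
  simp [extendFree, Fintype.linearCombination_apply_single]

lemma extendFree_freeMap (p : (Fin k → R) →ₗ[R] M) (v : Fin k → R) :
    extendFree B p (freeMap R B k v) = p v := by
  have h : (extendFree B p).restrictScalars R ∘ₗ freeMap R B k = p := by
    refine LinearMap.pi_ext' fun i => LinearMap.ext_ring ?_
    simp only [LinearMap.comp_apply, LinearMap.coe_single, LinearMap.restrictScalars_apply,
      freeMap_single, extendFree_single]
  exact LinearMap.congr_fun h v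

lemma extendFree_surjective {p : (Fin k → R) →ₗ[R] M} (hp : Function.Surjective p) :
    Function.Surjective (extendFree B p) := fun m => by
  obtain ⟨v, rfl⟩ := hp m
  exact ⟨freeMap R B k v, extendFree_freeMap p v⟩

variable (B) in
/-- The `B`-submodule of `B ^ k` generated by the kernel of `R ^ k → M`. -/
def kerSpan (p : (Fin k → R) →ₗ[R] M) : Submodule B (Fin k → B) :=
  Submodule.span B (freeMap R B k '' LinearMap.ker p)

lemma freeMap_mem_kerSpan {M : Type*} [AddCommGroup M] [Module R M] {p : (Fin k → R) →ₗ[R] M} {w : Fin k → R} (hw : p w = 0) :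
    freeMap R B k w ∈ kerSpan B p := Submodule.subset_span ⟨w, hw, rfl⟩

lemma kerSpan_le_ker (p : (Fin k → R) →ₗ[R] M) : kerSpan B p ≤ LinearMap.ker (extendFree B p) := by
  rw [kerSpan, Submodule.span_le]
  rintro _ ⟨w, hw, rfl⟩
  change extendFree B p _ = 0
  rw [extendFree_freeMap]
  exact hw

/-- Descent of a linear map along a surjection. -/
lemma exists_comp_eq {A M F N : Type*} [Ring A] [AddCommGroup M] [Module A M] [AddCommGroup F]
    [Module A F] [AddCommGroup N] [Module A N] {p : F →ₗ[A] M} (hp : Function.Surjective p)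
    {g : F →ₗ[A] N} (hg : ∀ w, p w = 0 → g w = 0) : ∃ s : M →ₗ[A] N, ∀ v, s (p v) = g v := by
  refine ⟨(LinearMap.ker p).liftQ g hg ∘ₗ (p.quotKerEquivOfSurjective hp).symm.toLinearMap,
    fun v => ?_⟩
  have h : (p.quotKerEquivOfSurjective hp).symm (p v) = Submodule.Quotient.mk v := by
    rw [LinearEquiv.symm_apply_eq]
    rfl
  change (LinearMap.ker p).liftQ g hg ((p.quotKerEquivOfSurjective hp).symm (p v)) = _
  rw [h]
  rfl

/-- If all linear maps from `M` to `B`-modules become `B`-linear after multiplication by `a` then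
`a` maps the kernel of `B ^ k → M` to the `B`-module generated by the kernel of `R ^ k → M`. -/
lemma smul_mem_kerSpan {M : Type*} [AddCommGroup M] [Module R M] [Module B M] {p : (Fin k → R) →ₗ[R] M} (hp : Function.Surjective p) {a : R}
    (ha : ∀ (f : M →ₗ[R] ((Fin k → B) ⧸ kerSpan B p)) (b : B) (v : M),
      f (a • b • v) = a • b • f v) {l : Fin k → B}
    (hl : extendFree B p l = 0) : a • l ∈ kerSpan B p := by
  obtain ⟨f, hf⟩ := exists_comp_eq hp (g := (kerSpan B p).mkQ.restrictScalars R ∘ₗ freeMap R B k)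
    fun w hw => (Submodule.Quotient.mk_eq_zero _).mpr (freeMap_mem_kerSpan hw)
  let T : M →ₗ[B] ((Fin k → B) ⧸ kerSpan B p) :=
    { toFun := fun v => a • f v
      map_add' := fun v w => by rw [map_add, smul_add]
      map_smul' := fun b v => by
        rw [← map_smul, ha, RingHom.id_apply, smul_comm a b] }
  have h1 : T ∘ₗ extendFree B p = algebraMap R B a • (kerSpan B p).mkQ := by
    refine LinearMap.pi_ext' fun i => LinearMap.ext_ring ?_
    simp only [LinearMap.comp_apply, LinearMap.coe_single, extendFree_single,
      LinearMap.smul_apply]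
    change a • f (p (Pi.single i 1)) = _
    rw [hf, algebraMap_smul]
    simp [freeMap_single]
  have h2 := LinearMap.congr_fun h1 l
  rw [LinearMap.comp_apply, hl, map_zero, LinearMap.smul_apply, ← map_smul, algebraMap_smul] at h2
  exact (Submodule.Quotient.mk_eq_zero _).mp h2.symm

lemma exists_extension {N : Type*} [AddCommGroup N] [Module R N] [Module B N] [IsScalarTower R B N]
    [Module.IsTorsionFree R N] [Module.Projective B M] (hinj : Function.Injective (algebraMap R B))
    {z : R} (hz : z ∈ nonZeroDivisors R) (hzB : ∀ b : B, ∃ c : R, algebraMap R B c = z • b)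
    {p : (Fin k → R) →ₗ[R] M} (hp : Function.Surjective p) {a : R}
    (ha : ∀ l, extendFree B p l = 0 → a • l ∈ kerSpan B p) (f : LinearMap.ker p →ₗ[R] N) :
    ∃ g : (Fin k → R) →ₗ[R] N, ∀ w : LinearMap.ker p, g w = a • f w := by
  have hfree : Function.Injective (freeMap R B k) := fun v w h =>
    funext fun i => hinj (congrFun h i)
  have h1 : ∀ w ∈ kerSpan B p, ∀ b : B, ∃ (m : N) (v : LinearMap.ker p),
      freeMap R B k v = z • b • w ∧ f v = z • m := by
    intro w hw
    induction hw using Submodule.span_induction with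
    | mem w hw =>
      obtain ⟨v, hv, rfl⟩ := hw
      intro b
      obtain ⟨c, hc⟩ := hzB b
      refine ⟨b • f ⟨v, hv⟩, c • ⟨v, hv⟩, ?_, ?_⟩
      · rw [Submodule.coe_smul, map_smul, ← smul_assoc, ← hc, algebraMap_smul]
      · rw [map_smul, ← smul_assoc, ← hc, algebraMap_smul]
    | zero => exact fun b => ⟨0, 0, by simp, by simp⟩
    | add w w' _ _ hw hw' =>
      intro b
      obtain ⟨m, v, h1, h2⟩ := hw b
      obtain ⟨m', v', h1', h2'⟩ := hw' b
      exact ⟨m + m', v + v', by simp [h1, h1'], by simp [h2, h2']⟩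
    | smul c w _ hw =>
      intro b
      rw [← mul_smul]
      exact hw (b * c)
  obtain ⟨s, hs⟩ := Module.projective_lifting_property (extendFree B p) LinearMap.id
    (extendFree_surjective hp)
  have h2 : ∀ u : Fin k → R, ∃ (m : N) (v : LinearMap.ker p),
      freeMap R B k v = z • a • (freeMap R B k u - s (p u)) ∧ f v = z • m := by
    intro u
    obtain ⟨m, v, h3, h4⟩ := h1 _ (ha (freeMap R B k u - s (p u)) (by
      rw [map_sub, extendFree_freeMap, sub_eq_zero]
      exact (LinearMap.congr_fun hs (p u)).symm)) 1
    exact ⟨m, v, by rw [h3, one_smul], h4⟩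
  choose m v hv hm using h2
  refine ⟨{ toFun := m, map_add' := fun u u' => ?_, map_smul' := fun c u => ?_ }, fun w => ?_⟩
  · refine smul_torsionFree_cancel hz ?_
    rw [smul_add, ← hm, ← hm, ← hm, ← map_add]
    congr 1
    refine Subtype.ext (hfree ?_)
    rw [Submodule.coe_add, map_add, hv, hv, hv, ← smul_add, ← smul_add, map_add, map_add, map_add]
    congr 2
    abel
  · refine smul_torsionFree_cancel hz ?_
    have h3 : s (p (c • u)) = c • s (p u) := by
      rw [map_smul, ← algebraMap_smul B c (p u), map_smul, algebraMap_smul]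
    rw [RingHom.id_apply, smul_comm z c, ← hm, ← hm, ← map_smul]
    congr 1
    refine Subtype.ext (hfree ?_)
    rw [Submodule.coe_smul, map_smul, hv, hv, h3, map_smul, ← smul_sub, smul_comm a c, smul_comm z c]
  · refine smul_torsionFree_cancel hz ?_
    change z • m w = _
    rw [← hm, ← map_smul, ← map_smul]
    congr 1
    refine Subtype.ext (hfree ?_)
    have h3 : p w = 0 := w.2
    rw [hv, h3, map_zero, sub_zero, Submodule.coe_smul, Submodule.coe_smul, map_smul, map_smul]

/-- A criterion for the projectivity of `M` over `B`, in terms of extensions to `R ^ k` of the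
multiplication maps by the elements of `I` on the kernel of `R ^ k → M`. -/
lemma projective_of_forall_exists_extension [Module.IsTorsionFree R B] {I : Ideal R} {y : B}
    (hy : y ∈ nonZeroDivisors B) (hyI : I.map (algebraMap R B) = Ideal.span {y})
    (hyM : IsSMulRegular M y) {z : R} (hz : z ∈ nonZeroDivisors R)
    (hzB : ∀ b : B, ∃ c : R, algebraMap R B c = z • b)
    {p : (Fin k → R) →ₗ[R] M} (hp : Function.Surjective p) (hpI : ∀ w, p w = 0 → ∀ i, w i ∈ I)
    (hg : ∀ a ∈ I, ∃ g : (Fin k → R) →ₗ[R] (Fin k → B), (∀ v, g v ∈ kerSpan B p) ∧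
      ∀ w, p w = 0 → g w = a • freeMap R B k w) : Module.Projective B M := by
  have h1 : ∀ c ∈ I.map (algebraMap R B), ∃ G : (Fin k → B) →ₗ[B] (Fin k → B),
      (∀ v, G v ∈ kerSpan B p) ∧ ∀ w ∈ kerSpan B p, G w = c • w := by
    intro c hc
    induction hc using Submodule.span_induction with
    | mem c hc =>
      obtain ⟨a, ha, rfl⟩ := hc
      obtain ⟨g, hg1, hg2⟩ := hg a ha
      refine ⟨extendFree B g, fun v => ?_, fun w hw => ?_⟩
      · rw [extendFree, Fintype.linearCombination_apply]
        exact Submodule.sum_mem _ fun i _ => Submodule.smul_mem _ _ (hg1 _)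
      · induction hw using Submodule.span_induction with
        | mem w hw =>
          obtain ⟨w, hw, rfl⟩ := hw
          rw [extendFree_freeMap, hg2 w hw, algebraMap_smul]
        | zero => simp
        | add w w' _ _ h h' => rw [map_add, h, h', smul_add]
        | smul b w _ h => rw [map_smul, h, smul_comm]
    | zero => exact ⟨0, fun v => zero_mem _, fun w _ => by simp⟩
    | add c d _ _ hc hd =>
      obtain ⟨G, h1, h2⟩ := hc
      obtain ⟨G', h1', h2'⟩ := hd
      exact ⟨G + G', fun v => add_mem (h1 v) (h1' v), fun w hw => by
        rw [LinearMap.add_apply, h2 w hw, h2' w hw, add_smul]⟩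
    | smul b c _ hc =>
      obtain ⟨G, h1, h2⟩ := hc
      exact ⟨b • G, fun v => Submodule.smul_mem _ b (h1 v), fun w hw => by
        rw [LinearMap.smul_apply, h2 w hw, smul_assoc]⟩
  obtain ⟨G, hG, hGy⟩ := h1 y (hyI ▸ Ideal.mem_span_singleton_self y)
  have hreg : ∀ v w : Fin k → B, y • v = y • w → v = w := fun v w h => funext fun i => by
    have h2 : y * v i = y * w i := congrFun h i
    rw [← sub_eq_zero, ← mul_sub] at h2
    exact sub_eq_zero.mp (mem_nonZeroDivisors_iff.mp hy |>.1 _ h2)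
  have h2 : ∀ w ∈ kerSpan B p, ∃ w', y • w' = w := by
    intro w hw
    induction hw using Submodule.span_induction with
    | mem w hw =>
      obtain ⟨w, hw, rfl⟩ := hw
      have h3 : ∀ i, ∃ b, y * b = algebraMap R B (w i) := fun i => by
        obtain ⟨b, hb⟩ := Ideal.mem_span_singleton'.mp (hyI ▸ Ideal.mem_map_of_mem _ (hpI w hw i) :
          algebraMap R B (w i) ∈ Ideal.span {y})
        exact ⟨b, by rw [mul_comm, hb]⟩
      choose b hb using h3
      exact ⟨b, funext hb⟩
    | zero => exact ⟨0, smul_zero _⟩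
    | add w w' _ _ h h' =>
      obtain ⟨v, rfl⟩ := h
      obtain ⟨v', rfl⟩ := h'
      exact ⟨v + v', smul_add _ _ _⟩
    | smul b w _ h =>
      obtain ⟨v, rfl⟩ := h
      exact ⟨b • v, smul_comm y b v⟩
  choose H hH using fun v => h2 _ (hG v)
  let G' : (Fin k → B) →ₗ[B] (Fin k → B) :=
    { toFun := H
      map_add' := fun v w => hreg _ _ (by rw [hH, smul_add, hH, hH, map_add])
      map_smul' := fun b v => hreg _ _ (by
        rw [hH, map_smul, RingHom.id_apply, smul_comm y b, hH]) }
  have hker : ∀ l, extendFree B p l = 0 → G' l = l := by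
    intro l hl
    choose c hc using fun i => hzB (l i)
    have h3 : freeMap R B k c = z • l := funext hc
    have h4 : z • l ∈ kerSpan B p := by
      rw [← h3]
      refine freeMap_mem_kerSpan ?_
      rw [← extendFree_freeMap (B := B) p, h3, ← algebraMap_smul B z l, map_smul, hl, smul_zero]
    refine smul_torsionFree_cancel hz ?_
    rw [← algebraMap_smul B z (G' l), ← map_smul, algebraMap_smul]
    exact hreg _ _ ((hH _).trans (hGy _ h4))
  obtain ⟨s, hs⟩ := exists_comp_eq (extendFree_surjective (B := B) hp) (g := LinearMap.id - G')
    fun w hw => by rw [LinearMap.sub_apply, hker w hw, LinearMap.id_apply, sub_self]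
  refine Module.Projective.of_split s (extendFree B p) (LinearMap.ext fun m => ?_)
  obtain ⟨v, rfl⟩ := extendFree_surjective (B := B) hp m
  rw [LinearMap.comp_apply, hs, LinearMap.id_apply, LinearMap.sub_apply, map_sub,
    LinearMap.id_apply]
  have h5 : extendFree B p (G' v) = 0 := by
    refine hyM ?_
    change y • _ = y • (0 : M)
    rw [← map_smul, smul_zero]
    exact (congrArg _ (hH v)).trans (kerSpan_le_ker p (hG v))
  rw [h5, sub_zero]

end FreeCover

end UlrichSplit

namespace UlrichSplit

lemma minimalCover_surjective {R : Type u} [CommRing R] (M : Type u) [AddCommGroup M] [Module R M]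
    [Module.Finite R M] : Function.Surjective (minimalCover R M) :=
  (exists_minimalCover R M).choose_spec

section

variable {R : Type u} [CommRing R] [IsLocalRing R] [IsNoetherianRing R] [IsOneDimCM R]

lemma mu_pi_le {R : Type u} [CommRing R] (k : ℕ) : mu R (Fin k → R) ≤ k := by
  rw [mu, ← (Pi.basisFun R (Fin k)).span_eq]
  refine (Submodule.spanFinrank_span_le_ncard_of_finite (Set.finite_range _)).trans ?_
  rw [← Set.image_univ]
  refine (Set.ncard_image_le Set.finite_univ).trans ?_
  simp [Set.ncard_univ]

lemma mem_maximalIdeal_of_mem_syzygy {R : Type u} [CommRing R] [IsLocalRing R] (M : Type u) [AddCommGroup M] [Module R M]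
    [Module.Finite R M] {w : Fin (mu R M) → R} (hw : minimalCover R M w = 0) (i : Fin (mu R M)) :
    w i ∈ maximalIdeal R := by
  have h1 := length_quotient_eq_add (minimalCover R M) (minimalCover_surjective M)
    (maximalIdeal R • ⊤)
  rw [Submodule.map_smul'', Submodule.map_top, LinearMap.range_eq_top.mpr (minimalCover_surjective M),
    ← mu_eq_length, ← mu_eq_length] at h1
  have h2 : relLength (LinearMap.ker (minimalCover R M)) (maximalIdeal R • ⊤) = 0 := by
    have h3 : (mu R (Fin (mu R M) → R) : ℕ∞) ≤ mu R M := by exact_mod_cast mu_pi_le (mu R M)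
    rw [h1] at h3
    have h4 : relLength (LinearMap.ker (minimalCover R M)) (maximalIdeal R • ⊤) + (mu R M : ℕ∞) ≤
      0 + mu R M := by rwa [zero_add]
    exact le_antisymm ((ENat.add_le_add_iff_right (ENat.natCast_ne_top _)).mp h4) zero_le
  have h3 := relLength_eq_zero_iff.mp h2 (show w ∈ _ from hw)
  have h4 : (maximalIdeal R • ⊤ : Submodule R (Fin (mu R M) → R)) ≤
      Submodule.comap (LinearMap.proj i) (maximalIdeal R) := by
    rw [Submodule.smul_le]
    intro a ha v _
    exact Ideal.mul_mem_right _ _ ha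
  exact h4 h3

end

section

variable {R B : Type u} [CommRing R] [CommRing B] [Algebra R B]
  {I : Ideal R} {y : B} {n : ℕ} {z : R}

lemma isSMulRegular_of_map_eq_span (hyI : I.map (algebraMap R B) = Ideal.span {y}) {t : R}
    (htI : t ∈ I) (ht : t ∈ nonZeroDivisors R) (M : Type*) [AddCommGroup M] [Module R M] [Module B M]
    [IsScalarTower R B M] [Module.IsTorsionFree R M] : IsSMulRegular M y := by
  obtain ⟨c, hc⟩ := Ideal.mem_span_singleton'.mp
    (hyI ▸ Ideal.mem_map_of_mem _ htI : algebraMap R B t ∈ Ideal.span {y})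
  refine isSMulRegular_of_dvd (b := algebraMap R B t) ⟨c, by rw [← hc, mul_comm]⟩ ?_
  intro v w hvw
  simp only [algebraMap_smul] at hvw
  exact smul_torsionFree_cancel ht hvw

lemma smul_ext_eq_zero_of_projective (hy : y ∈ nonZeroDivisors B)
    (hyI : I.map (algebraMap R B) = Ideal.span {y}) (hz : z ∈ nonZeroDivisors R)
    (hzB : ∀ b : B, ∃ c : R, algebraMap R B c = z • b)
    (M N : Type u) [AddCommGroup M] [Module R M] [Module B M] [IsScalarTower R B M]
    [AddCommGroup N] [Module R N] [Module B N] [IsScalarTower R B N]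
    (hinj : Function.Injective (algebraMap R B))
    (hn : ∀ k ≥ n, ∀ a ∈ I ^ k, ∀ b : B, ∃ a' ∈ I ^ k, algebraMap R B a' = b * algebraMap R B a)
    [Module.Finite R M] [Module.Projective B M] [Module.IsTorsionFree R N] {a : R} (ha : a ∈ I)
    (e : CategoryTheory.Abelian.Ext (ModuleCat.of R M) (ModuleCat.of R N) 1) : a • e = 0 := by
  have hp := minimalCover_surjective (R := R) M
  refine (smul_ext_eq_zero_iff (minimalCover R M) hp a).mpr (fun f => ?_) e
  refine exists_extension hinj hz hzB hp (fun l hl => smul_mem_kerSpan hp (fun f b v => ?_) hl) f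
  obtain ⟨c, hc⟩ := Ideal.mem_span_singleton'.mp
    (hyI ▸ Ideal.mem_map_of_mem _ ha : algebraMap R B a ∈ Ideal.span {y})
  have h1 : algebraMap R B a * b = y * (c * b) := by rw [← hc]; ring
  rw [← algebraMap_smul B a (b • v), ← algebraMap_smul B a (b • f v), ← mul_smul, ← mul_smul, h1]
  exact map_mul_smul_eq hy hyI hn f _ v

lemma projective_of_smul_ext_eq_zero [Module.IsTorsionFree R B] (hy : y ∈ nonZeroDivisors B)
    (hyI : I.map (algebraMap R B) = Ideal.span {y}) (hz : z ∈ nonZeroDivisors R)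
    (hzB : ∀ b : B, ∃ c : R, algebraMap R B c = z • b)
    (M : Type u) [AddCommGroup M] [Module R M] [Module B M] [IsScalarTower R B M]
    [IsLocalRing R] [IsNoetherianRing R] [IsOneDimCM R]
    (hI : I = maximalIdeal R) [Module.Finite R M] [Module.IsTorsionFree R M]
    (h : ∀ a ∈ I, ∀ e : CategoryTheory.Abelian.Ext (ModuleCat.of R M)
      (ModuleCat.of R (kerSpan B (minimalCover R M))) 1, a • e = 0) : Module.Projective B M := by
  have hp := minimalCover_surjective (R := R) M
  obtain ⟨t, htI, ht⟩ := IsOneDimCM.exists_mem (R := R)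
  rw [← hI] at htI
  have hyM := isSMulRegular_of_map_eq_span hyI htI ht M
  refine projective_of_forall_exists_extension hy hyI hyM hz hzB hp
    (fun w hw i => hI ▸ mem_maximalIdeal_of_mem_syzygy M hw i) fun a ha => ?_
  let f : LinearMap.ker (minimalCover R M) →ₗ[R] kerSpan B (minimalCover R M) :=
    LinearMap.codRestrict ((kerSpan B (minimalCover R M)).restrictScalars R)
      (freeMap R B _ ∘ₗ (LinearMap.ker (minimalCover R M)).subtype)
      fun w => freeMap_mem_kerSpan w.2
  obtain ⟨g, hg⟩ := (smul_ext_eq_zero_iff (minimalCover R M) hp a).mp (h a ha) f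
  refine ⟨(kerSpan B (minimalCover R M)).subtype.restrictScalars R ∘ₗ g, fun v => (g v).2,
    fun w hw => ?_⟩
  exact congrArg Subtype.val (hg ⟨w, hw⟩)

end

section

variable {R : Type u} [CommRing R] [IsLocalRing R] [IsNoetherianRing R] [IsOneDimCM R]

lemma projective_ideal_of_smul_ext_eq_zero {B : Type u} [CommRing B] [Algebra R B]
    [Module.Finite R B] [Module.IsTorsionFree R B]
    {y : B} {z : R} (hy : y ∈ nonZeroDivisors B)
    (hyI : (maximalIdeal R).map (algebraMap R B) = Ideal.span {y}) (hz : z ∈ nonZeroDivisors R)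
    (hzB : ∀ b : B, ∃ c : R, algebraMap R B c = z • b)
    (h : ∀ (M N : Type u) [AddCommGroup M] [Module R M] [Module B M] [IsScalarTower R B M]
      [AddCommGroup N] [Module R N] [Module B N] [IsScalarTower R B N] [Module.Finite R M]
      [Module.IsTorsionFree R M] [Module.Finite R N] [Module.IsTorsionFree R N],
      ∀ a ∈ maximalIdeal R, ∀ e : CategoryTheory.Abelian.Ext (ModuleCat.of R M)
      (ModuleCat.of R N) 1, a • e = 0) (n : Ideal B) : Module.Projective B n := by
  have hn0 : IsNoetherian R B := isNoetherian_of_isNoetherianRing_of_finite R _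
  have : Module.IsTorsionFree R n :=
    Function.Injective.moduleIsTorsionFree (n.subtype.restrictScalars R) n.injective_subtype (by simp)
  have : Module.Finite R n := Module.Finite.of_injective (n.subtype.restrictScalars R)
    n.injective_subtype
  have : Module.IsTorsionFree R (kerSpan B (minimalCover R n)) :=
    Function.Injective.moduleIsTorsionFree ((kerSpan B (minimalCover R n)).subtype.restrictScalars R)
      (kerSpan B (minimalCover R n)).injective_subtype (by simp)
  have : Module.Finite R (kerSpan B (minimalCover R n)) := Module.Finite.of_injective
    ((kerSpan B (minimalCover R n)).subtype.restrictScalars R)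
    (kerSpan B (minimalCover R n)).injective_subtype
  exact projective_of_smul_ext_eq_zero hy hyI hz hzB n rfl (h n (kerSpan B (minimalCover R n)))

lemma IsReduction.exists_forall_smul_eq {R : Type u} [CommRing R] {I : Ideal R} {r : ℕ} {x : R} (hx : IsReduction I r x)
    (hI : IsRegularIdeal I) :
    ∃ z ∈ nonZeroDivisors R, ∀ b : blowUp I, ∃ c : R, algebraMap R (blowUp I) c = z • b := by
  obtain ⟨z, hz, hzB⟩ := hx.exists_mem_one_div hI
  refine ⟨z, hz, fun b => ?_⟩
  obtain ⟨c, hc⟩ := Submodule.mem_one.mp (Submodule.mem_div_iff_forall_mul_mem.mp hzB b b.2)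
  refine ⟨c, Subtype.ext (hc.trans ?_)⟩
  rw [← Algebra.smul_def]
  rfl

lemma IsReduction.exists_forall_pow_stable {R : Type u} [CommRing R] {I : Ideal R} {r : ℕ} {x : R} (hx : IsReduction I r x)
    (hI : IsRegularIdeal I) : ∃ n, ∀ k ≥ n, ∀ a ∈ I ^ k, ∀ b : blowUp I,
      ∃ a' ∈ I ^ k, algebraMap R (blowUp I) a' = b * algebraMap R (blowUp I) a := by
  obtain ⟨n, hn⟩ := hx.exists_forall_mul_blowUp hI
  refine ⟨n, fun k hk a ha b => ?_⟩
  have h1 : algebraMap R (FractionRing R) a * b ∈ inQ (I ^ k) := by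
    rw [← (hn k hk).1]
    exact Submodule.mul_mem_mul (mem_inQ.mpr ⟨a, ha, rfl⟩) b.2
  obtain ⟨a', ha', h2⟩ := mem_inQ.mp h1
  exact ⟨a', ha', Subtype.ext (h2.trans (mul_comm _ _))⟩

lemma maxLocPrincipal_of_smul_ext_eq_zero {B : Subalgebra R (FractionRing R)} [Module.Finite R B]
    {y : B} {z : R} (hy : y ∈ nonZeroDivisors B)
    (hyI : (maximalIdeal R).map (algebraMap R B) = Ideal.span {y}) (hz : z ∈ nonZeroDivisors R)
    (hzB : ∀ b : B, ∃ c : R, algebraMap R B c = z • b)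
    (h : ∀ (M N : Type u) [AddCommGroup M] [Module R M] [Module B M] [IsScalarTower R B M]
      [AddCommGroup N] [Module R N] [Module B N] [IsScalarTower R B N] [Module.Finite R M]
      [Module.IsTorsionFree R M] [Module.Finite R N] [Module.IsTorsionFree R N],
      ∀ a ∈ maximalIdeal R, ∀ e : CategoryTheory.Abelian.Ext (ModuleCat.of R M)
      (ModuleCat.of R N) 1, a • e = 0) : MaxLocPrincipal B := by
  refine maxLocPrincipal_of_projective fun n _ => ?_
  exact projective_ideal_of_smul_ext_eq_zero hy hyI hz hzB h n

theorem IsReduction.forall_maximalIdealKillsExt_iff {r : ℕ} {x : R}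
    (hx : IsReduction (maximalIdeal R) r x) :
    (∀ (M N : Type u) [AddCommGroup M] [Module R M] [AddCommGroup N] [Module R N],
      IsUlrich R M → IsUlrich R N → MaximalIdealKillsExt R M N) ↔
      MaxLocPrincipal (blowUp (maximalIdeal R)) := by
  have hI : IsRegularIdeal (maximalIdeal R) := IsOneDimCM.exists_mem
  have hfin := hx.finite_blowUp hI
  obtain ⟨y, hy, hyI⟩ := hx.exists_map_eq_span hI
  obtain ⟨z, hz, hzB⟩ := hx.exists_forall_smul_eq hI
  obtain ⟨n, hn⟩ := hx.exists_forall_pow_stable hI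
  constructor
  · intro h
    refine maxLocPrincipal_of_smul_ext_eq_zero hy hyI hz hzB ?_
    intro M N _ _ _ _ _ _ _ _ _ _ _ _
    exact h M N ((isUlrich_iff M).mpr (hx.isUlrichWrt_of_module hI M))
      ((isUlrich_iff N).mpr (hx.isUlrichWrt_of_module hI N))
  · intro h M N _ _ _ _ hM hN
    rw [isUlrich_iff] at hM hN
    obtain ⟨_, _⟩ := hx.exists_module hI hM
    obtain ⟨_, _⟩ := hx.exists_module hI hN
    obtain ⟨_, _, _⟩ := (isUlrichWrt_iff hx hI M).mp hM
    obtain ⟨_, _, _⟩ := (isUlrichWrt_iff hx hI N).mp hN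
    have := h.projective_of_isTorsionFree M
    intro a ha e
    exact smul_ext_eq_zero_of_projective hy hyI hz hzB M N
      (fun a b hab => IsFractionRing.injective R (FractionRing R) (congrArg Subtype.val hab)) hn ha e

end

end UlrichSplit

namespace UlrichSplit

section Noetherian

open scoped Pointwise

variable {S : Type*} [CommRing S] [IsLocalRing S]

lemma isNoetherianRing_quotient_of_pow_le (hm : (maximalIdeal S).FG) {J : Ideal S} {k : ℕ}
    (hk : maximalIdeal S ^ k ≤ J) : IsNoetherianRing (S ⧸ J) := by
  refine IsNoetherianRing.of_prime fun P hP => ?_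
  have h1 : P.comap (Ideal.Quotient.mk J) = maximalIdeal S := by
    have : (P.comap (Ideal.Quotient.mk J)).IsPrime := hP.comap _
    refine ((maximalIdeal.isMaximal S).eq_of_le this.ne_top (this.le_of_pow_le (n := k) ?_)).symm
    refine hk.trans fun a ha => ?_
    rw [Ideal.mem_comap, Ideal.Quotient.eq_zero_iff_mem.mpr ha]
    exact zero_mem _
  rw [← Ideal.map_comap_of_surjective _ Ideal.Quotient.mk_surjective P, h1]
  exact hm.map _

lemma isNoetherian_of_quotient {S : Type*} [CommRing S] {J : Ideal S} (h : IsNoetherianRing (S ⧸ J)) :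
    IsNoetherian S (S ⧸ J) := by
  refine ⟨fun N => ?_⟩
  let N' : Ideal (S ⧸ J) :=
    { N with
      smul_mem' := fun c v hv => by
        obtain ⟨c, rfl⟩ := Ideal.Quotient.mk_surjective c
        exact N.smul_mem c hv }
  exact Submodule.FG.restrictScalars_of_surjective (S := N') (IsNoetherian.noetherian N')
    Ideal.Quotient.mk_surjective

lemma isPrecomplete_pi {S : Type*} [CommRing S] {I : Ideal S} [IsPrecomplete I S] (k : ℕ) : IsPrecomplete I (Fin k → S) := by
  have hmem : ∀ (n : ℕ) (v : Fin k → S), (∀ i, v i ∈ I ^ n) →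
      v ∈ (I ^ n • ⊤ : Submodule S (Fin k → S)) := by
    intro n v hv
    rw [pi_eq_sum_univ' v]
    exact Submodule.sum_mem _ fun i _ => Submodule.smul_mem_smul (hv i) trivial
  have hmem' : ∀ (n : ℕ) (v : Fin k → S), v ∈ (I ^ n • ⊤ : Submodule S (Fin k → S)) →
      ∀ i, v i ∈ I ^ n := by
    intro n v hv i
    have h1 := Submodule.mem_map_of_mem (f := LinearMap.proj (R := S) i) hv
    rw [Submodule.map_smul''] at h1
    have h2 := Submodule.smul_mono (le_refl (I ^ n)) le_top h1
    rwa [smul_eq_mul, Ideal.mul_top] at h2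
  refine ⟨fun f hf => ?_⟩
  have h1 : ∀ i, ∃ L : S, ∀ n, f n i ≡ L [SMOD (I ^ n • ⊤ : Submodule S S)] := fun i =>
    IsPrecomplete.prec inferInstance fun {m n} hmn => by
      rw [SModEq.sub_mem, smul_eq_mul, Ideal.mul_top]
      exact hmem' m _ (SModEq.sub_mem.mp (hf hmn)) i
  choose L hL using h1
  refine ⟨L, fun n => SModEq.sub_mem.mpr (hmem n _ fun i => ?_)⟩
  have h2 := SModEq.sub_mem.mp (hL i n)
  rwa [smul_eq_mul, Ideal.mul_top] at h2

/-- A complete local ring with finitely generated maximal ideal is Noetherian, if a principal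
ideal is primary to the maximal ideal. -/
theorem isNoetherianRing_of_isAdicComplete [IsAdicComplete (maximalIdeal S) S]
    (hm : (maximalIdeal S).FG) {t : S} (ht : t ∈ maximalIdeal S) {k : ℕ}
    (hk : maximalIdeal S ^ k ≤ Ideal.span {t}) : IsNoetherianRing S := by
  have hN := isNoetherianRing_quotient_of_pow_le hm hk
  have hN' : IsNoetherian S (S ⧸ Ideal.span {t}) :=
    isNoetherian_of_quotient hN
  refine IsNoetherianRing.of_prime fun P hP => ?_
  by_cases htP : t ∈ P
  · rwa [← (maximalIdeal.isMaximal S).eq_of_le hP.ne_top (hP.le_of_pow_le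
      (hk.trans ((Ideal.span_singleton_le_iff_mem _).mpr htP)))]
  let i : (P ⧸ (t • ⊤ : Submodule S P)) →ₗ[S] (S ⧸ Ideal.span {t}) :=
    Submodule.mapQ _ _ P.subtype (by
      rintro _ ⟨v, _, rfl⟩
      exact Ideal.mem_span_singleton'.mpr ⟨v, mul_comm _ _⟩)
  have hi : Function.Injective i := by
    rw [← LinearMap.ker_eq_bot, LinearMap.ker_eq_bot']
    intro v hv
    obtain ⟨v, rfl⟩ := Submodule.Quotient.mk_surjective _ v
    obtain ⟨s, hs⟩ := Ideal.mem_span_singleton'.mp ((Submodule.Quotient.mk_eq_zero _).mp hv)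
    have hsP : s ∈ P := (hP.mem_or_mem (hs ▸ v.2 : s * t ∈ P)).resolve_right htP
    exact (Submodule.Quotient.mk_eq_zero _).mpr
      ⟨⟨s, hsP⟩, trivial, Subtype.ext ((mul_comm t s).trans hs)⟩
  have : Module.Finite S (P ⧸ (t • ⊤ : Submodule S P)) := Module.Finite.of_injective i hi
  obtain ⟨l, f, hf⟩ := Module.Finite.exists_fin' S (P ⧸ (t • ⊤ : Submodule S P))
  obtain ⟨g, hg⟩ := Module.projective_lifting_property (t • ⊤ : Submodule S P).mkQ f
    (Submodule.mkQ_surjective _)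
  have : IsPrecomplete (maximalIdeal S) (Fin l → S) := isPrecomplete_pi l
  have : IsHausdorff (maximalIdeal S) P := ⟨fun v hv => by
    refine Subtype.ext (IsHausdorff.haus (I := maximalIdeal S) inferInstance (v : S) fun n => ?_)
    have h1 := (hv n)
    rw [SModEq.zero] at h1 ⊢
    have h2 := Submodule.mem_map_of_mem (f := P.subtype) h1
    rw [Submodule.map_smul''] at h2
    exact Submodule.smul_mono le_rfl le_top h2⟩
  have hsurj : Function.Surjective g := by
    refine surjective_of_mkQ_comp_surjective (I := maximalIdeal S) fun v => ?_
    obtain ⟨v, rfl⟩ := Submodule.Quotient.mk_surjective _ v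
    obtain ⟨w, hw⟩ := hf (Submodule.Quotient.mk v)
    refine ⟨w, (Submodule.Quotient.eq _).mpr ?_⟩
    rw [← hg] at hw
    have h1 := (Submodule.Quotient.eq _).mp hw
    refine (?_ : (t • ⊤ : Submodule S P) ≤ _) h1
    rintro _ ⟨v, _, rfl⟩
    exact Submodule.smul_mem_smul ht trivial
  have : Module.Finite S P := Module.Finite.of_surjective g hsurj
  exact Module.Finite.iff_fg.mp this

end Noetherian

section Completion

variable {R : Type u} [CommRing R] [IsLocalRing R] [IsNoetherianRing R]

lemma mem_maximalIdeal_pow_completion {n : ℕ} {s : Completion R} :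
    s ∈ maximalIdeal (Completion R) ^ n ↔ AdicCompletion.eval (maximalIdeal R) R n s = 0 := by
  rw [AdicCompletion.maximalIdeal_eq_map, ← Ideal.map_pow, ← LinearMap.mem_ker,
    ← AdicCompletion.pow_smul_top_eq_ker_eval (maximalIdeal R).fg_of_isNoetherianRing,
    Ideal.smul_top_eq_map]
  rfl

lemma algebraMap_mem_maximalIdeal_pow_iff {n : ℕ} {a : R} :
    algebraMap R (Completion R) a ∈ maximalIdeal (Completion R) ^ n ↔ a ∈ maximalIdeal R ^ n := by
  rw [mem_maximalIdeal_pow_completion]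
  change Submodule.Quotient.mk a = 0 ↔ _
  rw [Submodule.Quotient.mk_eq_zero, smul_eq_mul, Ideal.mul_top]

lemma exists_sub_algebraMap_mem (n : ℕ) (s : Completion R) :
    ∃ a : R, s - algebraMap R (Completion R) a ∈ maximalIdeal (Completion R) ^ n := by
  obtain ⟨a, ha⟩ := Submodule.Quotient.mk_surjective _ (AdicCompletion.eval (maximalIdeal R) R n s)
  refine ⟨a, mem_maximalIdeal_pow_completion.mpr ?_⟩
  rw [map_sub, sub_eq_zero, ← ha]
  rfl

lemma algebraMap_completion_mem_nonZeroDivisors {t : R} (ht : t ∈ nonZeroDivisors R) :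
    algebraMap R (Completion R) t ∈ nonZeroDivisors (Completion R) := by
  have h1 : IsSMulRegular R t := fun a b h => by
    rw [← sub_eq_zero]
    refine (mem_nonZeroDivisors_iff.mp ht).1 _ ?_
    rw [mul_sub, sub_eq_zero]
    exact h
  have h2 : IsSMulRegular (Completion R) (algebraMap R (Completion R) t) := h1.of_flat
  refine mem_nonZeroDivisors_iff_right.mpr fun s hs => h2 ?_
  change _ * s = _ * 0
  rw [mul_comm, hs, mul_zero]

lemma IsReduction.completion {r : ℕ} {x : R} (hx : IsReduction (maximalIdeal R) r x) :
    IsReduction (maximalIdeal (Completion R)) r (algebraMap R (Completion R) x) := by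
  obtain ⟨n₀, hn₀⟩ := hx.exists_forall_le
  refine ⟨hx.one_le, algebraMap_mem_maximalIdeal_pow_iff.mpr hx.mem, n₀, fun n hn => ?_⟩
  rw [AdicCompletion.maximalIdeal_eq_map, ← Ideal.map_pow, ← Ideal.map_pow, ← Set.image_singleton,
    ← Ideal.map_span, ← Ideal.map_mul]
  exact Ideal.map_mono (hn₀ n hn)

variable [IsOneDimCM R]

instance : IsNoetherianRing (Completion R) := by
  obtain ⟨t, htm, ht⟩ := IsOneDimCM.exists_mem (R := R)
  obtain ⟨k, hk⟩ := exists_pow_le_span ht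
  refine isNoetherianRing_of_isAdicComplete (t := algebraMap R _ t) (k := k) ?_ ?_ ?_
  · rw [AdicCompletion.maximalIdeal_eq_map]
    exact (maximalIdeal R).fg_of_isNoetherianRing.map _
  · rw [AdicCompletion.maximalIdeal_eq_map]
    exact Ideal.mem_map_of_mem _ htm
  · rw [AdicCompletion.maximalIdeal_eq_map, ← Ideal.map_pow, ← Set.image_singleton, ← Ideal.map_span]
    exact Ideal.map_mono hk

instance : IsOneDimCM (Completion R) := by
  obtain ⟨t, htm, ht⟩ := IsOneDimCM.exists_mem (R := R)
  obtain ⟨k, hk⟩ := exists_pow_le_span ht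
  refine isOneDimCM_of_pow_le (t := algebraMap R _ t) (k := k) ?_
    (algebraMap_completion_mem_nonZeroDivisors ht) ?_
  · rw [AdicCompletion.maximalIdeal_eq_map]
    exact Ideal.mem_map_of_mem _ htm
  · rw [AdicCompletion.maximalIdeal_eq_map, ← Ideal.map_pow, ← Set.image_singleton, ← Ideal.map_span]
    exact Ideal.map_mono hk

end Completion

end UlrichSplit

namespace UlrichSplit

section Square

variable {B C : Type*} [CommRing B] [CommRing C]

/-- A Noetherian version of `MaxLocPrincipal` which depends only on `B` modulo the squares of the
maximal ideals. -/
lemma maxLocPrincipal_iff_le_sup [IsNoetherianRing B] :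
    MaxLocPrincipal B ↔ ∀ n : Ideal B, n.IsMaximal → ∃ a ∈ n, n ≤ Ideal.span {a} ⊔ n ^ 2 := by
  refine forall_congr' fun n => forall_congr' fun hn => ⟨?_, ?_⟩
  · rintro ⟨a, ha, u, hu, h⟩
    refine ⟨a, ha, fun z hz => ?_⟩
    obtain ⟨w, i, hi, hw⟩ := hn.exists_inv hu
    have h1 : z = w * (u * z) + i * z := by linear_combination (-z) * hw
    rw [h1]
    refine Submodule.add_mem_sup (Ideal.mul_mem_left _ _ (Ideal.mem_span_singleton.mpr (h z hz))) ?_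
    rw [pow_two]
    exact Ideal.mul_mem_mul hi hz
  · rintro ⟨a, ha, h⟩
    rw [pow_two] at h
    obtain ⟨u, hu, hun⟩ := Submodule.exists_sub_one_mem_and_smul_le_of_fg_of_le_sup
      (IsNoetherian.noetherian n) le_rfl h
    refine ⟨a, ha, u, fun hun' => hn.ne_top ?_, fun z hz => ?_⟩
    · rw [Ideal.eq_top_iff_one]
      simpa using sub_mem hun' hu
    · exact Ideal.mem_span_singleton.mp (hun ⟨z, hz, rfl⟩)

lemma forall_le_sup_iff_of_surjective {f : B →+* C} (hf : Function.Surjective f)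
    (hker : ∀ n : Ideal B, n.IsMaximal → RingHom.ker f ≤ n ^ 2) :
    (∀ n : Ideal B, n.IsMaximal → ∃ a ∈ n, n ≤ Ideal.span {a} ⊔ n ^ 2) ↔
      ∀ n : Ideal C, n.IsMaximal → ∃ a ∈ n, n ≤ Ideal.span {a} ⊔ n ^ 2 := by
  constructor
  · intro h n hn
    obtain ⟨a, ha, han⟩ := h (n.comap f) (Ideal.comap_isMaximal_of_surjective f hf)
    refine ⟨f a, ha, ?_⟩
    have h1 := Ideal.map_mono (f := f) han
    rwa [Ideal.map_sup, Ideal.map_span, Set.image_singleton, Ideal.map_pow,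
      Ideal.map_comap_of_surjective f hf] at h1
  · intro h n hn
    have hkn : RingHom.ker f ≤ n := (hker n hn).trans (Ideal.pow_le_self two_ne_zero)
    have h1 : (n.map f).comap f = n := by
      rw [Ideal.comap_map_of_surjective' f hf, sup_eq_left.mpr hkn]
    have h2 : (n.map f).IsMaximal := by
      refine (Ideal.map_eq_top_or_isMaximal_of_surjective f hf hn).resolve_left fun h2 => ?_
      rw [h2, Ideal.comap_top] at h1
      exact hn.ne_top h1.symm
    obtain ⟨a, ha, han⟩ := h _ h2
    obtain ⟨a, rfl⟩ := hf a
    refine ⟨a, h1 ▸ Ideal.mem_comap.mpr ha, ?_⟩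
    have h3 : n.map f ≤ (Ideal.span {a} ⊔ n ^ 2).map f := by
      rwa [Ideal.map_sup, Ideal.map_span, Set.image_singleton, Ideal.map_pow]
    refine (Ideal.map_le_iff_le_comap.mp h3).trans ?_
    rw [Ideal.comap_map_of_surjective' f hf]
    exact sup_le le_rfl ((hker n hn).trans le_sup_right)

lemma maxLocPrincipal_iff_of_forall_exists_sub_mem [IsNoetherianRing B] [IsNoetherianRing C]
    (f : B →+* C) {J : Ideal C} (hf : ∀ c, ∃ b, c - f b ∈ J)
    (hB : ∀ n : Ideal B, n.IsMaximal → J.comap f ≤ n ^ 2)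
    (hC : ∀ n : Ideal C, n.IsMaximal → J ≤ n ^ 2) : MaxLocPrincipal C ↔ MaxLocPrincipal B := by
  rw [maxLocPrincipal_iff_le_sup, maxLocPrincipal_iff_le_sup,
    forall_le_sup_iff_of_surjective (f := Ideal.Quotient.mk J) Ideal.Quotient.mk_surjective,
    forall_le_sup_iff_of_surjective (f := (Ideal.Quotient.mk J).comp f)]
  · intro c
    obtain ⟨c, rfl⟩ := Ideal.Quotient.mk_surjective c
    obtain ⟨b, hb⟩ := hf c
    exact ⟨b, (Ideal.Quotient.eq.mpr hb).symm⟩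
  · exact fun n hn => le_trans (fun b hb => (Ideal.Quotient.eq_zero_iff_mem.mp hb : f b ∈ J)) (hB n hn)
  · intro n hn
    rw [Ideal.mk_ker]
    exact hC n hn

end Square

section BlowUp

variable {R : Type u} [CommRing R] {I : Ideal R} {r : ℕ} {x : R}

lemma IsReduction.mem_map_of_smul_eq (hx : IsReduction I r x) (hI : IsRegularIdeal I) {J : Ideal R}
    {j : ℕ} {c : R} (hc : c ∈ J * I ^ (r * j)) {b : blowUp I}
    (hb : x ^ j • (b : FractionRing R) = algebraMap R _ c) :
    b ∈ J.map (algebraMap R (blowUp I)) := by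
  have hxj := pow_mem (hx.mem_nonZeroDivisors hI) j
  obtain ⟨w, hw⟩ := (isUnit_algebraMap_fractionRing hxj).exists_right_inv
  have h1 : ∃ b' ∈ J.map (algebraMap R (blowUp I)),
      x ^ j • (b' : FractionRing R) = algebraMap R _ c := by
    clear hb b
    induction hc using Submodule.mul_induction_on' with
    | mem_mul_mem u hu v hv =>
      have hq : x ^ j • (w * algebraMap R _ v) = algebraMap R _ v := by
        rw [Algebra.smul_def, ← mul_assoc, hw, one_mul]
      let β : blowUp I := ⟨w * algebraMap R _ v,
        hx.mem_blowUp_of_mem hI (j := j) (by rw [hq]; exact mem_inQ.mpr ⟨v, hv, rfl⟩)⟩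
      refine ⟨β * algebraMap R (blowUp I) u,
        Ideal.mul_mem_left _ _ (Ideal.mem_map_of_mem _ hu), ?_⟩
      change x ^ j • (w * algebraMap R _ v * algebraMap R (FractionRing R) u) = _
      rw [← smul_mul_assoc, hq, map_mul, mul_comm]
    | add c _ d _ hc hd =>
      obtain ⟨b, hb, hbc⟩ := hc
      obtain ⟨b', hb', hbd⟩ := hd
      exact ⟨b + b', add_mem hb hb', by rw [Subalgebra.coe_add, smul_add, hbc, hbd, map_add]⟩
  obtain ⟨b', hb', h2⟩ := h1
  have h3 : b = b' := Subtype.ext (smul_fractionRing_cancel hxj (hb.trans h2.symm))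
  rwa [h3]

lemma smul_mem_of_mem_map {J : Ideal R}
    {j : ℕ} (hj : ∀ q : FractionRing R, q ∈ blowUp I ↔ x ^ j • q ∈ inQ (I ^ (r * j))) {b : blowUp I}
    (hb : b ∈ J.map (algebraMap R (blowUp I))) : x ^ j • (b : FractionRing R) ∈ inQ (J * I ^ (r * j)) := by
  have h1 : ∀ c : blowUp I, x ^ j • ((c * b : blowUp I) : FractionRing R) ∈ inQ (J * I ^ (r * j)) := by
    induction hb using Submodule.span_induction with
    | mem b hb =>
      obtain ⟨a, ha, rfl⟩ := hb
      intro c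
      obtain ⟨d, hd, hdc⟩ := mem_inQ.mp ((hj c).mp c.2)
      refine mem_inQ.mpr ⟨a * d, Ideal.mul_mem_mul ha hd, ?_⟩
      rw [map_mul, hdc]
      change _ = x ^ j • ((c : FractionRing R) * algebraMap R (FractionRing R) a)
      rw [← smul_mul_assoc, mul_comm]
    | zero => intro c; rw [mul_zero, ZeroMemClass.coe_zero, smul_zero]; exact zero_mem _
    | add b b' _ _ hb hb' =>
      intro c
      rw [mul_add, Subalgebra.coe_add, smul_add]
      exact add_mem (hb c) (hb' c)
    | smul d b _ hb =>
      intro c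
      rw [smul_eq_mul, ← mul_assoc]
      exact hb (c * d)
  have h2 := h1 1
  rwa [one_mul] at h2

end BlowUp

section Completion

variable {R : Type u} [CommRing R] [IsLocalRing R] [IsNoetherianRing R]

variable (R) in
/-- The map of total rings of fractions induced by the completion. -/
noncomputable def fractionRingMap : FractionRing R →+* FractionRing (Completion R) :=
  IsLocalization.map (M := nonZeroDivisors R) (T := nonZeroDivisors (Completion R))
    (FractionRing (Completion R)) (algebraMap R (Completion R))
    fun _ ht => algebraMap_completion_mem_nonZeroDivisors ht

lemma fractionRingMap_algebraMap (a : R) :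
    fractionRingMap R (algebraMap R (FractionRing R) a) =
      algebraMap (Completion R) (FractionRing (Completion R)) (algebraMap R (Completion R) a) :=
  IsLocalization.map_eq _ _

lemma fractionRingMap_smul (a : R) (q : FractionRing R) :
    fractionRingMap R (a • q) = algebraMap R (Completion R) a • fractionRingMap R q := by
  rw [Algebra.smul_def, Algebra.smul_def, map_mul, fractionRingMap_algebraMap]

variable [IsOneDimCM R] {r : ℕ} {x : R}

lemma IsReduction.fractionRingMap_mem_blowUp (hx : IsReduction (maximalIdeal R) r x)
    {q : FractionRing R} (hq : q ∈ blowUp (maximalIdeal R)) :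
    fractionRingMap R q ∈ blowUp (maximalIdeal (Completion R)) := by
  obtain ⟨j, hj⟩ := hx.exists_forall_mem_blowUp_iff IsOneDimCM.exists_mem
  obtain ⟨a, ha, hab⟩ := mem_inQ.mp ((hj j le_rfl q).mp hq)
  refine hx.completion.mem_blowUp_of_mem IsOneDimCM.exists_mem (j := j) (mem_inQ.mpr
    ⟨algebraMap R _ a, algebraMap_mem_maximalIdeal_pow_iff.mpr ha, ?_⟩)
  rw [← fractionRingMap_algebraMap, hab, ← map_pow, fractionRingMap_smul]

lemma map_pow_two_le_of_isMaximal {R : Type u} [CommRing R] [IsLocalRing R] {B : Subalgebra R (FractionRing R)} [Module.Finite R B]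
    {n : Ideal B} (hn : n.IsMaximal) : (maximalIdeal R ^ 2).map (algebraMap R B) ≤ n ^ 2 := by
  rw [Ideal.map_pow]
  refine Ideal.pow_right_mono (Ideal.map_le_iff_le_comap.mpr fun a ha => ?_) 2
  exact algebraMap_mem_of_isMaximal hn ha

/-- The map of blow-ups induced by the completion. -/
noncomputable def IsReduction.blowUpMap (hx : IsReduction (maximalIdeal R) r x) :
    blowUp (maximalIdeal R) →+* blowUp (maximalIdeal (Completion R)) :=
  ((fractionRingMap R).comp (blowUp (maximalIdeal R)).val.toRingHom).codRestrict _
    fun b => hx.fractionRingMap_mem_blowUp b.2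

lemma IsReduction.coe_blowUpMap (hx : IsReduction (maximalIdeal R) r x)
    (b : blowUp (maximalIdeal R)) :
    (hx.blowUpMap b : FractionRing (Completion R)) = fractionRingMap R b := rfl

lemma IsReduction.exists_sub_blowUpMap_mem (hx : IsReduction (maximalIdeal R) r x) (k : ℕ)
    (β : blowUp (maximalIdeal (Completion R))) :
    ∃ b, β - hx.blowUpMap b ∈ (maximalIdeal (Completion R) ^ k).map
      (algebraMap (Completion R) (blowUp (maximalIdeal (Completion R)))) := by
  have hI : IsRegularIdeal (maximalIdeal R) := IsOneDimCM.exists_mem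
  have hI' : IsRegularIdeal (maximalIdeal (Completion R)) := IsOneDimCM.exists_mem
  obtain ⟨j, hj⟩ := hx.completion.exists_forall_mem_blowUp_iff hI'
  obtain ⟨s, hs, hsβ⟩ := mem_inQ.mp ((hj j le_rfl β).mp β.2)
  obtain ⟨a, ha⟩ := exists_sub_algebraMap_mem (k + r * j) s
  have ham : a ∈ maximalIdeal R ^ (r * j) := by
    rw [← algebraMap_mem_maximalIdeal_pow_iff]
    have h1 := sub_mem hs (Ideal.pow_le_pow_right (by omega : r * j ≤ k + r * j) ha)
    rwa [sub_sub_cancel] at h1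
  obtain ⟨w, hw⟩ := (isUnit_algebraMap_fractionRing
      (pow_mem (hx.mem_nonZeroDivisors hI) j)).exists_right_inv
  have hq : x ^ j • (w * algebraMap R _ a) = algebraMap R _ a := by
    rw [Algebra.smul_def, ← mul_assoc, hw, one_mul]
  refine ⟨⟨w * algebraMap R _ a, hx.mem_blowUp_of_mem hI (j := j)
    (by rw [hq]; exact mem_inQ.mpr ⟨a, ham, rfl⟩)⟩, ?_⟩
  rw [pow_add] at ha
  refine hx.completion.mem_map_of_smul_eq hI' ha ?_
  rw [Subalgebra.coe_sub, smul_sub, hx.coe_blowUpMap, ← hsβ, map_sub, ← map_pow,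
    ← fractionRingMap_smul, hq, fractionRingMap_algebraMap]

lemma IsReduction.mem_map_of_blowUpMap_mem (hx : IsReduction (maximalIdeal R) r x) {k : ℕ}
    {b : blowUp (maximalIdeal R)} (hb : hx.blowUpMap b ∈ (maximalIdeal (Completion R) ^ k).map
      (algebraMap (Completion R) (blowUp (maximalIdeal (Completion R))))) :
    b ∈ (maximalIdeal R ^ k).map (algebraMap R (blowUp (maximalIdeal R))) := by
  have hI : IsRegularIdeal (maximalIdeal R) := IsOneDimCM.exists_mem
  have hI' : IsRegularIdeal (maximalIdeal (Completion R)) := IsOneDimCM.exists_mem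
  obtain ⟨j₁, hj₁⟩ := hx.exists_forall_mem_blowUp_iff hI
  obtain ⟨j₂, hj₂⟩ := hx.completion.exists_forall_mem_blowUp_iff hI'
  obtain ⟨s, hs, hsb⟩ := mem_inQ.mp (smul_mem_of_mem_map (hj₂ (max j₁ j₂) (le_max_right _ _)) hb)
  obtain ⟨a, ha, hab⟩ := mem_inQ.mp ((hj₁ (max j₁ j₂) (le_max_left _ _) b).mp b.2)
  refine hx.mem_map_of_smul_eq hI (c := a) ?_ hab.symm
  rw [hx.coe_blowUpMap, ← map_pow, ← fractionRingMap_smul, ← hab, fractionRingMap_algebraMap] at hsb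
  have h1 := IsFractionRing.injective (Completion R) (FractionRing (Completion R)) hsb
  rw [← pow_add] at hs ⊢
  rwa [← algebraMap_mem_maximalIdeal_pow_iff, ← h1]

theorem IsReduction.maxLocPrincipal_completion_iff (hx : IsReduction (maximalIdeal R) r x) :
    MaxLocPrincipal (blowUp (maximalIdeal (Completion R))) ↔
      MaxLocPrincipal (blowUp (maximalIdeal R)) := by
  have := hx.finite_blowUp IsOneDimCM.exists_mem
  have := hx.completion.finite_blowUp IsOneDimCM.exists_mem
  have : IsNoetherianRing (blowUp (maximalIdeal R)) := isNoetherianRing_subalgebra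
  have : IsNoetherianRing (blowUp (maximalIdeal (Completion R))) := isNoetherianRing_subalgebra
  exact maxLocPrincipal_iff_of_forall_exists_sub_mem hx.blowUpMap (hx.exists_sub_blowUpMap_mem 2)
    (fun n hn => le_trans (fun b hb => hx.mem_map_of_blowUpMap_mem hb)
      (map_pow_two_le_of_isMaximal hn)) fun n hn => map_pow_two_le_of_isMaximal hn

theorem IsReduction.isUlrichSplit_completion_iff (hx : IsReduction (maximalIdeal R) r x) :
    IsUlrichSplit (Completion R) ↔ MaxLocPrincipal (blowUp (maximalIdeal R)) := by
  rw [← hx.maxLocPrincipal_completion_iff,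
    ← hx.completion.ulrichSequencesSplit_iff IsOneDimCM.exists_mem, IsUlrichSplit,
    UlrichSequencesSplit]
  simp only [isUlrich_iff]

end Completion

end UlrichSplit

namespace UlrichSplit

section

open scoped Pointwise

variable {R : Type u} [CommRing R] [IsLocalRing R] [IsNoetherianRing R] [IsOneDimCM R] {r : ℕ} {x : R}

lemma isRegularIdeal_maximalIdeal {R : Type u} [CommRing R] [IsLocalRing R] [IsOneDimCM R] :
    IsRegularIdeal (maximalIdeal R) := IsOneDimCM.exists_mem

/-- If `R` has minimal multiplicity then its maximal ideal is an Ulrich module. -/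
lemma IsReduction.isUlrich_maximalIdeal (hx : IsReduction (maximalIdeal R) r x)
    (h : HasMinimalMultiplicity R) : IsUlrichWrt (maximalIdeal R) (maximalIdeal R) := by
  have hI := isRegularIdeal_maximalIdeal (R := R)
  obtain ⟨d, e, hd, he, hde⟩ := h
  rw [IsOneDimCM.ringKrullDim_eq] at hd
  have hd1 : d = 1 := by exact_mod_cast hd.symm
  obtain rfl : mu R (maximalIdeal R) = e := by omega
  rw [hasMultiplicity_iff hx hI] at he
  refine (isUlrichWrt_iff hx hI _).mpr ⟨inferInstance, inferInstance, ?_⟩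
  rw [← smul_length_eq_iff hx hI, ← mu_eq_length, ← he, ← relLength_top, ← relLength_top]
  have h1 := relLength_smul_self_eq (P := ⊤) (N := maximalIdeal R)
    (isSMulRegular_of_mem_nonZeroDivisors (hx.mem_nonZeroDivisors hI) R) le_top
    (by simpa using relLength_pow_ne_top hI (⊤ : Submodule R R) 0 1)
  rw [← h1, ← relLength_map (maximalIdeal R).subtype (maximalIdeal R).injective_subtype]
  congr 1
  · simp
  · ext v
    simp [Submodule.mem_smul_pointwise_iff_exists]

lemma IsReduction.mul_mem_of_isUlrichWrt (hx : IsReduction (maximalIdeal R) r x)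
    (h : IsUlrichWrt (maximalIdeal R) (maximalIdeal R)) {b : FractionRing R}
    (hb : b ∈ blowUp (maximalIdeal R)) {a : R} (ha : a ∈ maximalIdeal R) :
    ∃ c ∈ maximalIdeal R, algebraMap R (FractionRing R) c = b * algebraMap R _ a := by
  obtain ⟨_, _⟩ := hx.exists_module isRegularIdeal_maximalIdeal h
  let v : maximalIdeal R := (⟨b, hb⟩ : blowUp (maximalIdeal R)) • ⟨a, ha⟩
  refine ⟨v, v.2, ?_⟩
  obtain ⟨z, hz, c, hc⟩ := exists_smul_eq_algebraMap b
  refine smul_fractionRing_cancel hz ?_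
  have hc' : z • (⟨b, hb⟩ : blowUp (maximalIdeal R)) = algebraMap R _ c := Subtype.ext hc
  have h1 : z • v = c • ⟨a, ha⟩ := by
    rw [← smul_assoc, hc', algebraMap_smul]
  rw [← smul_mul_assoc, hc, ← map_mul, Algebra.smul_def, ← map_mul]
  exact congrArg (fun w : maximalIdeal R => algebraMap R (FractionRing R) w) h1

lemma isRegularLocalRing_of_blowUp_le (hx : IsReduction (maximalIdeal R) r x)
    (h : ∀ b ∈ blowUp (maximalIdeal R), ∃ a, algebraMap R (FractionRing R) a = b) :
    IsRegularLocalRing R := by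
  obtain ⟨y, hy, hym⟩ := hx.exists_map_eq_span isRegularIdeal_maximalIdeal
  obtain ⟨a, ha⟩ := h y y.2
  have hm : maximalIdeal R = Ideal.span {a} := by
    refine le_antisymm (fun c hc => ?_) ?_
    · obtain ⟨b, hb⟩ := Ideal.mem_span_singleton'.mp (hym ▸ Ideal.mem_map_of_mem _ hc :
        algebraMap R (blowUp (maximalIdeal R)) c ∈ Ideal.span {y})
      obtain ⟨d, hd⟩ := h b b.2
      refine Ideal.mem_span_singleton'.mpr ⟨d, IsFractionRing.injective R (FractionRing R) ?_⟩
      rw [map_mul, hd, ha]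
      exact congrArg Subtype.val hb
    · rw [Ideal.span_singleton_le_iff_mem]
      by_contra ha'
      rw [mem_maximalIdeal, mem_nonunits_iff, not_not] at ha'
      have := hx.finite_blowUp isRegularIdeal_maximalIdeal
      obtain ⟨n, hn⟩ := Ideal.exists_maximal (blowUp (maximalIdeal R))
      have h1 : (maximalIdeal R).map (algebraMap R (blowUp (maximalIdeal R))) ≤ n :=
        Ideal.map_le_iff_le_comap.mpr fun c hc => algebraMap_mem_of_isMaximal hn hc
      rw [hym, Ideal.span_singleton_le_iff_mem] at h1
      have h2 : algebraMap R (blowUp (maximalIdeal R)) a = y := Subtype.ext ha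
      exact hn.ne_top (Ideal.eq_top_of_isUnit_mem _ h1 (h2 ▸ ha'.map _))
  refine IsRegularLocalRing.of_spanFinrank_maximalIdeal_le R ?_
  rw [IsOneDimCM.ringKrullDim_eq, hm]
  have h1 := Submodule.spanFinrank_span_le_ncard_of_finite (R := R) (Set.finite_singleton a)
  rw [Set.ncard_singleton] at h1
  exact_mod_cast h1

lemma IsReduction.conductorIdeal_eq (hx : IsReduction (maximalIdeal R) r x)
    (hR : ¬ IsRegularLocalRing R) (hU : IsUlrichWrt (maximalIdeal R) (maximalIdeal R))
    (h : MaxLocPrincipal (blowUp (maximalIdeal R))) : conductorIdeal R = maximalIdeal R := by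
  have := hx.finite_blowUp isRegularIdeal_maximalIdeal
  have hle : integralClosure R (FractionRing R) ≤ blowUp (maximalIdeal R) := h.integralClosure_le
  refine le_antisymm (le_maximalIdeal fun hc => hR ?_) fun a ha => ?_
  · refine isRegularLocalRing_of_blowUp_le hx fun b hb => ?_
    have h1 : (1 : R) ∈ conductorIdeal R := hc ▸ trivial
    have h2 := Submodule.mem_div_iff_forall_mul_mem.mp (Submodule.mem_comap.mp h1) b
      (le_integralClosure _ hb)
    rw [Algebra.linearMap_apply, map_one, one_mul] at h2
    exact Submodule.mem_one.mp h2
  · refine Submodule.mem_comap.mpr (Submodule.mem_div_iff_forall_mul_mem.mpr fun q hq => ?_)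
    obtain ⟨c, -, hc⟩ := hx.mul_mem_of_isUlrichWrt hU (hle hq) ha
    exact Submodule.mem_one.mpr ⟨c, by rw [hc, Algebra.linearMap_apply, mul_comm]⟩

/-- The conductor is an ideal of the integral closure. -/
lemma exists_mem_conductorIdeal {R : Type u} [CommRing R] {q : FractionRing R}
    (hq : q ∈ integralClosure R (FractionRing R)) {a : R} (ha : a ∈ conductorIdeal R) :
    ∃ c ∈ conductorIdeal R, algebraMap R (FractionRing R) c = q * algebraMap R _ a := by
  have h1 := Submodule.mem_div_iff_forall_mul_mem.mp (Submodule.mem_comap.mp ha)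
  obtain ⟨c, hc⟩ := Submodule.mem_one.mp (h1 q hq)
  refine ⟨c, Submodule.mem_comap.mpr (Submodule.mem_div_iff_forall_mul_mem.mpr fun p hp => ?_), ?_⟩
  · rw [Algebra.linearMap_apply, hc, mul_assoc]
    exact h1 _ (Subalgebra.mul_mem _ hq hp)
  · rw [hc, mul_comm, Algebra.linearMap_apply]

lemma IsReduction.maxLocPrincipal_of_linearEquiv (hx : IsReduction (maximalIdeal R) r x)
    (e : maximalIdeal R ≃ₗ[R] conductorIdeal R) : MaxLocPrincipal (blowUp (maximalIdeal R)) := by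
  have := hx.finite_blowUp isRegularIdeal_maximalIdeal
  obtain ⟨t, htm, ht⟩ := isRegularIdeal_maximalIdeal (R := R)
  obtain ⟨q, hq⟩ := exists_forall_eq_mul (Algebra.linearMap R (FractionRing R) ∘ₗ (maximalIdeal R).subtype)
    ((IsFractionRing.injective R (FractionRing R)).comp (maximalIdeal R).injective_subtype)
    (x₀ := ⟨t, htm⟩) (isUnit_algebraMap_fractionRing ht)
    (Algebra.linearMap R (FractionRing R) ∘ₗ (conductorIdeal R).subtype ∘ₗ e.toLinearMap)
  replace hq : ∀ v : maximalIdeal R, algebraMap R (FractionRing R) (e v) = q * algebraMap R _ (v : R) := hq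
  have hq0 : ∀ k, q * k = 0 → k = 0 := by
    intro k hk
    obtain ⟨z, hz, a, ha⟩ := exists_smul_eq_algebraMap k
    have h1 : e ⟨t * a, Ideal.mul_mem_right _ _ htm⟩ = 0 := by
      refine Subtype.ext (IsFractionRing.injective R (FractionRing R) ?_)
      rw [hq, map_mul, ← ha, Algebra.smul_def, ZeroMemClass.coe_zero, map_zero]
      linear_combination algebraMap R (FractionRing R) t * algebraMap R _ z * hk
    rw [LinearEquiv.map_eq_zero_iff] at h1
    have h2 : a = 0 := (mem_nonZeroDivisors_iff.mp ht).1 _ (congrArg Subtype.val h1)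
    refine smul_fractionRing_cancel hz ?_
    rw [ha, h2, map_zero, smul_zero]
  refine maxLocPrincipal_of_integralClosure_le fun p hp => ?_
  refine mem_blowUp.mpr ⟨1, le_rfl, ?_⟩
  rw [pow_one, Submodule.mem_div_iff_forall_mul_mem]
  intro k hk
  obtain ⟨a, ha, rfl⟩ := mem_inQ.mp hk
  obtain ⟨c, hc, hca⟩ := exists_mem_conductorIdeal hp (e ⟨a, ha⟩).2
  refine mem_inQ.mpr ⟨e.symm ⟨c, hc⟩, (e.symm ⟨c, hc⟩).2, ?_⟩
  rw [← sub_eq_zero]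
  refine hq0 _ ?_
  rw [mul_sub, ← hq, LinearEquiv.apply_symm_apply, hca, hq]
  ring

end

end UlrichSplit

namespace UlrichSplit

section Syzygy

variable {R : Type u} [CommRing R] [IsLocalRing R] [IsNoetherianRing R] [IsOneDimCM R] {r : ℕ} {x : R}

lemma IsReduction.isUlrichWrt_syzygy (hx : IsReduction (maximalIdeal R) r x)
    (hU : IsUlrichWrt (maximalIdeal R) (maximalIdeal R)) (M : Type u) [AddCommGroup M] [Module R M]
    [Module.Finite R M] [Module.IsTorsionFree R M] :
    IsUlrichWrt (maximalIdeal R) (syzygy R M) := by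
  obtain ⟨_, _⟩ := exists_module_of_forall (B := blowUp (maximalIdeal R)) (M := syzygy R M)
    fun b v => by
      choose w hwm hw using fun i => hx.mul_mem_of_isUlrichWrt hU b.2
        (mem_maximalIdeal_of_mem_syzygy M v.2 i)
      obtain ⟨z, hz, a, ha⟩ := IsBirational.exists_smul_eq (R := R) b
      have h1 : z • w = a • (v : Fin (mu R M) → R) := by
        ext i
        refine IsFractionRing.injective R (FractionRing R) ?_
        rw [Pi.smul_apply, Pi.smul_apply, smul_eq_mul, smul_eq_mul, map_mul, map_mul, hw, ← mul_assoc,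
          ← Algebra.smul_def]
        exact congrArg (· * _) (congrArg Subtype.val ha)
      refine ⟨⟨w, smul_torsionFree_cancel hz ?_⟩, z, hz, a, ha, Subtype.ext h1⟩
      rw [← map_smul, h1, map_smul, v.2, smul_zero, smul_zero]
  exact hx.isUlrichWrt_of_module isRegularIdeal_maximalIdeal (syzygy R M)

lemma IsReduction.maximalIdealKillsExt_conductorIdeal (hx : IsReduction (maximalIdeal R) r x)
    (hR : ¬ IsRegularLocalRing R) (hU : IsUlrichWrt (maximalIdeal R) (maximalIdeal R))
    (h : MaxLocPrincipal (blowUp (maximalIdeal R))) :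
    MaximalIdealKillsExt R (conductorIdeal R) (syzygy R (conductorIdeal R)) := by
  refine hx.forall_maximalIdealKillsExt_iff.mpr h _ _ ((isUlrich_iff _).mpr ?_)
    ((isUlrich_iff _).mpr (hx.isUlrichWrt_syzygy hU _))
  rw [hx.conductorIdeal_eq hR hU h]
  exact hU

lemma IsReduction.isReduced_of_maxLocPrincipal {I : Ideal R} (hx : IsReduction I r x)
    (hI : IsRegularIdeal I) (h : MaxLocPrincipal (blowUp I)) : IsReduced R := by
  have := hx.finite_blowUp hI
  obtain ⟨t, htm, ht⟩ := isRegularIdeal_maximalIdeal (R := R)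
  obtain ⟨z, hz, hzB⟩ := hx.exists_forall_smul_eq hI
  refine ⟨fun ν hν => ?_⟩
  have h1 : z * ν ∈ ⨅ k : ℕ, maximalIdeal R ^ k := by
    rw [Submodule.mem_iInf]
    intro k
    obtain ⟨w, hw⟩ := (isUnit_algebraMap_fractionRing (pow_mem ht k)).exists_right_inv
    have hint : IsIntegral R (w * algebraMap R (FractionRing R) ν) := by
      obtain ⟨n, hn⟩ := hν
      refine IsIntegral.of_pow (n := n + 1) n.succ_pos ?_
      rw [mul_pow, ← map_pow, pow_succ ν, hn, zero_mul, map_zero, mul_zero]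
      exact isIntegral_zero
    obtain ⟨c, hc⟩ := hzB ⟨_, h.integralClosure_le hint⟩
    have hc' : algebraMap R (FractionRing R) c = z • (w * algebraMap R _ ν) :=
      congrArg Subtype.val hc
    have h2 : z * ν = t ^ k * c := by
      refine IsFractionRing.injective R (FractionRing R) ?_
      rw [map_mul, map_mul, hc', Algebra.smul_def]
      linear_combination (-algebraMap R (FractionRing R) z * algebraMap R _ ν) * hw
    rw [h2]
    exact Ideal.mul_mem_right _ _ (Ideal.pow_mem_pow htm k)
  rw [Ideal.iInf_pow_eq_bot_of_isLocalRing _ Ideal.IsPrime.ne_top', Ideal.mem_bot] at h1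
  exact (mem_nonZeroDivisors_iff.mp hz).1 _ h1

lemma IsReduction.isAnalyticallyUnramified (hx : IsReduction (maximalIdeal R) r x)
    (h : MaxLocPrincipal (blowUp (maximalIdeal R))) : IsAnalyticallyUnramified R :=
  hx.completion.isReduced_of_maxLocPrincipal isRegularIdeal_maximalIdeal
    (hx.maxLocPrincipal_completion_iff.mpr h)

end Syzygy

section Reduced

variable {S : Type u} [CommRing S] [IsLocalRing S] [IsOneDimCM S] [IsReduced S]

lemma exists_notMem_mul_eq_zero {S : Type*} [CommRing S] [IsReduced S] {P : Ideal S}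
    (hP : P ∈ minimalPrimes S) {e : S} (he : e ∈ P) : ∃ u ∉ P, u * e = 0 := by
  have : P.IsPrime := hP.1.1
  have := Ring.KrullDimLE.of_isLocalization P hP (Localization.AtPrime P)
  have h1 : IsNilpotent (algebraMap S (Localization.AtPrime P) e) := by
    rw [Ring.KrullDimLE.isNilpotent_iff_mem_maximalIdeal]
    exact (IsLocalization.AtPrime.to_map_mem_maximal_iff _ P e).mpr he
  obtain ⟨n, hn⟩ := h1
  rw [← map_pow, IsLocalization.map_eq_zero_iff P.primeCompl] at hn
  obtain ⟨u, hu⟩ := hn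
  refine ⟨u, u.2, IsReduced.eq_zero _ ⟨n + 1, ?_⟩⟩
  rw [mul_pow, pow_succ, pow_succ e]
  linear_combination (u : S) ^ n * e * hu

lemma exists_pow_eq_mul_add {t : S} (ht : t ∈ maximalIdeal S) (e : S) :
    ∃ (k : ℕ) (f g : S), t ^ k = e * f + g ∧ e * g = 0 := by
  have hdim : Ring.KrullDimLE 1 S := Ring.krullDimLE_iff.mpr (IsOneDimCM.ringKrullDim_eq (R := S)).le
  have h1 : t ∈ (Ideal.span {e} ⊔ LinearMap.ker (LinearMap.mulLeft S e)).radical := by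
    rw [Ideal.radical_eq_sInf, Submodule.mem_sInf]
    rintro P ⟨hP, hPp⟩
    obtain hmin | hmax := Ring.krullDimLE_one_iff.mp hdim P hPp
    · exfalso
      obtain ⟨u, hu, hue⟩ := exists_notMem_mul_eq_zero hmin
        (hP (Ideal.mem_sup_left (Ideal.mem_span_singleton_self e)))
      refine hu (hP (Ideal.mem_sup_right ?_))
      rw [LinearMap.mem_ker, LinearMap.mulLeft_apply, mul_comm, hue]
    · rwa [IsLocalRing.eq_maximalIdeal hmax]
  obtain ⟨k, hk⟩ := h1
  obtain ⟨a, ha, g, hg, h2⟩ := Submodule.mem_sup.mp hk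
  obtain ⟨f, rfl⟩ := Ideal.mem_span_singleton'.mp ha
  exact ⟨k, f, g, by rw [← h2, mul_comm e f], hg⟩

lemma eq_zero_of_forall_isIntegral {t : S} (htm : t ∈ maximalIdeal S) (ht : t ∈ nonZeroDivisors S)
    {e : S} (he : ∀ k : ℕ, ∃ q : FractionRing S, IsIntegral S q ∧
      t ^ (k + 1) • q = algebraMap S (FractionRing S) e) : e = 0 := by
  obtain ⟨k, f, g, htk, hg⟩ := exists_pow_eq_mul_add htm e
  obtain ⟨q, hq, hqe⟩ := he k
  set θ := q * algebraMap S (FractionRing S) f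
  have hθ : IsIntegral S θ := hq.mul isIntegral_algebraMap
  set ε := t • θ
  have h1 : t ^ k • ε = algebraMap S (FractionRing S) (e * f) := by
    rw [smul_smul, ← pow_succ, ← smul_mul_assoc, hqe, map_mul]
  have h2 : ε * ε = ε := by
    refine smul_fractionRing_cancel (pow_mem ht k) (smul_fractionRing_cancel (pow_mem ht k) ?_)
    rw [← mul_smul_comm, ← smul_mul_assoc, h1, ← map_mul, Algebra.smul_def (t ^ k), ← map_mul]
    congr 1
    rw [htk]
    linear_combination (-f) * hg
  set N := (Subalgebra.toSubmodule (Algebra.adjoin S {θ})).map (LinearMap.mulLeft S ε)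
  have hN : N = ⊥ := by
    refine Submodule.eq_bot_of_le_smul_of_le_jacobson_bot (maximalIdeal S) N
      (Submodule.FG.map _ (hθ.fg_adjoin_singleton)) ?_ (IsLocalRing.maximalIdeal_le_jacobson _)
    rintro _ ⟨p, hp, rfl⟩
    have h3 : ε * p = t • (ε * (θ * p)) := by
      rw [← mul_smul_comm, ← smul_mul_assoc, ← mul_assoc, h2]
    rw [LinearMap.mulLeft_apply, h3]
    exact Submodule.smul_mem_smul htm ⟨θ * p, Subalgebra.mul_mem _
      (Algebra.self_mem_adjoin_singleton S θ) hp, rfl⟩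
  have h3 : ε = 0 := by
    have h4 : ε ∈ N := ⟨1, Subalgebra.one_mem _, mul_one ε⟩
    rwa [hN, Submodule.mem_bot] at h4
  rw [h3, smul_zero, eq_comm, ← map_zero (algebraMap S (FractionRing S))] at h1
  have h4 := IsFractionRing.injective S (FractionRing S) h1
  rw [h4, zero_add] at htk
  rw [← htk, mul_comm] at hg
  exact (mem_nonZeroDivisors_iff.mp (pow_mem ht k)).1 _ hg

end Reduced

end UlrichSplit

namespace UlrichSplit

section Chevalley

variable {R : Type u} [CommRing R]

/-- The ideal of all `a` in `R` such that `a / t ^ n` is integral over `R`. -/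
def integralDivIdeal (t : R) (n : ℕ) : Ideal R :=
  Submodule.comap (Algebra.linearMap R (FractionRing R))
    ((Subalgebra.toSubmodule (integralClosure R (FractionRing R))).map
      (LinearMap.lsmul R (FractionRing R) (t ^ n)))

lemma mem_integralDivIdeal {t : R} {n : ℕ} {a : R} : a ∈ integralDivIdeal t n ↔
    ∃ q : FractionRing R, IsIntegral R q ∧ t ^ n • q = algebraMap R _ a := Iff.rfl

lemma integralDivIdeal_antitone (t : R) : Antitone (integralDivIdeal t) := by
  intro m n hmn a ha
  obtain ⟨q, hq, h⟩ := mem_integralDivIdeal.mp ha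
  refine mem_integralDivIdeal.mpr ⟨t ^ (n - m) • q, hq.smul _, ?_⟩
  rw [smul_smul, ← pow_add, Nat.add_sub_cancel' hmn, h]

variable [IsLocalRing R] [IsNoetherianRing R] [IsOneDimCM R]

lemma isArtinian_quotient_span {s : R} (hs : s ∈ nonZeroDivisors R) :
    IsArtinian R (R ⧸ Ideal.span {s}) := by
  have h1 : Module.length R (R ⧸ Ideal.span {s}) ≠ ⊤ := by
    refine length_ne_top_of_smul_eq_zero hs fun v => ?_
    obtain ⟨c, rfl⟩ := Submodule.Quotient.mk_surjective _ v
    exact (Submodule.Quotient.mk_eq_zero _).mpr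
      (Ideal.mul_mem_right c _ (Ideal.mem_span_singleton_self s))
  exact (isFiniteLength_iff_isNoetherian_isArtinian.mp (Module.length_ne_top_iff.mp h1)).2

lemma exists_forall_sup_span_le {A : ℕ → Ideal R} (hA : Antitone A) {s : R}
    (hs : s ∈ nonZeroDivisors R) : ∃ N, ∀ n, A N ≤ A n ⊔ Ideal.span {s} := by
  have := isArtinian_quotient_span hs
  obtain ⟨N, hN⟩ := IsArtinian.monotone_stabilizes (R := R) (M := R ⧸ Ideal.span {s})
    ⟨fun n => OrderDual.toDual (Submodule.map (Submodule.mkQ (Ideal.span {s})) (A n)),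
      fun m n hmn => Submodule.map_mono (hA hmn)⟩
  refine ⟨N, fun n => ?_⟩
  obtain h | h := le_total n N
  · exact (hA h).trans le_sup_left
  · have h1 : Submodule.map (Submodule.mkQ (Ideal.span {s})) (A N) =
      Submodule.map (Submodule.mkQ (Ideal.span {s})) (A n) := hN n h
    have h2 := Submodule.map_le_iff_le_comap.mp h1.le
    rwa [Submodule.comap_map_mkQ, sup_comm] at h2

/-- A version of Chevalley's theorem: the limit of a coherent sequence in the completion. -/
lemma exists_completion_of_not_le {A : ℕ → Ideal R} (hA : Antitone A) {t : R}
    (htm : t ∈ maximalIdeal R) (ht : t ∈ nonZeroDivisors R) (h : ∀ n, ¬ A n ≤ Ideal.span {t}) :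
    ∃ e : Completion R, e ≠ 0 ∧ ∀ k, ∃ a ∈ A (k + 1), ∃ s : Completion R,
      e = algebraMap R _ a + algebraMap R _ t ^ (k + 1) * s := by
  have hstep : ∀ k a, (∀ n, a ∈ A n ⊔ Ideal.span {t ^ (k + 1)}) →
      ∃ a', (∀ n, a' ∈ A n ⊔ Ideal.span {t ^ (k + 2)}) ∧ a' - a ∈ Ideal.span {t ^ (k + 1)} := by
    intro k a ha
    obtain ⟨N, hN⟩ := exists_forall_sup_span_le hA (pow_mem ht (k + 2))
    obtain ⟨a', ha', v, hv, rfl⟩ := Submodule.mem_sup.mp (ha N)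
    exact ⟨a', fun n => hN n ha', by simpa using hv⟩
  obtain ⟨N, hN⟩ := exists_forall_sup_span_le hA (pow_mem ht 1)
  obtain ⟨a₀, ha₀, ha₀t⟩ := Set.not_subset.mp (h N)
  choose! F hF hF' using hstep
  let a : ℕ → R := fun k => Nat.rec a₀ F k
  have ha : ∀ k n, a k ∈ A n ⊔ Ideal.span {t ^ (k + 1)} := by
    intro k
    induction k with
    | zero => exact fun n => hN n ha₀
    | succ k ih => exact hF k _ ih
  have hsub : ∀ k l, a (k + l) - a k ∈ Ideal.span {t ^ (k + 1)} := by
    intro k l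
    induction l with
    | zero => simp
    | succ l ih =>
      have h1 := hF' (k + l) _ (ha (k + l))
      have h2 : Ideal.span {t ^ (k + l + 1)} ≤ Ideal.span {t ^ (k + 1)} :=
        Ideal.span_singleton_le_span_singleton.mpr (pow_dvd_pow t (by omega))
      have h3 := add_mem (h2 h1) ih
      rwa [sub_add_sub_cancel] at h3
  have htpow : ∀ k : ℕ, Ideal.span {t ^ k} ≤ maximalIdeal R ^ k := fun k =>
    (Ideal.span_singleton_le_iff_mem _).mpr (Ideal.pow_mem_pow htm k)
  obtain ⟨e, he⟩ := IsPrecomplete.prec (I := maximalIdeal (Completion R)) (M := Completion R)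
    inferInstance (f := fun k => algebraMap R (Completion R) (a k)) (fun {m n} hmn => by
      obtain ⟨l, rfl⟩ := Nat.exists_eq_add_of_le hmn
      rw [SModEq.comm, SModEq.sub_mem, smul_eq_mul, Ideal.mul_top, ← map_sub,
        algebraMap_mem_maximalIdeal_pow_iff]
      exact Ideal.pow_le_pow_right (Nat.le_succ m) (htpow (m + 1) (hsub m l)))
  have hlim : ∀ k, ∃ s, e = algebraMap R _ (a k) + algebraMap R _ t ^ (k + 1) * s := by
    intro k
    obtain ⟨l, hl⟩ := exists_pow_le_span (R := Completion R)
      (pow_mem (algebraMap_completion_mem_nonZeroDivisors ht) (k + 1))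
    have h1 := he (k + l)
    rw [SModEq.comm, SModEq.sub_mem, smul_eq_mul, Ideal.mul_top] at h1
    obtain ⟨s, hs⟩ := Ideal.mem_span_singleton'.mp
      (hl (Ideal.pow_le_pow_right (Nat.le_add_left l k) h1))
    obtain ⟨c, hc⟩ := Ideal.mem_span_singleton'.mp (hsub k l)
    refine ⟨s + algebraMap R _ c, ?_⟩
    have hc' := congrArg (algebraMap R (Completion R)) hc
    rw [map_mul, map_pow, map_sub] at hc'
    linear_combination -hs - hc'
  refine ⟨e, ?_, fun k => ?_⟩
  · rintro rfl
    obtain ⟨s, hs⟩ := hlim 0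
    obtain ⟨n, hn⟩ := exists_pow_le_span ht
    obtain ⟨c, hc⟩ := exists_sub_algebraMap_mem n s
    have h1 : a₀ + t * c ∈ Ideal.span {t} := by
      refine hn (algebraMap_mem_maximalIdeal_pow_iff.mp ?_)
      have h2 : algebraMap R (Completion R) (a₀ + t * c) =
          -(algebraMap R _ t * (s - algebraMap R _ c)) := by
        rw [map_add, map_mul]
        have hs' : (0 : Completion R) = algebraMap R _ a₀ + algebraMap R _ t ^ (0 + 1) * s := hs
        linear_combination -hs'
      rw [h2]
      exact neg_mem (Ideal.mul_mem_left _ _ hc)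
    refine ha₀t ?_
    have h2 := sub_mem h1 (Ideal.mul_mem_right c _ (Ideal.mem_span_singleton_self t))
    rwa [add_sub_cancel_right] at h2
  · obtain ⟨s, hs⟩ := hlim k
    obtain ⟨b, hb, v, hv, hbv⟩ := Submodule.mem_sup.mp (ha k (k + 1))
    obtain ⟨c, rfl⟩ := Ideal.mem_span_singleton'.mp hv
    refine ⟨b, hb, algebraMap R _ c + s, ?_⟩
    rw [hs, ← hbv, map_add, map_mul, map_pow]
    ring

/-- If `R` is analytically unramified then its conductor is regular. -/
lemma exists_forall_smul_eq_of_isAnalyticallyUnramified (h : IsAnalyticallyUnramified R) :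
    ∃ z ∈ nonZeroDivisors R, ∀ q : FractionRing R, IsIntegral R q →
      ∃ c, algebraMap R (FractionRing R) c = z • q := by
  have hred : IsReduced (Completion R) := h
  obtain ⟨t, htm, ht⟩ := isRegularIdeal_maximalIdeal (R := R)
  have h1 : ∃ n, integralDivIdeal t n ≤ Ideal.span {t} := by
    by_contra! hn
    obtain ⟨e, he, hek⟩ := exists_completion_of_not_le (integralDivIdeal_antitone t) htm ht hn
    refine he (eq_zero_of_forall_isIntegral (t := algebraMap R _ t)
      (by rw [AdicCompletion.maximalIdeal_eq_map]; exact Ideal.mem_map_of_mem _ htm)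
      (algebraMap_completion_mem_nonZeroDivisors ht) fun k => ?_)
    obtain ⟨a, ha, s, rfl⟩ := hek k
    obtain ⟨q, hq, hqa⟩ := mem_integralDivIdeal.mp ha
    refine ⟨fractionRingMap R q + algebraMap _ _ s, IsIntegral.add ?_ isIntegral_algebraMap, ?_⟩
    · exact hq.map_of_comp_eq (algebraMap R (Completion R)) (fractionRingMap R)
        (RingHom.ext fun a => (fractionRingMap_algebraMap a).symm)
    · rw [smul_add, ← map_pow, ← fractionRingMap_smul, hqa, fractionRingMap_algebraMap, map_add,
        map_mul, Algebra.smul_def]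
  obtain ⟨n, hn⟩ := h1
  refine ⟨t ^ n, pow_mem ht n, fun q hq => ?_⟩
  have hdesc : ∀ N, (∃ c, algebraMap R (FractionRing R) c = t ^ (n + N) • q) →
      ∃ c, algebraMap R (FractionRing R) c = t ^ n • q := by
    intro N
    induction N with
    | zero => exact id
    | succ N ih =>
      rintro ⟨c, hc⟩
      obtain ⟨d, rfl⟩ := Ideal.mem_span_singleton'.mp (hn (integralDivIdeal_antitone t
        (by omega : n ≤ n + (N + 1)) (mem_integralDivIdeal.mpr ⟨q, hq, hc.symm⟩)))
      refine ih ⟨d, smul_fractionRing_cancel ht ?_⟩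
      rw [smul_smul, ← pow_succ', add_assoc, ← hc, map_mul, Algebra.smul_def, mul_comm]
  obtain ⟨z, hz, a, ha⟩ := exists_smul_eq_algebraMap q
  obtain ⟨k, hk⟩ := exists_pow_le_span hz
  obtain ⟨w, hw⟩ := Ideal.mem_span_singleton'.mp (hk (Ideal.pow_mem_pow htm k))
  refine hdesc k ⟨t ^ n * w * a, ?_⟩
  rw [pow_add, ← hw, ← mul_assoc, mul_smul _ z, ha, Algebra.smul_def, ← map_mul]

end Chevalley

section Converse

lemma projective_of_smul_ext_syzygy_eq_zero {R B : Type u} [CommRing R] [CommRing B] [Algebra R B]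
    [Module.IsTorsionFree R B] [IsLocalRing R] [IsNoetherianRing R] [IsOneDimCM R] {y : B} {z : R}
    (hy : y ∈ nonZeroDivisors B) (hyI : (maximalIdeal R).map (algebraMap R B) = Ideal.span {y})
    (hz : z ∈ nonZeroDivisors R) (hzB : ∀ b : B, ∃ c : R, algebraMap R B c = z • b)
    (M : Type u) [AddCommGroup M] [Module R M] [Module B M] [IsScalarTower R B M]
    [Module.Finite R M] [Module.IsTorsionFree R M] (h : MaximalIdealKillsExt R M (syzygy R M)) :
    Module.Projective B M := by
  have hp := minimalCover_surjective (R := R) M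
  obtain ⟨t, htI, ht⟩ := isRegularIdeal_maximalIdeal (R := R)
  have hyM := isSMulRegular_of_map_eq_span hyI htI ht M
  refine projective_of_forall_exists_extension hy hyI hyM hz hzB hp
    (fun w hw i => mem_maximalIdeal_of_mem_syzygy M hw i) fun a ha => ?_
  obtain ⟨g, hg⟩ := (smul_ext_eq_zero_iff (minimalCover R M) hp a).mp (h a ha) LinearMap.id
  refine ⟨freeMap R B _ ∘ₗ (syzygy R M).subtype ∘ₗ g, fun v => freeMap_mem_kerSpan (g v).2,
    fun w hw => ?_⟩
  rw [LinearMap.comp_apply, ← map_smul]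
  exact congrArg _ (congrArg Subtype.val (hg ⟨w, hw⟩))

variable {R : Type u} [CommRing R] [IsLocalRing R] [IsNoetherianRing R] [IsOneDimCM R] {r : ℕ} {x : R}

lemma IsReduction.maxLocPrincipal_of_maximalIdealKillsExt (hx : IsReduction (maximalIdeal R) r x)
    (hR : IsAnalyticallyUnramified R)
    (h : MaximalIdealKillsExt R (conductorIdeal R) (syzygy R (conductorIdeal R))) :
    MaxLocPrincipal (blowUp (maximalIdeal R)) := by
  have hI := isRegularIdeal_maximalIdeal (R := R)
  have := hx.finite_blowUp hI
  obtain ⟨y, hy, hyI⟩ := hx.exists_map_eq_span hI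
  obtain ⟨z, hz, hzB⟩ := hx.exists_forall_smul_eq hI
  obtain ⟨s, hs, hsR⟩ := exists_forall_smul_eq_of_isAnalyticallyUnramified hR
  have hsc : s ∈ conductorIdeal R := by
    refine Submodule.mem_comap.mpr (Submodule.mem_div_iff_forall_mul_mem.mpr fun q hq => ?_)
    obtain ⟨c, hc⟩ := hsR q hq
    rw [Algebra.linearMap_apply, ← Algebra.smul_def, ← hc]
    exact Submodule.mem_one.mpr ⟨c, rfl⟩
  obtain ⟨_, _⟩ := exists_module_of_forall (B := blowUp (maximalIdeal R)) (M := conductorIdeal R)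
    fun b v => by
      obtain ⟨w, hw, hwb⟩ := exists_mem_conductorIdeal (le_integralClosure _ b.2) v.2
      obtain ⟨z, hz, a, ha⟩ := IsBirational.exists_smul_eq (R := R) b
      refine ⟨⟨w, hw⟩, z, hz, a, ha, Subtype.ext (IsFractionRing.injective R (FractionRing R) ?_)⟩
      change algebraMap R (FractionRing R) (z * w) = algebraMap R (FractionRing R) (a * v)
      rw [map_mul, hwb, ← mul_assoc, ← Algebra.smul_def, map_mul]
      exact congrArg (· * _) (congrArg Subtype.val ha)
  have hproj := projective_of_smul_ext_syzygy_eq_zero hy hyI hz hzB (conductorIdeal R) h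
  have : Module.Finite (blowUp (maximalIdeal R)) (conductorIdeal R) :=
    Module.Finite.of_restrictScalars_finite R _ _
  obtain ⟨k, v, p, hp, hsum⟩ := exists_sum_mul_eq_one (B := blowUp (maximalIdeal R))
    (Algebra.linearMap R (FractionRing R) ∘ₗ (conductorIdeal R).subtype)
    ((IsFractionRing.injective R (FractionRing R)).comp (conductorIdeal R).injective_subtype)
    (x₀ := ⟨s, hsc⟩) (isUnit_algebraMap_fractionRing hs)
  refine maxLocPrincipal_of_integralClosure_le fun q hq => ?_
  have h1 : q = ∑ j, p j * (q * algebraMap R (FractionRing R) (v j : R)) := by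
    calc q = q * ∑ j, p j * algebraMap R (FractionRing R) (v j : R) := by
          rw [show ∑ j, p j * algebraMap R (FractionRing R) (v j : R) = 1 from hsum, mul_one]
      _ = _ := by
          rw [Finset.mul_sum]
          exact Finset.sum_congr rfl fun j _ => by ring
  rw [h1]
  refine Subalgebra.sum_mem _ fun j _ => ?_
  obtain ⟨c, hc, hcq⟩ := exists_mem_conductorIdeal hq (v j).2
  rw [← hcq]
  exact hp j ⟨c, hc⟩

end Converse

end UlrichSplit
theorem theorem1p2 (R : Type u) [CommRing R] [IsLocalRing R] [IsNoetherianRing R]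
    (hCM : IsCohenMacaulayLocal R) (hdim : ringKrullDim R = 1)
    (I : Ideal R) (hIm : I ≤ maximalIdeal R) (hI : IsRegularIdeal I) :
    haveI : IsLocalRing (fiberSquare I) := isLocalRing_fiberSquare hIm
    List.TFAE
      [UlrichSequencesSplit I,
        UlrichSequencesSplit (fiberSquareIdeal I),
        IsRegularRing (blowUp I),
        ∀ᶠ n : ℕ in atTop,
          traceIdeal R (I ^ n : Ideal R) = conductorIdeal R ∧ Module.IsReflexive R (I ^ n : Ideal R)] ∧
    (I = maximalIdeal R →
      List.TFAE
        [UlrichSequencesSplit I,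
          UlrichSequencesSplit (fiberSquareIdeal I),
          IsRegularRing (blowUp I),
          ∀ᶠ n : ℕ in atTop,
            traceIdeal R (I ^ n : Ideal R) = conductorIdeal R ∧
              Module.IsReflexive R (I ^ n : Ideal R),
          ∀ (M N : Type u) [AddCommGroup M] [Module R M] [AddCommGroup N] [Module R N],
            IsUlrich R M → IsUlrich R N → MaximalIdealKillsExt R M N,
          IsUlrichSplit (Completion R)]) ∧
    (I = maximalIdeal R → ¬ IsRegularLocalRing R → HasMinimalMultiplicity R →
      List.TFAE
        [UlrichSequencesSplit I,
          UlrichSequencesSplit (fiberSquareIdeal I),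
          IsRegularRing (blowUp I),
          ∀ᶠ n : ℕ in atTop,
            traceIdeal R (I ^ n : Ideal R) = conductorIdeal R ∧
              Module.IsReflexive R (I ^ n : Ideal R),
          ∀ (M N : Type u) [AddCommGroup M] [Module R M] [AddCommGroup N] [Module R N],
            IsUlrich R M → IsUlrich R N → MaximalIdealKillsExt R M N,
          IsUlrichSplit (Completion R),
          Nonempty (maximalIdeal R ≃ₗ[R] conductorIdeal R),
          IsAnalyticallyUnramified R ∧
            MaximalIdealKillsExt R (conductorIdeal R) (syzygy R (conductorIdeal R))]) := by
  have := isOneDimCM_of_isCohenMacaulayLocal hCM hdim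
  obtain ⟨r, x, hx⟩ := exists_isReduction hIm hI
  have : IsLocalRing (fiberSquare I) := isLocalRing_fiberSquare hIm
  have := hx.finite_blowUp hI
  have h1 : UlrichSequencesSplit I ↔ MaxLocPrincipal (blowUp I) := hx.ulrichSequencesSplit_iff hI
  have h2 : UlrichSequencesSplit (fiberSquareIdeal I) ↔ MaxLocPrincipal (blowUp I) :=
    (hx.ulrichSequencesSplit_fiberSquare_iff hIm hI).trans h1
  have h3 : IsRegularRing (blowUp I) ↔ MaxLocPrincipal (blowUp I) :=
    isRegularRing_iff_maxLocPrincipal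
  have h4 := hx.eventually_trace_iff hI
  refine ⟨?_, ?_, ?_⟩
  · rw [h1, h2, h3, h4]
    tfae_finish
  · rintro rfl
    rw [h1, h2, h3, h4, hx.forall_maximalIdealKillsExt_iff, hx.isUlrichSplit_completion_iff]
    tfae_finish
  · rintro rfl hR hmin
    have hU := hx.isUlrich_maximalIdeal hmin
    rw [h1, h2, h3, h4, hx.forall_maximalIdealKillsExt_iff, hx.isUlrichSplit_completion_iff]
    tfae_have 1 → 7 := fun h =>
      ⟨LinearEquiv.ofEq _ _ (hx.conductorIdeal_eq hR hU h).symm⟩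
    tfae_have 7 → 1 := fun ⟨e⟩ => hx.maxLocPrincipal_of_linearEquiv e
    tfae_have 1 → 8 := fun h =>
      ⟨hx.isAnalyticallyUnramified h, hx.maximalIdealKillsExt_conductorIdeal hR hU h⟩
    tfae_have 8 → 1 := fun ⟨hS, hE⟩ => hx.maxLocPrincipal_of_maximalIdealKillsExt hS hE
    tfae_finish
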